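/- Let $m,n\ge 1$ be integers, $I=\{1,\dots,m+n\}$, $I'=\{1,\dots,m+n-1\}$. Work over $\mathbb{C}(q)$, put $p=-q^{-1}$, and let $q_a=q$ for $a\le m$ and $q_a=p$ for $a>m$. Let $\mathrm U=\mathrm U_q(\mathfrak{gl}_{m,n})$ be the unital associative $\mathbb{C}(q)$-algebra generated by $e_a,f_a$ ($a\in I'$) and $K_b^{\pm1}$ ($b\in I$) with relations $$K_aK_a^{-1}=1,\quad K_a^{\pm1}K_b^{\pm1}=K_b^{\pm1}K_a^{\pm1},\quad K_ae_bK_a^{-1}=q_a^{\delta_{ab}-\delta_{a,b+1}}e_b,\quad K_af_bK_a^{-1}=q_a^{-\delta_{ab}+\delta_{a,b+1}}f_b,$$ $$e_af_b-f_be_a=\delta_{ab}\frac{k_a-k_a^{-1}}{q_a-q_a^{-1}}\ \ (k_a=K_aK_{a+1}^{-1}),\qquad e_ae_b=e_be_a,\ f_af_b=f_bf_a\ \ (|a-b|>1),$$ $$x_a^2x_{a\pm1}-(q_a+q_a^{-1})x_ax_{a\pm1}x_a+x_{a\pm1}x_a^2=0\ \ (x=e,f;\ a\ne m),\qquad e_m^2=f_m^2=0,$$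 and, if $m,n\ge2$, $[e_m,E_{m-1,m+2}]=0=[f_m,E_{m+2,m-1}]$, where $[A,B]_x=AB-xBA$, $[A,B]=[A,B]_1$, $E_{m-1,m+2}=[[e_{m-1},e_m]_{q_m^{-1}},e_{m+1}]_{q_{m+1}^{-1}}$ and $E_{m+2,m-1}=[f_{m+1},[f_m,f_{m-1}]_{q_m}]_{q_{m+1}}$. Let $\mathrm U_q(\mathfrak g_0)\subset\mathrm U$ be the subalgebra generated by all $K_b^{\pm1}$ and by $e_a,f_a$ with $a\neq m$, and let $\mathrm U_q(\mathfrak p)\subset\mathrm U$ be the subalgebra generated by $\mathrm U_q(\mathfrak g_0)$ and $e_m$. For $\Lambda=(\lambda_1,\dots,\lambda_{m+n})$ with all $\lambda_a\in\mathbb{C}(q)^*=\mathbb{C}(q)\setminus\{0\}$, let $L^0(\Lambda)$ be the simple highest weight $\mathrm U_q(\mathfrak g_0)$-module with highest weight $\Lambda$: it is generated by a nonzero vector $v$ with $e_av=0$ ($a\ne m$) and $K_bv=\lambda_bv$ ($b\in I$), and it is the quotient of the universal such module (the Verma module) by the sum of all its proper submodules. Make it a $\mathrm U_q(\mathfrak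 p)$-module by $e_mL^0(\Lambda)=0$, put $V(\Lambda)=\mathrm U\otimes_{\mathrm U_q(\mathfrak p)}L^0(\Lambda)$, let $M(\Lambda)$ be the sum of all submodules of $V(\Lambda)$ having zero intersection with $1\otimes L^0(\Lambda)$, and $L(\Lambda)=V(\Lambda)/M(\Lambda)$. Then $L^0(\Lambda)$ is a simple $\mathrm U_q(\mathfrak g_0)$-module, $L(\Lambda)$ is a simple $\mathrm U$-module generated by a highest weight vector of weight $\Lambda$ (a nonzero $v$ with $e_av=0$ for all $a\in I'$ and $K_bv=\lambda_bv$ for all $b\in I$), $L(\Lambda)$ is a weight module (spanned by simultaneous eigenvectors of the $K_b$ with eigenvalues in $\mathbb{C}(q)^*$), and $L(\Lambda)$ is finite dimensional over $\mathbb{C}(q)$ if and only if $$\frac{\lambda_a}{\lambda_{a+1}}=\omega_aq_a^{\ell_a}\quad\text{with }\ell_a\in\mathbb{Z}_{\ge 0},\ \omega_a=\pm1,\quad\text{for all } a\in I',\ a\neq m.\qquad(*)$$ Consequently the finite dimensional simple weight modules of $\mathrm U$ are parametrised, up to isomorphism, by $\{\pm1\}^{m+n-2}\times\mathbb{Z}_{\ge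 0}^{m+n-2}\times\mathbb{C}(q)^*\times\mathbb{C}(q)^*$: for every $(\omega,\ell,c,d)$ in this set there is exactly one $\Lambda$ which satisfies $(*)$ with these $\omega_a,\ell_a$ and has $\lambda_m=c$, $\lambda_{m+1}=d$; the module $L(\Lambda)$ is then finite dimensional; and every finite dimensional simple weight module of $\mathrm U$ is isomorphic to the $L(\Lambda)$ obtained from exactly one $(\omega,\ell,c,d)$. -/

import Mathlib

open scoped TensorProduct

noncomputable section

namespace DegenerateQuantumGL

/-- The ground field `ℂ(q)` of rational functions in the indeterminate `q`. -/
abbrev Cq : Type := RatFunc ℂ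

/-- The indeterminate `q`. -/
def q : Cq := RatFunc.X

/-- The index set `I = {1, …, m + n}`. -/
abbrev I (m n : ℕ) : Type := Set.Icc 1 (m + n)

/-- The index set `I' = {1, …, m + n - 1}`. -/
abbrev I' (m n : ℕ) : Type := Set.Ico 1 (m + n)

/-- `a ∈ I'` regarded as an element of `I`. -/
def I'.inc {m n : ℕ} (a : I' m n) : I m n := ⟨a, a.2.1, a.2.2.le⟩

/-- `a + 1 ∈ I` for `a ∈ I'`. -/
def I'.next {m n : ℕ} (a : I' m n) : I m n := ⟨a + 1, by omega, a.2.2⟩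

/-- `q_a = q` for `a ≤ m`, and `q_a = p = -q⁻¹` for `a > m`. -/
def qa (m a : ℕ) : Cq := if a ≤ m then q else -q⁻¹

/-- The generators `e_a, f_a` (`a ∈ I'`) and `K_b, K_b⁻¹` (`b ∈ I`). -/
inductive Gen (m n : ℕ) : Type
  | e (a : I' m n)
  | f (a : I' m n)
  | K (b : I m n)
  | Kinv (b : I m n)

/-- The `x`-commutator `[A, B]_x = A B - x B A`. -/
def xcomm {A : Type*} [Ring A] [Algebra Cq A] (x : Cq) (a b : A) : A := a * b - x • (b * a)

section Relations

variable {m n : ℕ}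

/-- Generators as elements of the free algebra. -/
abbrev fe (a : I' m n) : FreeAlgebra Cq (Gen m n) := FreeAlgebra.ι Cq (Gen.e a)
/-- Generators as elements of the free algebra. -/
abbrev ff (a : I' m n) : FreeAlgebra Cq (Gen m n) := FreeAlgebra.ι Cq (Gen.f a)
/-- Generators as elements of the free algebra. -/
abbrev fK (b : I m n) : FreeAlgebra Cq (Gen m n) := FreeAlgebra.ι Cq (Gen.K b)
/-- Generators as elements of the free algebra. -/
abbrev fKinv (b : I m n) : FreeAlgebra Cq (Gen m n) := FreeAlgebra.ι Cq (Gen.Kinv b)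

end Relations

/-- The defining relations of `U_q(gl_{m,n})`. In `quartic_e` and `quartic_f` the indices are forced
to be `a = m - 1`, `b = m`, `c = m + 1`, so these relations are vacuous when `m = 1` or `n = 1`. -/
inductive Rel (m n : ℕ) : FreeAlgebra Cq (Gen m n) → FreeAlgebra Cq (Gen m n) → Prop
  | K_mul_Kinv (a : I m n) : Rel m n (fK a * fKinv a) 1
  | K_comm_K (a b : I m n) : Rel m n (fK a * fK b) (fK b * fK a)
  | K_comm_Kinv (a b : I m n) : Rel m n (fK a * fKinv b) (fKinv b * fK a)
  | Kinv_comm_Kinv (a b : I m n) : Rel m n (fKinv a * fKinv b) (fKinv b * fKinv a)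
  | K_e (a : I m n) (b : I' m n) : Rel m n (fK a * fe b * fKinv a)
      ((qa m a ^ ((if (a : ℕ) = b then 1 else 0) - (if (a : ℕ) = b + 1 then 1 else 0) : ℤ)) • fe b)
  | K_f (a : I m n) (b : I' m n) : Rel m n (fK a * ff b * fKinv a)
      ((qa m a ^ (-(if (a : ℕ) = b then 1 else 0) + (if (a : ℕ) = b + 1 then 1 else 0) : ℤ)) • ff b)
  | e_f_same (a : I' m n) : Rel m n (fe a * ff a - ff a * fe a)
      ((qa m a - (qa m a)⁻¹)⁻¹ • (fK a.inc * fKinv a.next - fK a.next * fKinv a.inc))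
  | e_f_ne (a b : I' m n) (h : a ≠ b) : Rel m n (fe a * ff b - ff b * fe a) 0
  | e_comm (a b : I' m n) (h : (a : ℕ) + 1 < b ∨ (b : ℕ) + 1 < a) :
      Rel m n (fe a * fe b) (fe b * fe a)
  | f_comm (a b : I' m n) (h : (a : ℕ) + 1 < b ∨ (b : ℕ) + 1 < a) :
      Rel m n (ff a * ff b) (ff b * ff a)
  | serre_e (a b : I' m n) (ha : (a : ℕ) ≠ m) (h : (b : ℕ) = a + 1 ∨ (a : ℕ) = b + 1) :
      Rel m n (fe a * fe a * fe b - (qa m a + (qa m a)⁻¹) • (fe a * fe b * fe a)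
        + fe b * fe a * fe a) 0
  | serre_f (a b : I' m n) (ha : (a : ℕ) ≠ m) (h : (b : ℕ) = a + 1 ∨ (a : ℕ) = b + 1) :
      Rel m n (ff a * ff a * ff b - (qa m a + (qa m a)⁻¹) • (ff a * ff b * ff a)
        + ff b * ff a * ff a) 0
  | e_sq (a : I' m n) (ha : (a : ℕ) = m) : Rel m n (fe a * fe a) 0
  | f_sq (a : I' m n) (ha : (a : ℕ) = m) : Rel m n (ff a * ff a) 0
  | quartic_e (a b c : I' m n) (ha : (a : ℕ) + 1 = m) (hb : (b : ℕ) = m) (hc : (c : ℕ) = m + 1) :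
      Rel m n (fe b * xcomm (qa m (m + 1))⁻¹ (xcomm (qa m m)⁻¹ (fe a) (fe b)) (fe c))
        (xcomm (qa m (m + 1))⁻¹ (xcomm (qa m m)⁻¹ (fe a) (fe b)) (fe c) * fe b)
  | quartic_f (a b c : I' m n) (ha : (a : ℕ) + 1 = m) (hb : (b : ℕ) = m) (hc : (c : ℕ) = m + 1) :
      Rel m n (ff b * xcomm (qa m (m + 1)) (ff c) (xcomm (qa m m) (ff b) (ff a)))
        (xcomm (qa m (m + 1)) (ff c) (xcomm (qa m m) (ff b) (ff a)) * ff b)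

/-- The degenerate quantum general linear group `U_q(gl_{m,n})`. -/
def U (m n : ℕ) : Type := RingQuot (Rel m n)

instance (m n : ℕ) : Ring (U m n) := inferInstanceAs (Ring (RingQuot (Rel m n)))
instance (m n : ℕ) : Algebra Cq (U m n) := inferInstanceAs (Algebra Cq (RingQuot (Rel m n)))

section Generators

variable {m n : ℕ}

/-- The canonical projection from the free algebra. -/
def U.mk : FreeAlgebra Cq (Gen m n) →ₐ[Cq] U m n := RingQuot.mkAlgHom Cq (Rel m n)

theorem U.mk_rel {x y : FreeAlgebra Cq (Gen m n)} (h : Rel m n x y) : U.mk x = U.mk y :=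
  RingQuot.mkAlgHom_rel Cq h

/-- The universal property of the presentation. -/
def U.lift {A : Type*} [Ring A] [Algebra Cq A] (φ : FreeAlgebra Cq (Gen m n) →ₐ[Cq] A)
    (h : ∀ x y, Rel m n x y → φ x = φ y) : U m n →ₐ[Cq] A :=
  RingQuot.liftAlgHom Cq ⟨φ, fun {x y} => h x y⟩

theorem U.lift_mk {A : Type*} [Ring A] [Algebra Cq A] (φ : FreeAlgebra Cq (Gen m n) →ₐ[Cq] A)
    (h : ∀ x y, Rel m n x y → φ x = φ y) (x : FreeAlgebra Cq (Gen m n)) :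
    U.lift φ h (U.mk x) = φ x :=
  RingQuot.liftAlgHom_mkAlgHom_apply Cq φ (fun {x y} => h x y) x

/-- The generator `e_a` of `U_q(gl_{m,n})`. -/
def e (a : I' m n) : U m n := U.mk (fe a)
/-- The generator `f_a` of `U_q(gl_{m,n})`. -/
def f (a : I' m n) : U m n := U.mk (ff a)
/-- The generator `K_b` of `U_q(gl_{m,n})`. -/
def K (b : I m n) : U m n := U.mk (fK b)
/-- The generator `K_b⁻¹` of `U_q(gl_{m,n})`. -/
def Kinv (b : I m n) : U m n := U.mk (fKinv b)

end Generators

/-- Generators of `U_q(g₀)`: `e_a, f_a` with `a ≠ m` and all `K_b, K_b⁻¹`. -/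
inductive LeviGen (m n : ℕ) : U m n → Prop
  | e (a : I' m n) (ha : (a : ℕ) ≠ m) : LeviGen m n (e a)
  | f (a : I' m n) (ha : (a : ℕ) ≠ m) : LeviGen m n (f a)
  | K (b : I m n) : LeviGen m n (K b)
  | Kinv (b : I m n) : LeviGen m n (Kinv b)

/-- Generators of `U_q(p)`: all `e_a`, all `K_b, K_b⁻¹`, and `f_a` with `a ≠ m`. -/
inductive ParabolicGen (m n : ℕ) : U m n → Prop
  | e (a : I' m n) : ParabolicGen m n (e a)
  | f (a : I' m n) (ha : (a : ℕ) ≠ m) : ParabolicGen m n (f a)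
  | K (b : I m n) : ParabolicGen m n (K b)
  | Kinv (b : I m n) : ParabolicGen m n (Kinv b)

/-- The subalgebra `U_q(g₀) = U_q(gl_m) ⊗ U_p(gl_n)` of `U_q(gl_{m,n})`. -/
def Ug0 (m n : ℕ) : Subalgebra Cq (U m n) := Algebra.adjoin Cq {x | LeviGen m n x}

/-- The subalgebra `U_q(p)` of `U_q(gl_{m,n})`. -/
def Up (m n : ℕ) : Subalgebra Cq (U m n) := Algebra.adjoin Cq {x | ParabolicGen m n x}

section Grading

variable {m n : ℕ}

/-- The degree of `e_a`: `1` for `a = m` and `0` otherwise. -/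
def deg (a : I' m n) : ℤ := if (a : ℕ) = m then 1 else 0

/-- Homogeneous images of the generators in the Laurent polynomial algebra over `U_q(gl_{m,n})`. -/
def gradingGen : Gen m n → AddMonoidAlgebra (U m n) ℤ
  | .e a => AddMonoidAlgebra.single (deg a) (e a)
  | .f a => AddMonoidAlgebra.single (-deg a) (f a)
  | .K b => AddMonoidAlgebra.single 0 (K b)
  | .Kinv b => AddMonoidAlgebra.single 0 (Kinv b)

theorem gradingGen_rel (x y : FreeAlgebra Cq (Gen m n)) (h : Rel m n x y) :
    FreeAlgebra.lift Cq gradingGen x = FreeAlgebra.lift Cq gradingGen y := by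
  have h' := U.mk_rel h
  have s0 : ∀ (d : ℤ) {u v : U m n}, u = v →
      AddMonoidAlgebra.single d u = AddMonoidAlgebra.single d v := fun d u v h => h ▸ rfl
  cases h
  case' K_mul_Kinv a => replace h' := s0 0 h'
  case' K_comm_K a b => replace h' := s0 0 h'
  case' K_comm_Kinv a b => replace h' := s0 0 h'
  case' Kinv_comm_Kinv a b => replace h' := s0 0 h'
  case' K_e a b => replace h' := s0 (deg b) h'
  case' K_f a b => replace h' := s0 (-deg b) h'
  case' e_f_same a => replace h' := s0 0 h'
  case' e_f_ne a b _ => replace h' := s0 (deg a + -deg b) h'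
  case' e_comm a b _ => replace h' := s0 (deg a + deg b) h'
  case' f_comm a b _ => replace h' := s0 (-deg a + -deg b) h'
  case' serre_e a b _ _ => replace h' := s0 (deg a + (deg a + deg b)) h'
  case' serre_f a b _ _ => replace h' := s0 (-deg a + (-deg a + -deg b)) h'
  case' e_sq a _ => replace h' := s0 (deg a + deg a) h'
  case' f_sq a _ => replace h' := s0 (-deg a + -deg a) h'
  case' quartic_e a b c _ _ _ => replace h' := s0 (deg b + (deg b + (deg a + deg c))) h'
  case' quartic_f a b c _ _ _ => replace h' := s0 (-deg b + (-deg b + (-deg a + -deg c))) h'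
  all_goals
    simp only [xcomm, map_mul, map_sub, map_add, map_smul, map_one, map_zero,
      FreeAlgebra.lift_ι_apply, gradingGen, AddMonoidAlgebra.single_mul_single,
      AddMonoidAlgebra.smul_single, mul_sub, sub_mul, mul_smul_comm, smul_mul_assoc, smul_sub,
      AddMonoidAlgebra.single_sub, AddMonoidAlgebra.single_add, AddMonoidAlgebra.single_zero,
      ← AddMonoidAlgebra.one_def, e, f, K, Kinv, add_zero, zero_add] at h' ⊢
    try simp only [add_neg_cancel, neg_add_cancel]
    first
      | exact h'
      | (simp only [add_comm, add_left_comm, add_assoc] at h' ⊢; exact h')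

/-- The `ℤ`-grading of `U_q(gl_{m,n})` with `e_m` in degree `1`, `f_m` in degree `-1` and the other
generators in degree `0`, as the algebra homomorphism `u ↦ ∑ u_d T^d` into Laurent polynomials. -/
def grading : U m n →ₐ[Cq] AddMonoidAlgebra (U m n) ℤ :=
  U.lift (FreeAlgebra.lift Cq gradingGen) gradingGen_rel

theorem grading_e (a : I' m n) : grading (e a) = AddMonoidAlgebra.single (deg a) (e a) := by
  rw [grading, e, U.lift_mk, FreeAlgebra.lift_ι_apply]; rfl
theorem grading_f (a : I' m n) : grading (f a) = AddMonoidAlgebra.single (-deg a) (f a) := by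
  rw [grading, f, U.lift_mk, FreeAlgebra.lift_ι_apply]; rfl
theorem grading_K (b : I m n) : grading (K b) = AddMonoidAlgebra.single 0 (K b) := by
  rw [grading, K, U.lift_mk, FreeAlgebra.lift_ι_apply]; rfl
theorem grading_Kinv (b : I m n) : grading (Kinv b) = AddMonoidAlgebra.single 0 (Kinv b) := by
  rw [grading, Kinv, U.lift_mk, FreeAlgebra.lift_ι_apply]; rfl

theorem coeff_mul_neg {x y : AddMonoidAlgebra (U m n) ℤ} (hx : ∀ k < 0, x.coeff k = 0)
    (hy : ∀ k < 0, y.coeff k = 0) : ∀ k < 0, (x * y).coeff k = 0 := by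
  intro k hk
  rw [AddMonoidAlgebra.coeff_mul]
  refine Finset.sum_eq_zero fun i hi => Finset.sum_eq_zero fun j hj => ?_
  rw [Finsupp.mem_support_iff] at hi hj
  have h1 : 0 ≤ i := by by_contra h; exact hi (hx i (by omega))
  have h2 : 0 ≤ j := by by_contra h; exact hj (hy j (by omega))
  exact if_neg (by omega)

theorem coeff_mul_zero' {x y : AddMonoidAlgebra (U m n) ℤ} (hx : ∀ k < 0, x.coeff k = 0)
    (hy : ∀ k < 0, y.coeff k = 0) : (x * y).coeff 0 = x.coeff 0 * y.coeff 0 := by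
  rw [AddMonoidAlgebra.coeff_mul, Finsupp.sum, Finset.sum_eq_single 0]
  · rw [Finsupp.sum, Finset.sum_eq_single 0]
    · simp
    · intro j _ hj
      exact if_neg (by omega)
    · intro h
      rw [Finsupp.notMem_support_iff] at h
      simp [h]
  · intro i hi hi0
    refine Finset.sum_eq_zero fun j hj => ?_
    rw [Finsupp.mem_support_iff] at hi hj
    have h1 : 0 ≤ i := by by_contra h; exact hi (hx i (by omega))
    have h2 : 0 ≤ j := by by_contra h; exact hj (hy j (by omega))
    exact if_neg (by omega)
  · intro h
    rw [Finsupp.notMem_support_iff] at h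
    simp [h, Finsupp.sum]

theorem grading_Up {x : U m n} (hx : x ∈ Up m n) :
    (∀ k < 0, (grading x).coeff k = 0) ∧ (grading x).coeff 0 ∈ Ug0 m n := by
  induction hx using Algebra.adjoin_induction with
  | mem x hx =>
    cases hx with
    | e a =>
      rw [grading_e, deg, AddMonoidAlgebra.coeff_single]
      split_ifs with h
      · exact ⟨fun k hk => Finsupp.single_eq_of_ne (by omega),
          by rw [Finsupp.single_eq_of_ne (by omega)]; exact zero_mem _⟩
      · exact ⟨fun k hk => Finsupp.single_eq_of_ne (by omega),
          by rw [Finsupp.single_eq_same]; exact Algebra.subset_adjoin (.e a h)⟩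
    | f a h =>
      rw [grading_f, deg, if_neg h, neg_zero, AddMonoidAlgebra.coeff_single]
      exact ⟨fun k hk => Finsupp.single_eq_of_ne (by omega),
          by rw [Finsupp.single_eq_same]; exact Algebra.subset_adjoin (.f a h)⟩
    | K b =>
      rw [grading_K, AddMonoidAlgebra.coeff_single]
      exact ⟨fun k hk => Finsupp.single_eq_of_ne (by omega),
          by rw [Finsupp.single_eq_same]; exact Algebra.subset_adjoin (.K b)⟩
    | Kinv b =>
      rw [grading_Kinv, AddMonoidAlgebra.coeff_single]
      exact ⟨fun k hk => Finsupp.single_eq_of_ne (by omega),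
          by rw [Finsupp.single_eq_same]; exact Algebra.subset_adjoin (.Kinv b)⟩
  | algebraMap r =>
    have : grading (algebraMap Cq (U m n) r)
        = AddMonoidAlgebra.single 0 (algebraMap Cq (U m n) r) := by
      rw [AlgHom.commutes]; rfl
    rw [this, AddMonoidAlgebra.coeff_single]
    exact ⟨fun k hk => Finsupp.single_eq_of_ne (by omega),
      by rw [Finsupp.single_eq_same]; exact Subalgebra.algebraMap_mem _ r⟩
  | add x y _ _ hx hy =>
    rw [map_add, AddMonoidAlgebra.coeff_add]
    exact ⟨fun k hk => by rw [Finsupp.add_apply, hx.1 k hk, hy.1 k hk, add_zero],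
      add_mem hx.2 hy.2⟩
  | mul x y _ _ hx hy =>
    rw [map_mul]
    exact ⟨coeff_mul_neg hx.1 hy.1, by rw [coeff_mul_zero' hx.1 hy.1]; exact mul_mem hx.2 hy.2⟩

/-- The algebra homomorphism `U_q(p) → U_q(g₀)` which sends `e_m` to `0` and is the identity on
`U_q(g₀)`: it takes the component of degree `0`. -/
def toLevi (m n : ℕ) : Up m n →+* Ug0 m n where
  toFun x := ⟨(grading (x : U m n)).coeff 0, (grading_Up x.2).2⟩
  map_zero' := by ext; simp
  map_one' := by
    ext
    simp only [OneMemClass.coe_one, map_one]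
    rw [AddMonoidAlgebra.one_def, AddMonoidAlgebra.coeff_single, Finsupp.single_eq_same]
  map_add' x y := by ext; simp
  map_mul' x y := by
    ext
    simp only [MulMemClass.coe_mul, map_mul]
    exact coeff_mul_zero' (grading_Up x.2).1 (grading_Up y.2).1

theorem toLevi_e_m (a : I' m n) (ha : (a : ℕ) = m) :
    toLevi m n ⟨e a, Algebra.subset_adjoin (.e a)⟩ = 0 := by
  ext
  change (grading (e a)).coeff 0 = 0
  rw [grading_e, deg, if_pos ha, AddMonoidAlgebra.coeff_single, Finsupp.single_eq_of_ne (by omega)]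

theorem toLevi_of_Ug0 {x : U m n} (hx : x ∈ Ug0 m n) (hp : x ∈ Up m n) :
    toLevi m n ⟨x, hp⟩ = ⟨x, hx⟩ := by
  have : grading x = AddMonoidAlgebra.single 0 x := by
    clear hp
    induction hx using Algebra.adjoin_induction with
    | mem x hx =>
      cases hx with
      | e a h => rw [grading_e, deg, if_neg h]
      | f a h => rw [grading_f, deg, if_neg h, neg_zero]
      | K b => exact grading_K b
      | Kinv b => exact grading_Kinv b
    | algebraMap r => rw [AlgHom.commutes]; rfl
    | add x y _ _ hx hy => rw [map_add, hx, hy, AddMonoidAlgebra.single_add]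
    | mul x y _ _ hx hy =>
      rw [map_mul, hx, hy, AddMonoidAlgebra.single_mul_single, add_zero]
  ext
  change (grading x).coeff 0 = x
  rw [this, AddMonoidAlgebra.coeff_single, Finsupp.single_eq_same]

end Grading

section InducedModule

variable {A : Type*} [Ring A] [Algebra Cq A]

/-- The `A`-submodule of `A ⊗ M` generated by all `a b ⊗ w - a ⊗ b w` with `b ∈ B`. -/
def balancing (B : Subalgebra Cq A) (M : Type*) [AddCommGroup M] [Module Cq M] [Module B M] :
    Submodule A (A ⊗[Cq] M) :=
  Submodule.span A {t | ∃ (a : A) (b : B) (w : M), t = (a * b) ⊗ₜ[Cq] w - a ⊗ₜ[Cq] (b • w)}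

/-- The `A`-module `A ⊗_B M` induced from a module `M` over a subalgebra `B`. -/
abbrev Induced (B : Subalgebra Cq A) (M : Type*) [AddCommGroup M] [Module Cq M] [Module B M] :
    Type _ :=
  (A ⊗[Cq] M) ⧸ balancing B M

end InducedModule

/-- An `m + n`-tuple `Λ = (λ_1, …, λ_{m+n})` of nonzero elements of `ℂ(q)`. -/
abbrev Weight (m n : ℕ) : Type := I m n → Cqˣ

section Modules

variable {m n : ℕ}

/-- The left ideal of `U_q(g₀)` generated by `e_a` (`a ≠ m`) and `K_b - λ_b`. -/
def vermaIdeal (Λ : Weight m n) : Submodule (Ug0 m n) (Ug0 m n) :=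
  Submodule.span (Ug0 m n)
    ({x | ∃ a : I' m n, (a : ℕ) ≠ m ∧ (x : U m n) = e a} ∪
      {x | ∃ b : I m n, (x : U m n) = K b - algebraMap Cq (U m n) (Λ b)})

/-- The left ideal whose quotient by `vermaIdeal` is the largest proper submodule of the
Verma module: the sum of all proper left ideals containing `vermaIdeal`. -/
def maxIdeal (Λ : Weight m n) : Submodule (Ug0 m n) (Ug0 m n) :=
  sSup {N | vermaIdeal Λ ≤ N ∧ N ≠ ⊤}

/-- The simple `U_q(g₀)`-module `L⁰(Λ)` with highest weight `Λ`: the simple quotient of the Verma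
module of highest weight `Λ`. -/
def L0 (Λ : Weight m n) : Type := Ug0 m n ⧸ maxIdeal Λ

instance (Λ : Weight m n) : AddCommGroup (L0 Λ) :=
  inferInstanceAs (AddCommGroup (Ug0 m n ⧸ maxIdeal Λ))
instance (Λ : Weight m n) : Module (Ug0 m n) (L0 Λ) :=
  inferInstanceAs (Module (Ug0 m n) (Ug0 m n ⧸ maxIdeal Λ))
instance (Λ : Weight m n) : Module Cq (L0 Λ) :=
  inferInstanceAs (Module Cq (Ug0 m n ⧸ maxIdeal Λ))
instance (Λ : Weight m n) : IsScalarTower Cq (Ug0 m n) (L0 Λ) :=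
  inferInstanceAs (IsScalarTower Cq (Ug0 m n) (Ug0 m n ⧸ maxIdeal Λ))

/-- `L⁰(Λ)` as a `U_q(p)`-module, with `e_m L⁰(Λ) = 0`. -/
instance (Λ : Weight m n) : Module (Up m n) (L0 Λ) := Module.compHom (L0 Λ) (toLevi m n)

/-- The generalised Verma module `V(Λ) = U_q(gl_{m,n}) ⊗_{U_q(p)} L⁰(Λ)`. -/
abbrev V (Λ : Weight m n) : Type := Induced (Up m n) (L0 Λ)

/-- The map `w ↦ 1 ⊗ w` from `L⁰(Λ)` to `V(Λ)`. -/
def V.incl (Λ : Weight m n) (w : L0 Λ) : V Λ :=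
  Submodule.Quotient.mk ((1 : U m n) ⊗ₜ[Cq] w)

/-- `M(Λ)`: the sum of all submodules of `V(Λ)` having zero intersection with `1 ⊗ L⁰(Λ)`. -/
def M (Λ : Weight m n) : Submodule (U m n) (V Λ) :=
  sSup {N | ∀ w : L0 Λ, V.incl Λ w ∈ N → V.incl Λ w = 0}

/-- The `U_q(gl_{m,n})`-module `L(Λ) = V(Λ) / M(Λ)`. -/
abbrev L (Λ : Weight m n) : Type := V Λ ⧸ M Λ

/-- `W` is generated over `U_q(gl_{m,n})` by a highest weight vector of weight `Λ`. -/
def IsHighestWeightModule (Λ : Weight m n) (W : Type*) [AddCommGroup W] [Module Cq W]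
    [Module (U m n) W] : Prop :=
  ∃ v : W, v ≠ 0 ∧ (∀ a : I' m n, e a • v = 0) ∧ (∀ b : I m n, K b • v = (Λ b : Cq) • v) ∧
    Submodule.span (U m n) {v} = ⊤

/-- The condition `λ_a / λ_{a+1} = ± q_a^{ℓ_a}` with `ℓ_a ∈ ℤ_+`, for all `a ≠ m`. -/
def FDCondition (Λ : Weight m n) : Prop :=
  ∃ (ω : I' m n → ℤˣ) (ℓ : I' m n → ℕ), ∀ a : I' m n, (a : ℕ) ≠ m →
    (Λ a.inc : Cq) / (Λ a.next : Cq) = ((ω a : ℤ) : Cq) * qa m a ^ ℓ a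

/-- `W` is a weight module: it is spanned by simultaneous eigenvectors of all the `K_b`, with
eigenvalues in `ℂ(q)`. -/
def IsWeightModule (m n : ℕ) (W : Type*) [AddCommGroup W] [Module Cq W] [Module (U m n) W] :
    Prop :=
  Submodule.span Cq {w : W | ∃ Λ : Weight m n, ∀ b : I m n, K b • w = (Λ b : Cq) • w} = ⊤

end Modules

/-- Parameters: a sign and a nonnegative integer for each of the `m + n - 2` indices
`a ∈ I'`, `a ≠ m`, and two nonzero scalars. -/
abbrev Params (m n : ℕ) : Type :=
  ({a : I' m n // (a : ℕ) ≠ m} → ℤˣ) × ({a : I' m n // (a : ℕ) ≠ m} → ℕ) × Cqˣ × Cqˣ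

/-- `Λ` has parameters `(ω, ℓ, c, d)` if `λ_a / λ_{a+1} = ω_a q_a^{ℓ_a}` for all `a ≠ m`,
`λ_m = c` and `λ_{m+1} = d`. -/
def HasParams {m n : ℕ} (Λ : Weight m n) (x : Params m n) : Prop :=
  (∀ a : {a : I' m n // (a : ℕ) ≠ m},
    (Λ a.1.inc : Cq) / (Λ a.1.next : Cq) = ((x.1 a : ℤ) : Cq) * qa m a.1 ^ x.2.1 a) ∧
  (∀ b : I m n, (b : ℕ) = m → Λ b = x.2.2.1) ∧ (∀ b : I m n, (b : ℕ) = m + 1 → Λ b = x.2.2.2)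

end DegenerateQuantumGL

end

/-!
The hard point is that `L(Λ)` is finite dimensional under the integrality condition `FDCondition`.
No Poincaré–Birkhoff–Witt theorem is used: every module is studied through the spanning set of
*words* `f_{a₁} f_{a₂} ⋯ v` in a highest weight vector `v`.

*Odd letters.* In the subalgebra generated by the `f`'s, iterated `q`-commutators of `f_m` with the
other `f`'s give `m n` odd root vectors. The Serre relations, `f_m² = 0` and the quartic relation
imply that they square to zero and that a product of two of them can be straightened
(`IsOddPair.oddSpan_mul_le`). The other `f`'s `q`-commute with them up to odd root vectors, so a
word with more than `m n` letters `f_m` vanishes (`prod_f_eq_zero`).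

*Heights.* A suitable monomial `∏ K_b ^ r_b` acts on a word of height `h` by a constant times
`q ^ (-2 h)`. Since `q` is not a root of unity, `v` is not a combination of nonempty words
(`CartanData.IsSingular.notMem_posSpan`). Hence a module generated by `v` has a largest proper
submodule; this gives the simplicity of `L⁰(Λ)` and `L(Λ)` and identifies every simple module of
highest weight `Λ` with `L(Λ)` (`nonempty_equiv_L`), once `V(Λ)` is known to be nonzero.

*Existence.* A nonzero module of highest weight `Λ` is constructed on the space with basis all
words in the `f`'s. The `e`'s are defined by the commutation rule with the `f`'s, so that only the
relations among the `f`'s alone, or among the `e`'s alone, can fail. Divide by the largest stable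
subspace of vectors without component along the empty word. Each of the missing relations is an
operator that commutes with all `e`'s (or all `f`'s), and such an operator vanishes on the quotient
(`WordSpace.eq_zero_of_commute_E`, `WordSpace.eq_zero_of_commute_F`, `exists_reduced_module`).

*Finite dimensionality.* For `a ≠ m` the elements `e_a, f_a` generate a copy of quantum `sl₂`.
If `L(Λ)` is finite dimensional, the string `f_a ^ j v` terminates, which forces the integrality
condition. Conversely, this condition makes every `f_a` with `a ≠ m` locally nilpotent on `L(Λ)`,
so the set of contents of nonvanishing words is invariant under the simple reflections of the even
Weyl group (`CartanData.IsSingular.exists_word_reflection`). The number of letters `f_m` is at most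
`m n`, and a set of contents that is bounded at `m` and invariant under these reflections is bounded
(`exists_content_bound`). So only finitely many words are nonzero.

*Classification.* On a finite dimensional module, long products of `e`'s annihilate every weight
vector because of their heights, so a weight module contains a highest weight vector; its weight
determines, and is determined by, the parameters.
-/

noncomputable section

namespace DegenerateQuantumGL

section

/-! ### Ladders of `q`-commutators along a type `A` chain -/

section Ladder

variable {k A : Type*} [Field k] [Ring A] [Algebra k A]

/-- The left-hand side of the quantum Serre relation of the pair `(c, z)` with parameter `y`. -/
def serre (y : k) (c z : A) : A := c * c * z - (y + y⁻¹) • (c * z * c) + z * c * c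

/-- The `y`-commutator `[c, z]_y = c z - y z c` over an arbitrary field. -/
def qcomm (y : k) (c z : A) : A := c * z - y • (z * c)

/-- The Serre relation says that `c` and `[c, z]_y` commute up to the factor `y⁻¹`. -/
theorem mul_qcomm_of_serre {y : k} (hy : y ≠ 0) {c z : A} (h : serre y c z = 0) :
    c * qcomm y c z = y⁻¹ • (qcomm y c z * c) := by
  rw [serre] at h
  rw [qcomm, ← sub_eq_zero]
  simp only [mul_sub, sub_mul, smul_mul_assoc, mul_smul_comm, mul_assoc, smul_smul,
    smul_sub] at h ⊢
  linear_combination (norm := skip) h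
  match_scalars <;> field_simp <;> ring

theorem commute_qcomm {y : k} {c z w : A} (h1 : Commute w c) (h2 : Commute w z) :
    Commute w (qcomm y c z) :=
  (h1.mul_right h2).sub_right ((h2.mul_right h1).smul_right y)

theorem qcomm_mul {y : k} {c w : A} (h : Commute c w) (z : A) :
    qcomm y c (z * w) = qcomm y c z * w := by
  simp only [qcomm, sub_mul, smul_mul_assoc, mul_assoc, h.eq]

theorem qcomm_mul' {y : k} {c w : A} (h : Commute c w) (z : A) :
    qcomm y c (w * z) = w * qcomm y c z := by
  simp only [qcomm, mul_sub, mul_smul_comm, ← mul_assoc, h.eq]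

theorem qcomm_add (y : k) (c z w : A) : qcomm y c (z + w) = qcomm y c z + qcomm y c w := by
  simp only [qcomm, mul_add, add_mul, smul_add]; abel

theorem qcomm_smul (y r : k) (c z : A) : qcomm y c (r • z) = r • qcomm y c z := by
  simp only [qcomm, mul_smul_comm, smul_mul_assoc, smul_sub, smul_comm r y]

/-- The Serre relation with `c` passes from `b` to `[b, z]_y` if `z` commutes with `c`. -/
theorem serre_qcomm {y : k} {c b z : A} (h : serre y c b = 0) (hz : Commute c z) :
    serre y c (qcomm y b z) = 0 := by
  have e1 : z * c = c * z := hz.eq.symm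
  have e2 : ∀ t, z * (c * t) = c * (z * t) := fun t => by rw [← mul_assoc, e1, mul_assoc]
  have T1 := congrArg (· * z) h
  have T2 := congrArg (z * ·) h
  simp only [serre, qcomm, mul_add, add_mul, mul_sub, sub_mul, smul_mul_assoc, mul_smul_comm,
    mul_assoc, smul_smul, smul_sub, zero_mul, mul_zero, e1, e2] at T1 T2 ⊢
  linear_combination (norm := skip) T1 - y • T2
  match_scalars <;> ring

/-- If `b` and `z` commute and both satisfy the Serre relation with `c`, then `c` commutes with
`[b, [c, z]_y]_y`. -/
theorem commute_qcomm_qcomm {y : k} (hy : y ≠ 0) (hy2 : y + y⁻¹ ≠ 0) {a b z : A}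
    (S1 : serre y a b = 0) (S2 : serre y a z = 0) (hbz : Commute b z) :
    Commute a (qcomm y b (qcomm y a z)) := by
  have e0 : b * z = z * b := hbz.eq
  have e1 : ∀ t, b * (z * t) = z * (b * t) := fun t => by rw [← mul_assoc, e0, mul_assoc]
  have h : (y + y⁻¹) • (a * (qcomm y b (qcomm y a z)) - (qcomm y b (qcomm y a z)) * a) = 0 := by
    -- the commutator is a combination of the two Serre relations multiplied by `z` and by `b`
    have T1 := congrArg (· * z) S1
    have T2 := congrArg (z * ·) S1
    have T3 := congrArg (· * b) S2
    have T4 := congrArg (b * ·) S2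
    simp only [serre, qcomm, mul_add, add_mul, mul_sub, sub_mul, smul_mul_assoc, mul_smul_comm,
      mul_assoc, smul_smul, smul_sub, zero_mul, mul_zero, e0, e1] at T1 T2 T3 T4 ⊢
    linear_combination (norm := skip) -T1 + (y ^ 2) • T2 - (y ^ 2) • T3 + T4
    match_scalars <;> field_simp <;> ring
  exact sub_eq_zero.1 ((smul_eq_zero.1 h).resolve_left hy2)

/-- A sequence `C 0, C 1, …` satisfying the type `A` Serre relations, together with an element `z`
which plays the part of `C (-1)`, except that nothing is required of the powers of `z`. -/
structure IsChain (y : k) (C : ℕ → A) (z : A) : Prop where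
  comm : ∀ i j, i + 1 < j → Commute (C i) (C j)
  serre : ∀ i j, (j = i + 1 ∨ i = j + 1) → serre y (C i) (C j) = 0
  comm_base : ∀ i, 0 < i → Commute (C i) z
  serre_base : DegenerateQuantumGL.serre y (C 0) z = 0

/-- The iterated `y`-commutators of `z` with the members of a chain:
`ladder y C z t = [C (t-1), [… , [C 1, [C 0, z]_y]_y …]_y]_y`. -/
def ladder (y : k) (C : ℕ → A) (z : A) : ℕ → A
  | 0 => z
  | t + 1 => qcomm y (C t) (ladder y C z t)

theorem mul_ladder (y : k) (C : ℕ → A) (z : A) (t : ℕ) :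
    C t * ladder y C z t = y • (ladder y C z t * C t) + ladder y C z (t + 1) := by
  rw [ladder, qcomm]; abel

namespace IsChain

variable {y : k} {C : ℕ → A} {z : A}

theorem commute_ladder_of_lt (h : IsChain y C z) {t u : ℕ} (htu : t < u) :
    Commute (C u) (ladder y C z t) := by
  induction t with
  | zero => exact h.comm_base u htu
  | succ t ih => exact commute_qcomm (h.comm t u htu).symm (ih (by omega))

theorem serre_ladder (h : IsChain y C z) (t : ℕ) :
    DegenerateQuantumGL.serre y (C t) (ladder y C z t) = 0 := by
  cases t with
  | zero => exact h.serre_base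
  | succ t =>
    exact serre_qcomm (h.serre _ _ (.inr rfl)) (h.commute_ladder_of_lt (Nat.lt_succ_self t))

theorem mul_ladder_succ (h : IsChain y C z) (hy : y ≠ 0) (t : ℕ) :
    C t * ladder y C z (t + 1) = y⁻¹ • (ladder y C z (t + 1) * C t) :=
  mul_qcomm_of_serre hy (h.serre_ladder t)

theorem commute_ladder_of_gt (h : IsChain y C z) (hy : y ≠ 0) (hy2 : y + y⁻¹ ≠ 0) {t u : ℕ}
    (htu : u + 2 ≤ t) : Commute (C u) (ladder y C z t) := by
  induction t, htu using Nat.le_induction with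
  | base =>
    exact commute_qcomm_qcomm hy hy2 (h.serre _ _ (.inl rfl)) (h.serre_ladder u)
      (h.commute_ladder_of_lt (Nat.lt_succ_self u))
  | succ t ht ih => exact commute_qcomm (h.comm u t (by omega)) ih

/-- Squares along a ladder vanish as soon as the square of its base does, and the members of the
ladder `q`-commute with each other. -/
theorem ladder_sq_and_comm (h : IsChain y C z) (hy : y ≠ 0)
    (hy2 : y + y⁻¹ ≠ 0) (hz : z * z = 0) :
    ∀ t, ladder y C z t * ladder y C z t = 0 ∧ ∀ u, t < u →
      ladder y C z u * ladder y C z t = -y • (ladder y C z t * ladder y C z u) := by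
  -- consecutive members `q`-commute: apply `C t` to the vanishing square and collect terms
  have next : ∀ t, ladder y C z t * ladder y C z t = 0 →
      ladder y C z (t + 1) * ladder y C z t = -y • (ladder y C z t * ladder y C z (t + 1)) := by
    intro t ht
    have T : C t * (ladder y C z t * ladder y C z t) = 0 := by rw [ht, mul_zero]
    have T' := congrArg (· * C t) ht
    simp only [zero_mul, mul_assoc] at T'
    rw [← mul_assoc, mul_ladder, add_mul, smul_mul_assoc, mul_assoc, mul_ladder, mul_add,
      mul_smul_comm, T', smul_zero, zero_add] at T
    rw [neg_smul, eq_neg_iff_add_eq_zero, add_comm, T]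
  intro t
  induction t with
  | zero =>
    refine ⟨hz, fun u hu => ?_⟩
    induction u, hu using Nat.le_induction with
    | base => exact next 0 hz
    | succ u hu ih =>
      have c := h.commute_ladder_of_lt (t := 0) (u := u) hu
      have T := congrArg (qcomm y (C u)) ih
      rwa [qcomm_smul, qcomm_mul c, qcomm_mul' c] at T
  | succ t ih =>
    have sq : ladder y C z (t + 1) * ladder y C z (t + 1) = 0 := by
      -- `C t` applied to the relation between the members `t` and `t + 1` yields the next square
      have T := congrArg (C t * ·) (next t ih.1)
      have r1 := mul_ladder y C z t
      have r2 := h.mul_ladder_succ hy t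
      set a := ladder y C z t
      set b := ladder y C z (t + 1)
      have r3 := congrArg (b * ·) r1
      have r4 := congrArg (· * a) r2
      have r5 := congrArg (· * b) r1
      have r6 := congrArg (a * ·) r2
      have r7 := congrArg (· * C t) (next t ih.1)
      have : (y + y⁻¹) • (b * b) = 0 := by
        simp only [mul_add, add_mul, smul_mul_assoc, mul_smul_comm, mul_assoc] at T r3 r4 r5 r6 r7
        linear_combination (norm := skip) T - r4 - y⁻¹ • r3 - r7 - y • r5 - y ^ 2 • r6
        match_scalars <;> field_simp <;> ring
      exact (smul_eq_zero.1 this).resolve_left hy2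
    refine ⟨sq, fun u hu => ?_⟩
    induction u, hu using Nat.le_induction with
    | base => exact next _ sq
    | succ u hu ih =>
      have c := h.commute_ladder_of_lt (t := t + 1) (u := u) hu
      have T := congrArg (qcomm y (C u)) ih
      rwa [qcomm_smul, qcomm_mul c, qcomm_mul' c] at T

/-- The members of two ladders over the same chain commute when the first lies strictly below the
second, provided that this holds at the bottom. -/
theorem commute_ladder_ladder (h : IsChain y C z) {w : A} (hw : IsChain y C w) (hy : y ≠ 0)
    (hy2 : y + y⁻¹ ≠ 0) (h01 : Commute z (ladder y C w 1)) :
    ∀ t u, t < u → Commute (ladder y C z t) (ladder y C w u) := by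
  intro t
  induction t with
  | zero =>
    intro u hu
    induction u, hu using Nat.le_induction with
    | base => exact h01
    | succ u hu ih => exact commute_qcomm (h.commute_ladder_of_lt hu).symm ih
  | succ t ih =>
    intro u hu
    exact (commute_qcomm (hw.commute_ladder_of_gt hy hy2 hu).symm (ih u (by omega)).symm).symm

/-- The crossing relation between two ladders over the same chain. -/
theorem ladder_crossing (h : IsChain y C z) {w : A} (hw : IsChain y C w) {x : k}
    (hcol : ∀ t, ladder y C z t * ladder y C w t = -x • (ladder y C w t * ladder y C z t))
    (hnest : ∀ t u, t < u → Commute (ladder y C z t) (ladder y C w u)) (t u : ℕ) (htu : t < u) :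
    ladder y C z u * ladder y C w t + (x * y) • (ladder y C w t * ladder y C z u)
      = -(x + y) • (ladder y C w u * ladder y C z t) := by
  induction u, htu using Nat.le_induction with
  | base =>
    -- apply `C t` to the relation `hcol t`
    have c := (hnest t (t + 1) (Nat.lt_succ_self t)).eq
    have T := congrArg (C t * ·) (hcol t)
    have r1 := mul_ladder y C z t
    have r2 := mul_ladder y C w t
    have r0 := congrArg (· * C t) (hcol t)
    have r3 := congrArg (· * ladder y C w t) r1
    have r4 := congrArg (ladder y C z t * ·) r2
    have r5 := congrArg (· * ladder y C z t) r2
    have r6 := congrArg (ladder y C w t * ·) r1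
    simp only [mul_add, add_mul, smul_mul_assoc, mul_smul_comm, mul_assoc] at T r0 r3 r4 r5 r6
    rw [c] at r4
    linear_combination (norm := skip) T - r3 - y • r4 - x • r5 - (x * y) • r6 - y ^ 2 • r0
    match_scalars <;> ring
  | succ u hu ih =>
    have cz := h.commute_ladder_of_lt (t := t) (u := u) hu
    have cw := hw.commute_ladder_of_lt (t := t) (u := u) hu
    have T := congrArg (qcomm y (C u)) ih
    rwa [qcomm_add, qcomm_smul, qcomm_smul, qcomm_mul cw, qcomm_mul' cw, qcomm_mul cz] at T

end IsChain

end Ladder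

end

section

/-! ### Odd root vectors and their quadratic relations -/

section OddRoots

open MulOpposite

variable {k A : Type*} [Field k] [Ring A] [Algebra k A]

/-- The base of a chain may be replaced by its commutator with an element that commutes with the
chain. -/
theorem IsChain.qcomm_right {y : k} {C : ℕ → A} {z w : A} (h : IsChain y C z) (x : k)
    (hw : ∀ i, Commute w (C i)) : IsChain y C (z * w - x • (w * z)) where
  comm := h.comm
  serre := h.serre
  comm_base i hi := (((h.comm_base i hi).mul_right (hw i).symm).sub_right
    (((hw i).symm.mul_right (h.comm_base i hi)).smul_right x))
  serre_base := by
    have T := h.serre_base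
    have e1 : w * C 0 = C 0 * w := (hw 0).eq
    have e2 : ∀ t, w * (C 0 * t) = C 0 * (w * t) := fun t => by rw [← mul_assoc, e1, mul_assoc]
    have T1 := congrArg (· * w) T
    have T2 := congrArg (w * ·) T
    simp only [DegenerateQuantumGL.serre, mul_add, add_mul, mul_sub, sub_mul, smul_mul_assoc,
      mul_smul_comm, mul_assoc, smul_smul, smul_sub, zero_mul, mul_zero, e1, e2] at T1 T2 ⊢
    linear_combination (norm := skip) T1 - x • T2
    match_scalars <;> ring

theorem ladder_qcomm_right {y : k} {C : ℕ → A} {w : A} (x : k) (hw : ∀ i, Commute w (C i))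
    (z : A) (t : ℕ) : ladder y C (z * w - x • (w * z)) t
      = ladder y C z t * w - x • (w * ladder y C z t) := by
  induction t with
  | zero => rfl
  | succ t ih =>
    have h := (hw t).symm
    rw [ladder, ih, sub_eq_add_neg, ← neg_smul, qcomm_add, qcomm_smul, qcomm_mul h, qcomm_mul' h,
      neg_smul, ← sub_eq_add_neg, ladder]

/-- Two chains `a` and `c` which commute with each other and are joined at the square-zero
element `b`, as are the simple root vectors `f_{m-1}, f_{m-2}, …`, the simple root vectors
`f_{m+1}, f_{m+2}, …` and `b = f_m`. The chain `a` acts by commutators from the right, so that its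
relations are stated in the opposite algebra. -/
structure IsOddPair (x y : k) (a c : ℕ → A) (b : A) : Prop where
  x_ne : x ≠ 0
  y_ne : y ≠ 0
  x_add : x + x⁻¹ ≠ 0
  y_add : y + y⁻¹ ≠ 0
  left : IsChain x (fun s => op (a s)) (op b)
  right : IsChain y c b
  comm : ∀ s t, Commute (a s) (c t)
  sq : b * b = 0
  quartic : Commute b (qcomm y (c 0) (b * a 0 - x • (a 0 * b)))

/-- The root vectors `odd s t = [c_{t-1}, [… [c_0, [… [b, a_0]_x …, a_{s-1}]_x]_y …]_y` of the odd
roots. -/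
def odd (x y : k) (a c : ℕ → A) (b : A) (s t : ℕ) : A :=
  ladder y c (unop (ladder x (fun s => op (a s)) (op b) s)) t

theorem odd_succ_right (x y : k) (a c : ℕ → A) (b : A) (s t : ℕ) :
    odd x y a c b s (t + 1) = qcomm y (c t) (odd x y a c b s t) := rfl

namespace IsOddPair

variable {x y : k} {a c : ℕ → A} {b : A}

local notation "o" => odd x y a c b

theorem odd_succ_left (h : IsOddPair x y a c b) (s t : ℕ) :
    o (s + 1) t = o s t * a s - x • (a s * o s t) := by
  rw [odd, ladder]
  exact ladder_qcomm_right x (h.comm s) _ t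

/-- The two kinds of commutators in `odd` may be taken in either order. -/
theorem op_odd (h : IsOddPair x y a c b) (s t : ℕ) :
    op (o s t) = ladder x (fun s => op (a s)) (op (ladder y c b t)) s := by
  induction s with
  | zero => rfl
  | succ s ih => rw [h.odd_succ_left, ladder, ← ih]; rfl

theorem isChain_right (h : IsOddPair x y a c b) (s : ℕ) : IsChain y c (o s 0) := by
  induction s with
  | zero => exact h.right
  | succ s ih => rw [h.odd_succ_left]; exact ih.qcomm_right x (h.comm s)

theorem isChain_left (h : IsOddPair x y a c b) (t : ℕ) :
    IsChain x (fun s => op (a s)) (op (ladder y c b t)) := by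
  induction t with
  | zero => exact h.left
  | succ t ih => exact ih.qcomm_right y fun i => (h.comm i t).symm.op

theorem odd_sq (h : IsOddPair x y a c b) (s t : ℕ) : o s t * o s t = 0 := by
  have h1 := (h.left.ladder_sq_and_comm h.x_ne h.x_add (congrArg op h.sq) s).1
  exact ((h.isChain_right s).ladder_sq_and_comm h.y_ne h.y_add (congrArg unop h1) t).1

theorem odd_row (h : IsOddPair x y a c b) (s : ℕ) {t u : ℕ} (htu : t < u) :
    o s u * o s t = -y • (o s t * o s u) :=
  ((h.isChain_right s).ladder_sq_and_comm h.y_ne h.y_add (h.odd_sq s 0) t).2 u htu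

theorem odd_col (h : IsOddPair x y a c b) {s r : ℕ} (hsr : s < r) (t : ℕ) :
    o s t * o r t = -x • (o r t * o s t) := by
  have h0 : op (ladder y c b t) * op (ladder y c b t) = 0 := congrArg op (h.odd_sq 0 t)
  have := ((h.isChain_left t).ladder_sq_and_comm h.x_ne h.x_add h0 s).2 r hsr
  rw [← h.op_odd, ← h.op_odd] at this
  exact congrArg unop this

theorem odd_nested (h : IsOddPair x y a c b) {s r t u : ℕ} (hsr : s < r) (htu : t < u) :
    Commute (o s t) (o r u) := by
  have h1 : Commute (op (ladder y c b 0))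
      (ladder x (fun s => op (a s)) (op (ladder y c b 1)) 1) := by
    rw [← h.op_odd]
    exact h.quartic.op
  have h2 := (h.isChain_left 0).commute_ladder_ladder (h.isChain_left 1) h.x_ne h.x_add h1 s r hsr
  rw [← h.op_odd, ← h.op_odd] at h2
  exact (h.isChain_right s).commute_ladder_ladder (h.isChain_right r) h.y_ne h.y_add h2.unop t u htu

theorem odd_crossing (h : IsOddPair x y a c b) {s r t u : ℕ} (hsr : s < r) (htu : t < u) :
    o s u * o r t + (x * y) • (o r t * o s u) = -(x + y) • (o r u * o s t) :=
  (h.isChain_right s).ladder_crossing (h.isChain_right r) (fun t => h.odd_col hsr t)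
    (fun _ _ htu => h.odd_nested hsr htu) t u htu

/-- Even letters of the right chain `q`-commute with odd root vectors up to an odd root vector. -/
theorem right_mul_odd (h : IsOddPair x y a c b) (s t u : ℕ) :
    ∃ (r : k) (w : A), (w = 0 ∨ w = o s (t + 1)) ∧ c u * o s t = r • (o s t * c u) + w := by
  have hc := h.isChain_right s
  rcases lt_trichotomy t u with htu | rfl | htu
  · exact ⟨1, 0, .inl rfl, by rw [one_smul, add_zero]; exact (hc.commute_ladder_of_lt htu).eq⟩
  · exact ⟨y, _, .inr rfl, mul_ladder y c _ t⟩
  · obtain rfl | h2 : t = u + 1 ∨ u + 2 ≤ t := by omega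
    · exact ⟨y⁻¹, 0, .inl rfl, by rw [add_zero]; exact hc.mul_ladder_succ h.y_ne u⟩
    · exact ⟨1, 0, .inl rfl,
        by rw [one_smul, add_zero]; exact (hc.commute_ladder_of_gt h.y_ne h.y_add h2).eq⟩

/-- Even letters of the left chain `q`-commute with odd root vectors up to an odd root vector. -/
theorem left_mul_odd (h : IsOddPair x y a c b) (s t u : ℕ) :
    ∃ (r r' : k) (w : A), (w = 0 ∨ w = o (s + 1) t) ∧
      a u * o s t = r • (o s t * a u) + r' • w := by
  have hc := h.isChain_left t
  rcases lt_trichotomy s u with htu | rfl | htu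
  · have := hc.commute_ladder_of_lt htu
    rw [← h.op_odd] at this
    exact ⟨1, 0, 0, .inl rfl, by rw [one_smul, smul_zero, add_zero]; exact this.unop.eq⟩
  · refine ⟨x⁻¹, -x⁻¹, _, .inr rfl, ?_⟩
    have hx := h.x_ne
    rw [h.odd_succ_left, smul_sub, smul_smul]
    simp [hx]
  · obtain rfl | h2 : s = u + 1 ∨ u + 2 ≤ s := by omega
    · have := hc.mul_ladder_succ h.x_ne u
      rw [← h.op_odd] at this
      replace this := congrArg unop this
      simp only [unop_mul, unop_op, unop_smul] at this
      refine ⟨x, 0, 0, .inl rfl, ?_⟩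
      rw [this, smul_smul, mul_inv_cancel₀ h.x_ne, one_smul, smul_zero, add_zero]
    · have := hc.commute_ladder_of_gt h.x_ne h.x_add h2
      rw [← h.op_odd] at this
      exact ⟨1, 0, 0, .inl rfl, by rw [one_smul, smul_zero, add_zero]; exact this.unop.eq⟩

end IsOddPair

/-- The span of the first `T` odd root vectors, for the order in which `(s, t)` precedes `(r, u)`
if `s < r`, or `s = r` and `u < t`; the column index is restricted to `t < N`. -/
def oddSpan (x y : k) (a c : ℕ → A) (b : A) (N T : ℕ) : Submodule k A :=
  Submodule.span k {z | ∃ s t, t < N ∧ s * N + (N - 1 - t) < T ∧ z = odd x y a c b s t}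

namespace IsOddPair

variable {x y : k} {a c : ℕ → A} {b : A}

local notation "o" => odd x y a c b
local notation "R" => oddSpan x y a c b

theorem odd_mem_oddSpan {N T s t : ℕ} (ht : t < N) (hT : s * N + (N - 1 - t) < T) :
    o s t ∈ R N T := Submodule.subset_span ⟨s, t, ht, hT, rfl⟩

/-- Straightening: a product of two of the first `T + 1` odd root vectors can be rewritten so that
its left factor is among the first `T`. -/
theorem oddSpan_mul_le (h : IsOddPair x y a c b) (N T : ℕ) :
    R N (T + 1) * R N (T + 1) ≤ R N T * R N (T + 1) := by
  nth_rewrite 1 [oddSpan]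
  nth_rewrite 1 [oddSpan]
  rw [Submodule.span_mul_span, Submodule.span_le]
  rintro _ ⟨_, ⟨r, t, ht, hT, rfl⟩, _, ⟨s, u, hu, hT', rfl⟩, rfl⟩
  have mem : ∀ {s t : ℕ}, t < N → s * N + (N - 1 - t) < T + 1 → o s t ∈ R N (T + 1) :=
    fun ht hT => odd_mem_oddSpan ht hT
  have mem' : ∀ {s t : ℕ}, t < N → s * N + (N - 1 - t) < T → o s t ∈ R N T :=
    fun ht hT => odd_mem_oddSpan ht hT
  have row : ∀ {s r : ℕ}, s < r → s * N + N ≤ r * N := fun {s r} hsr => by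
    rw [← Nat.succ_mul]; exact Nat.mul_le_mul_right N hsr
  change o r t * o s u ∈ R N T * R N (T + 1)
  have hx := h.x_ne
  have hy := h.y_ne
  by_cases hlt : r * N + (N - 1 - t) < T
  · exact Submodule.mul_mem_mul (mem' ht hlt) (mem hu hT')
  rcases lt_trichotomy s r with hsr | rfl | hsr
  · have h1 := row hsr
    have hs : ∀ {v}, v < N → o s v ∈ R N T := fun hv => mem' hv (by omega)
    rcases lt_trichotomy u t with hut | rfl | hut
    · rw [← (h.odd_nested hsr hut).eq]
      exact Submodule.mul_mem_mul (hs hu) (mem ht hT)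
    · have := h.odd_col hsr u
      have e : o r u * o s u = -x⁻¹ • (o s u * o r u) := by
        rw [this, smul_smul]; simp [hx]
      rw [e]
      exact Submodule.smul_mem _ _ (Submodule.mul_mem_mul (hs hu) (mem ht hT))
    · have e : o r t * o s u = (x * y)⁻¹ • (-(x + y) • (o s t * o r u) - o s u * o r t) := by
        rw [(h.odd_nested hsr hut).eq, ← h.odd_crossing hsr hut, add_sub_cancel_left, smul_smul,
          inv_mul_cancel₀ (mul_ne_zero hx hy), one_smul]
      rw [e]
      exact Submodule.smul_mem _ _ (Submodule.sub_mem _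
        (Submodule.smul_mem _ _ (Submodule.mul_mem_mul (hs ht) (mem hu (by omega))))
        (Submodule.mul_mem_mul (hs hu) (mem ht hT)))
  · rcases lt_trichotomy u t with hut | rfl | hut
    · omega
    · rw [h.odd_sq]; exact Submodule.zero_mem _
    · have e : o s t * o s u = -y⁻¹ • (o s u * o s t) := by
        rw [h.odd_row s hut, smul_smul]; simp [hy]
      rw [e]
      exact Submodule.smul_mem _ _ (Submodule.mul_mem_mul (mem' hu (by omega)) (mem ht hT))
  · have := row hsr
    omega

/-- Any product of more than `T` of the first `T` odd root vectors vanishes. -/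
theorem oddSpan_pow (h : IsOddPair x y a c b) (N T : ℕ) : R N T ^ (T + 1) = ⊥ := by
  induction T with
  | zero =>
    rw [zero_add, pow_one, oddSpan, Submodule.span_eq_bot]
    rintro _ ⟨s, t, _, hT, _⟩
    exact absurd hT (Nat.not_lt_zero _)
  | succ T ih =>
    have key : ∀ d, R N (T + 1) ^ (d + 1) ≤ R N T ^ d * R N (T + 1) := by
      intro d
      induction d with
      | zero => simp
      | succ d ihd =>
        calc R N (T + 1) ^ (d + 1 + 1) = R N (T + 1) ^ (d + 1) * R N (T + 1) := pow_succ _ _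
          _ ≤ R N T ^ d * R N (T + 1) * R N (T + 1) := mul_le_mul' ihd le_rfl
          _ = R N T ^ d * (R N (T + 1) * R N (T + 1)) := mul_assoc _ _ _
          _ ≤ R N T ^ d * (R N T * R N (T + 1)) := mul_le_mul' le_rfl (h.oddSpan_mul_le N T)
          _ = R N T ^ (d + 1) * R N (T + 1) := by rw [pow_succ, mul_assoc]
    have := key (T + 1)
    rw [ih, Submodule.bot_mul] at this
    exact le_bot_iff.1 this

variable {M N : ℕ}

theorem odd_eq_zero_left (h : IsOddPair x y a c b) (ha : ∀ s, M ≤ s + 1 → a s = 0) (hM : 0 < M)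
    {s : ℕ} (hs : M ≤ s) (t : ℕ) : o s t = 0 := by
  obtain ⟨s, rfl⟩ : ∃ s', s = s' + 1 := ⟨s - 1, by omega⟩
  rw [h.odd_succ_left, ha s hs]; simp

theorem odd_eq_zero_right (hc : ∀ s, N ≤ s + 1 → c s = 0) (hN : 0 < N)
    (s : ℕ) {t : ℕ} (ht : N ≤ t) : o s t = 0 := by
  obtain ⟨t, rfl⟩ : ∃ t', t = t' + 1 := ⟨t - 1, by omega⟩
  rw [odd_succ_right, hc t ht]; simp [qcomm]

theorem odd_mem (h : IsOddPair x y a c b) (ha : ∀ s, M ≤ s + 1 → a s = 0) (hM : 0 < M)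
    (hc : ∀ s, N ≤ s + 1 → c s = 0) (hN : 0 < N) (s t : ℕ) : o s t ∈ R N (M * N) := by
  by_cases hs : M ≤ s
  · rw [h.odd_eq_zero_left ha hM hs]; exact Submodule.zero_mem _
  by_cases ht : N ≤ t
  · rw [odd_eq_zero_right hc hN s ht]; exact Submodule.zero_mem _
  refine odd_mem_oddSpan (by omega) ?_
  have : s * N + N ≤ M * N := by
    rw [← Nat.succ_mul]; exact Nat.mul_le_mul_right N (by omega)
  omega

/-- The span of the odd root vectors is stable under commutators with the even simple root
vectors; hence left multiplication by the latter preserves the right ideals generated by its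
powers. -/
theorem even_mul_mem (h : IsOddPair x y a c b) (ha : ∀ s, M ≤ s + 1 → a s = 0) (hM : 0 < M)
    (hc : ∀ s, N ≤ s + 1 → c s = 0) (hN : 0 < N) {g : A} (hg : (∃ s, g = a s) ∨ ∃ t, g = c t)
    (d : ℕ) {z : A} (hz : z ∈ R N (M * N) ^ d * ⊤) : g * z ∈ R N (M * N) ^ d * ⊤ := by
  induction d generalizing z with
  | zero =>
    rw [pow_zero, one_mul] at hz ⊢; trivial
  | succ d ih =>
    rw [pow_succ', mul_assoc] at hz ⊢
    refine Submodule.mul_induction_on hz (fun p hp w hw => ?_)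
      (fun z w hz hw => by rw [mul_add]; exact Submodule.add_mem _ hz hw)
    induction hp using Submodule.span_induction with
    | mem p hp =>
      obtain ⟨s, t, _, _, rfl⟩ := hp
      have hm : ∀ s t, o s t ∈ R N (M * N) := h.odd_mem ha hM hc hN
      rcases hg with ⟨u, rfl⟩ | ⟨u, rfl⟩
      · obtain ⟨r, r', w', hw', e⟩ := h.left_mul_odd s t u
        rw [← mul_assoc (a u), e, add_mul, smul_mul_assoc, smul_mul_assoc, mul_assoc]
        refine Submodule.add_mem _ (Submodule.smul_mem _ _ (Submodule.mul_mem_mul (hm _ _) (ih hw)))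
          (Submodule.smul_mem _ _ (Submodule.mul_mem_mul ?_ hw))
        rcases hw' with rfl | rfl
        exacts [Submodule.zero_mem _, hm _ _]
      · obtain ⟨r, w', hw', e⟩ := h.right_mul_odd s t u
        rw [← mul_assoc (c u), e, add_mul, smul_mul_assoc, mul_assoc]
        refine Submodule.add_mem _ (Submodule.smul_mem _ _ (Submodule.mul_mem_mul (hm _ _) (ih hw)))
          (Submodule.mul_mem_mul ?_ hw)
        rcases hw' with rfl | rfl
        exacts [Submodule.zero_mem _, hm _ _]
    | zero => simp
    | add p p' _ _ hp hp' => rw [add_mul, mul_add]; exact Submodule.add_mem _ hp hp'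
    | smul r p _ hp => rw [smul_mul_assoc, mul_smul_comm]; exact Submodule.smul_mem _ _ hp

/-- A product of elements equal to `b`, to some `a s` or to some `c t` vanishes if it has more than
`M * N` factors equal to `b`. -/
theorem prod_eq_zero (h : IsOddPair x y a c b) (ha : ∀ s, M ≤ s + 1 → a s = 0) (hM : 0 < M)
    (hc : ∀ s, N ≤ s + 1 → c s = 0) (hN : 0 < N) {X : Type*} (φ : X → A) (p : X → Prop)
    [DecidablePred p] (hp : ∀ i, p i → φ i = b)
    (hp' : ∀ i, ¬ p i → (∃ s, φ i = a s) ∨ ∃ t, φ i = c t) (l : List X)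
    (hl : M * N < l.countP p) : (l.map φ).prod = 0 := by
  have key : ∀ l : List X, (l.map φ).prod ∈ R N (M * N) ^ (l.countP p) * ⊤ := by
    intro l
    induction l with
    | nil => simp
    | cons i l ih =>
      rw [List.map_cons, List.prod_cons]
      by_cases hi : p i
      · rw [List.countP_cons_of_pos (by simpa using hi), pow_succ', mul_assoc, hp i hi]
        exact Submodule.mul_mem_mul (h.odd_mem ha hM hc hN 0 0) ih
      · rw [List.countP_cons_of_neg (by simpa using hi)]
        exact h.even_mul_mem ha hM hc hN (hp' i hi) _ ih
  have h0 : R N (M * N) ^ l.countP p = ⊥ := by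
    obtain ⟨e, he⟩ := Nat.exists_eq_add_of_lt hl
    rw [he, add_right_comm, pow_add, h.oddSpan_pow, Submodule.bot_mul]
  have := key l
  rwa [h0, Submodule.bot_mul, Submodule.mem_bot] at this

end IsOddPair

end OddRoots

end

section

/-! ### Scalars -/

theorem q_ne_zero : q ≠ 0 := RatFunc.X_ne_zero

theorem q_pow_eq_one {k : ℕ} (h : q ^ k = 1) : k = 0 := by
  have h1 : algebraMap (Polynomial ℂ) Cq (Polynomial.X ^ k) = algebraMap (Polynomial ℂ) Cq 1 := by
    rw [map_pow, RatFunc.algebraMap_X, map_one]; exact h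
  have h2 := RatFunc.algebraMap_injective ℂ h1
  simpa using congrArg Polynomial.natDegree h2

theorem q_zpow_eq_one {k : ℤ} (h : q ^ k = 1) : k = 0 := by
  obtain ⟨l, rfl | rfl⟩ := k.eq_nat_or_neg
  · rw [zpow_natCast] at h; simp [q_pow_eq_one h]
  · rw [zpow_neg, inv_eq_one, zpow_natCast] at h; simp [q_pow_eq_one h]

theorem qa_ne_zero (m a : ℕ) : qa m a ≠ 0 := by
  unfold qa; split_ifs
  exacts [q_ne_zero, neg_ne_zero.2 (inv_ne_zero q_ne_zero)]

/-- The denominators in the relations between `e_a` and `f_a` do not depend on `a`. -/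
theorem qa_sub_inv (m a : ℕ) : qa m a - (qa m a)⁻¹ = q - q⁻¹ := by
  unfold qa; split_ifs
  · rfl
  · field_simp
    ring

theorem neg_inv_zpow_two_mul {F : Type*} [Field F] (x : F) (k : ℤ) :
    (-x⁻¹) ^ (2 * k) = x ^ (-(2 * k)) := by
  rw [Even.neg_zpow (even_two_mul k), inv_zpow, zpow_neg]

theorem qa_zpow_sq_eq_one {m a : ℕ} {k : ℤ} (h : qa m a ^ (2 * k) = 1) : k = 0 := by
  unfold qa at h; split_ifs at h
  · have := q_zpow_eq_one h; omega
  · rw [neg_inv_zpow_two_mul] at h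
    have := q_zpow_eq_one h; omega

theorem qa_zpow_eq {m a : ℕ} {k : ℤ} (h : qa m a ^ k = 1 ∨ qa m a ^ k = -1) : k = 0 := by
  refine qa_zpow_sq_eq_one (m := m) (a := a) ?_
  rw [mul_comm, zpow_mul, zpow_ofNat]
  rcases h with h | h <;> rw [h] <;> norm_num

theorem qa_add_inv_ne_zero (m a : ℕ) : qa m a + (qa m a)⁻¹ ≠ 0 := by
  intro h
  have h0 := qa_ne_zero m a
  have h1 : qa m a ^ (2 : ℤ) = -1 := by
    field_simp at h
    rw [zpow_ofNat]; linear_combination h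
  have := qa_zpow_eq (.inr h1)
  omega

theorem q_sub_inv_ne_zero : q - q⁻¹ ≠ 0 := by
  intro h
  have h1 : q ^ 2 = 1 := by
    have h0 := q_ne_zero
    field_simp at h
    linear_combination h
  have := q_pow_eq_one h1
  omega

/-! ### The defining relations in commutation form -/

variable {m n : ℕ}

/-- The scalar by which conjugation with `K_b` acts on `e_a`. -/
def chi (b : I m n) (a : I' m n) : Cq :=
  qa m b ^ ((if (b : ℕ) = a then 1 else 0) - (if (b : ℕ) = a + 1 then 1 else 0) : ℤ)

theorem chi_ne_zero (b : I m n) (a : I' m n) : chi b a ≠ 0 := zpow_ne_zero _ (qa_ne_zero m b)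

theorem K_mul_Kinv (b : I m n) : K b * Kinv b = 1 := by
  have := U.mk_rel (Rel.K_mul_Kinv b); rwa [map_mul, map_one] at this

theorem K_comm_K (b c : I m n) : Commute (K b) (K c) := by
  have := U.mk_rel (Rel.K_comm_K b c); rwa [map_mul, map_mul] at this

theorem K_comm_Kinv (b c : I m n) : Commute (K b) (Kinv c) := by
  have := U.mk_rel (Rel.K_comm_Kinv b c); rwa [map_mul, map_mul] at this

theorem Kinv_mul_K (b : I m n) : Kinv b * K b = 1 := by
  rw [← (K_comm_Kinv b b).eq, K_mul_Kinv]

theorem K_mul_e (b : I m n) (a : I' m n) : K b * e a = chi b a • (e a * K b) := by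
  have := U.mk_rel (Rel.K_e b a)
  rw [map_mul, map_mul, map_smul] at this
  change K b * e a * Kinv b = chi b a • e a at this
  replace this := congrArg (· * K b) this
  simpa only [mul_assoc, Kinv_mul_K, mul_one, smul_mul_assoc] using this

theorem K_mul_f (b : I m n) (a : I' m n) : K b * f a = (chi b a)⁻¹ • (f a * K b) := by
  have := U.mk_rel (Rel.K_f b a)
  rw [map_mul, map_mul, map_smul] at this
  have hs : (-(if (b : ℕ) = a then 1 else 0) + (if (b : ℕ) = a + 1 then 1 else 0) : ℤ)
    = -((if (b : ℕ) = a then 1 else 0) - (if (b : ℕ) = a + 1 then 1 else 0) : ℤ) := by ring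
  rw [hs, zpow_neg] at this
  change K b * f a * Kinv b = (chi b a)⁻¹ • f a at this
  replace this := congrArg (· * K b) this
  simpa only [mul_assoc, Kinv_mul_K, mul_one, smul_mul_assoc] using this

theorem e_mul_f_same (a : I' m n) : e a * f a = f a * e a +
    (q - q⁻¹)⁻¹ • (K a.inc * Kinv a.next - K a.next * Kinv a.inc) := by
  have := U.mk_rel (Rel.e_f_same a)
  rw [map_sub, map_smul, map_sub, map_mul, map_mul, map_mul, map_mul, qa_sub_inv] at this
  exact sub_eq_iff_eq_add'.1 this

theorem e_comm_f {a b : I' m n} (h : a ≠ b) : Commute (e a) (f b) := by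
  have := U.mk_rel (Rel.e_f_ne a b h)
  rw [map_sub, map_mul, map_mul, map_zero, sub_eq_zero] at this
  exact this

theorem f_comm_f {a b : I' m n} (h : (a : ℕ) + 1 < b ∨ (b : ℕ) + 1 < a) :
    Commute (f a) (f b) := by
  have := U.mk_rel (Rel.f_comm a b h); rwa [map_mul, map_mul] at this

theorem serre_f {a b : I' m n} (ha : (a : ℕ) ≠ m) (h : (b : ℕ) = a + 1 ∨ (a : ℕ) = b + 1) :
    serre (qa m a) (f a) (f b) = 0 := by
  have := U.mk_rel (Rel.serre_f a b ha h)
  simp only [map_add, map_sub, map_smul, map_mul, map_zero] at this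
  exact this

theorem f_sq {a : I' m n} (ha : (a : ℕ) = m) : f a * f a = 0 := by
  have := U.mk_rel (Rel.f_sq a ha); rwa [map_mul, map_zero] at this

theorem quartic_f {a b c : I' m n} (ha : (a : ℕ) + 1 = m) (hb : (b : ℕ) = m)
    (hc : (c : ℕ) = m + 1) :
    Commute (f b) (qcomm (qa m (m + 1)) (f c) (qcomm (qa m m) (f b) (f a))) := by
  have := U.mk_rel (Rel.quartic_f a b c ha hb hc)
  simp only [map_mul, xcomm, map_sub, map_smul] at this
  exact this

/-! ### Words with many odd letters vanish -/

/-- The generator `f_i`, extended by zero to all natural numbers `i`. -/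
def fnat (m n i : ℕ) : U m n := if h : i ∈ Set.Ico 1 (m + n) then f ⟨i, h⟩ else 0

theorem fnat_coe (a : I' m n) : fnat m n a = f a := dif_pos a.2

theorem fnat_eq_zero {i : ℕ} (h : i ∉ Set.Ico 1 (m + n)) : fnat m n i = 0 := dif_neg h

theorem fnat_zero : fnat m n 0 = 0 := fnat_eq_zero (by simp)

theorem fnat_cases (i : ℕ) : fnat m n i = 0 ∨ ∃ a : I' m n, (a : ℕ) = i ∧ fnat m n i = f a := by
  by_cases h : i ∈ Set.Ico 1 (m + n)
  · exact .inr ⟨⟨i, h⟩, rfl, dif_pos h⟩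
  · exact .inl (dif_neg h)

theorem fnat_comm {i j : ℕ} (h : i + 1 < j ∨ i = 0 ∨ j = 0) :
    Commute (fnat m n i) (fnat m n j) := by
  rcases fnat_cases (m := m) (n := n) i with hi | ⟨a, ha, hi⟩
  · rw [hi]; exact Commute.zero_left _
  rcases fnat_cases (m := m) (n := n) j with hj | ⟨b, hb, hj⟩
  · rw [hj]; exact Commute.zero_right _
  rw [hi, hj]
  have h1 := a.2.1
  have h2 := b.2.1
  exact f_comm_f (.inl (by omega))

theorem serre_fnat {i j : ℕ} (hm : i ≠ m) (h : j = i + 1 ∨ i = j + 1) :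
    serre (qa m i) (fnat m n i) (fnat m n j) = 0 := by
  rcases fnat_cases (m := m) (n := n) i with hi | ⟨a, rfl, hi⟩
  · simp [serre, hi]
  rcases fnat_cases (m := m) (n := n) j with hj | ⟨b, rfl, hj⟩
  · simp [serre, hj]
  rw [hi, hj]
  exact serre_f hm h

open MulOpposite in
theorem serre_op {k A : Type*} [Field k] [Ring A] [Algebra k A] (y : k) (c z : A) :
    serre y (op c) (op z) = op (serre y c z) := by
  simp only [serre, op_add, op_sub, op_mul, op_smul, mul_assoc]
  abel

/-- The odd pair of `U_q(gl_{m,n})`; the chains are continued by zeros beyond the generators. -/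
theorem isOddPair_f (hm : 0 < m) : IsOddPair q (-q⁻¹) (fun s => fnat m n (m - 1 - s))
    (fun t => fnat m n (m + 1 + t)) (fnat m n m) := by
  have e1 : ∀ i, i ≤ m → qa m i = q := fun i hi => if_pos hi
  have e2 : ∀ i, m < i → qa m i = -q⁻¹ := fun i hi => if_neg (by omega)
  refine ⟨q_ne_zero, ?_, ?_, ?_, ⟨?_, ?_, ?_, ?_⟩, ⟨?_, ?_, ?_, ?_⟩, ?_, ?_, ?_⟩
  · rw [← e2 (m + 1) (by omega)]; exact qa_ne_zero _ _
  · rw [← e1 m le_rfl]; exact qa_add_inv_ne_zero _ _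
  · rw [← e2 (m + 1) (by omega)]; exact qa_add_inv_ne_zero _ _
  · intro i j hij
    exact (fnat_comm (by omega)).symm.op
  · intro i j hij
    rw [serre_op, MulOpposite.op_eq_zero_iff]
    by_cases hi : m - 1 - i = 0
    · simp [hi, fnat_zero, serre]
    · rw [← e1 (m - 1 - i) (by omega)]
      exact serre_fnat (by omega) (by omega)
  · intro i hi
    exact (fnat_comm (by omega)).op
  · rw [serre_op, MulOpposite.op_eq_zero_iff]
    rw [← e1 (m - 1 - 0) (by omega)]
    exact serre_fnat (by omega) (by omega)
  · intro i j hij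
    exact fnat_comm (by omega)
  · intro i j hij
    rw [← e2 (m + 1 + i) (by omega)]
    exact serre_fnat (by omega) (by omega)
  · intro i hi
    exact (fnat_comm (by omega)).symm
  · rw [← e2 (m + 1 + 0) (by omega)]
    exact serre_fnat (by omega) (by omega)
  · intro s t
    exact fnat_comm (by omega)
  · rcases fnat_cases (m := m) (n := n) m with h | ⟨a, ha, h⟩
    · rw [h, mul_zero]
    · rw [h, f_sq ha]
  · rcases fnat_cases (m := m) (n := n) m with h | ⟨b, hb, h⟩
    · rw [h]; exact Commute.zero_left _
    rcases fnat_cases (m := m) (n := n) (m - 1 - 0) with h' | ⟨a, ha, h'⟩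
    · rw [h']; simp [qcomm]
    rcases fnat_cases (m := m) (n := n) (m + 1 + 0) with h'' | ⟨c, hc, h''⟩
    · rw [h'']; simp [qcomm]
    have := quartic_f (a := a) (b := b) (c := c) (by have := a.2.1; omega) hb hc
    rw [e1 m le_rfl, e2 (m + 1) (by omega)] at this
    rw [h, h', h'']
    exact this

/-- A product of `f`'s with more than `m n` factors `f_m` vanishes. -/
theorem prod_f_eq_zero (hm : 0 < m) (hn : 0 < n) (l : List (I' m n))
    (hl : m * n < l.countP (fun a : I' m n => (a : ℕ) = m)) : (l.map f).prod = 0 := by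
  refine (isOddPair_f hm).prod_eq_zero (M := m) (N := n) (fun s hs => ?_) hm (fun s hs => ?_) hn f
    (fun a : I' m n => (a : ℕ) = m) (fun a ha => ?_) (fun a ha => ?_) l hl
  · rw [show m - 1 - s = 0 by omega, fnat_zero]
  · exact fnat_eq_zero (fun h => by have := h.2; omega)
  · rw [← fnat_coe, ha]
  · have h1 := a.2.1
    rcases lt_or_gt_of_ne ha with h | h
    · exact .inl ⟨m - 1 - a, by rw [← fnat_coe]; congr 1; omega⟩
    · exact .inr ⟨a - (m + 1), by rw [← fnat_coe]; congr 1; omega⟩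

end

section

/-! ### Highest weight vectors -/

variable {m n : ℕ}

/-- Elements `E x, F x, k b, k b⁻¹` of an algebra which satisfy those relations of
`U_q(gl_{m,n})` that involve neither two `e`'s nor two `f`'s. The letters `x` range over a type `X`
mapped to `I'` by `ix`, so that the notion applies both to `U_q(gl_{m,n})` and to `U_q(g₀)`. -/
structure CartanData {X : Type*} (ix : X → I' m n) (A : Type*) [Ring A] [Algebra Cq A] where
  /-- the images of the `e`'s -/
  E : X → A
  /-- the images of the `f`'s -/
  F : X → A
  /-- the images of the `K`'s -/
  k : I m n → A
  /-- the images of the `K⁻¹`'s -/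
  kinv : I m n → A
  k_kinv : ∀ b, k b * kinv b = 1
  kinv_k : ∀ b, kinv b * k b = 1
  k_comm : ∀ b c, Commute (k b) (k c)
  k_E : ∀ b x, k b * E x = chi b (ix x) • (E x * k b)
  k_F : ∀ b x, k b * F x = (chi b (ix x))⁻¹ • (F x * k b)
  E_F : ∀ x, E x * F x = F x * E x + (q - q⁻¹)⁻¹ •
    (k (ix x).inc * kinv (ix x).next - k (ix x).next * kinv (ix x).inc)
  E_F_ne : ∀ x y, x ≠ y → Commute (E x) (F y)

/-- The scalar by which conjugation with `K_b` acts on a product of `e`'s. -/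
def chiWord {X : Type*} (ix : X → I' m n) (b : I m n) (l : List X) : Cq :=
  (l.map fun x => chi b (ix x)).prod

theorem chiWord_ne_zero {X : Type*} (ix : X → I' m n) (b : I m n) (l : List X) :
    chiWord ix b l ≠ 0 := by
  refine List.prod_ne_zero ?_
  simp only [List.mem_map, not_exists, not_and]
  exact fun x _ => chi_ne_zero b _

namespace CartanData

section Basic

variable {X : Type*} {ix : X → I' m n} {A : Type*} [Ring A] [Algebra Cq A]

/-- The image of Cartan data under an algebra homomorphism. -/
def map (D : CartanData ix A) {B : Type*} [Ring B] [Algebra Cq B] (φ : A →ₐ[Cq] B) :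
    CartanData ix B where
  E x := φ (D.E x)
  F x := φ (D.F x)
  k b := φ (D.k b)
  kinv b := φ (D.kinv b)
  k_kinv b := by rw [← map_mul, D.k_kinv, map_one]
  kinv_k b := by rw [← map_mul, D.kinv_k, map_one]
  k_comm b c := (D.k_comm b c).map φ
  k_E b x := by rw [← map_mul, D.k_E, map_smul, map_mul]
  k_F b x := by rw [← map_mul, D.k_F, map_smul, map_mul]
  E_F x := by
    rw [← map_mul, D.E_F]; simp only [map_add, map_mul, map_smul, map_sub]
  E_F_ne x y h := (D.E_F_ne x y h).map φ

variable (D : CartanData ix A)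

theorem kinv_comm_k (b c : I m n) : Commute (D.kinv b) (D.k c) := by
  have h := (D.k_comm b c).eq
  calc D.kinv b * D.k c = D.kinv b * (D.k c * D.k b) * D.kinv b := by
        rw [mul_assoc, mul_assoc, D.k_kinv, mul_one]
    _ = D.k c * D.kinv b := by rw [← h, ← mul_assoc, D.kinv_k, one_mul]

theorem kinv_comm (b c : I m n) : Commute (D.kinv b) (D.kinv c) := by
  have h := (D.kinv_comm_k b c).eq
  calc D.kinv b * D.kinv c = D.kinv c * (D.k c * D.kinv b) * D.kinv c := by
        rw [← mul_assoc, D.kinv_k, one_mul]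
    _ = D.kinv c * D.kinv b := by rw [← h, mul_assoc, mul_assoc, D.k_kinv, mul_one]

theorem kinv_E (b : I m n) (x : X) :
    D.kinv b * D.E x = (chi b (ix x))⁻¹ • (D.E x * D.kinv b) := by
  have h := congrArg (fun z => (chi b (ix x))⁻¹ • (D.kinv b * z * D.kinv b)) (D.k_E b x)
  simp only [mul_smul_comm, smul_mul_assoc, smul_smul, inv_mul_cancel₀ (chi_ne_zero b (ix x)),
    one_smul, mul_assoc, D.k_kinv, mul_one] at h
  rw [← h, ← mul_assoc, D.kinv_k, one_mul]

theorem kinv_F (b : I m n) (x : X) :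
    D.kinv b * D.F x = chi b (ix x) • (D.F x * D.kinv b) := by
  have h := congrArg (fun z => chi b (ix x) • (D.kinv b * z * D.kinv b)) (D.k_F b x)
  simp only [mul_smul_comm, smul_mul_assoc, smul_smul, mul_inv_cancel₀ (chi_ne_zero b (ix x)),
    one_smul, mul_assoc, D.k_kinv, mul_one] at h
  rw [← h, ← mul_assoc, D.kinv_k, one_mul]

/-- The symmetry exchanging the `e`'s with the `f`'s and the `K`'s with their inverses. -/
def swap : CartanData ix A where
  E := D.F
  F := D.E
  k := D.kinv
  kinv := D.k
  k_kinv := D.kinv_k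
  kinv_k := D.k_kinv
  k_comm := D.kinv_comm
  k_E := D.kinv_F
  k_F := D.kinv_E
  E_F x := by
    rw [D.E_F, (D.kinv_comm_k _ _).eq, (D.kinv_comm_k _ _).eq, add_assoc, ← smul_add]
    simp
  E_F_ne x y h := (D.E_F_ne y x h.symm).symm

end Basic

section Module

variable {X : Type*} {ix : X → I' m n} {W : Type*} [AddCommGroup W] [Module Cq W]
  (D : CartanData ix (Module.End Cq W))

/-- The operator `F x₁ F x₂ ⋯` attached to a word `x₁ x₂ ⋯`. -/
def word (l : List X) : Module.End Cq W := (l.map D.F).prod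

@[simp] theorem word_nil (v : W) : D.word [] v = v := rfl

@[simp] theorem word_cons (x : X) (l : List X) (v : W) : D.word (x :: l) v = D.F x (D.word l v) :=
  rfl

/-- `v` is annihilated by the `E`'s and is an eigenvector of the `k`'s of weight `Λ`. The vector
`v = 0` is allowed. -/
structure IsSingular (Λ : Weight m n) (v : W) : Prop where
  E_apply : ∀ x, D.E x v = 0
  k_apply : ∀ b, D.k b v = (Λ b : Cq) • v

theorem kinv_apply {b : I m n} {c : Cq} (hc : c ≠ 0) {w : W} (h : D.k b w = c • w) :
    D.kinv b w = c⁻¹ • w := by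
  have h1 := congrArg (fun z => c⁻¹ • D.kinv b z) h
  simp only [map_smul, smul_smul, inv_mul_cancel₀ hc, one_smul] at h1
  rw [← h1, ← Module.End.mul_apply, D.kinv_k, Module.End.one_apply]

theorem k_F_apply {b : I m n} {x : X} {c : Cq} {w : W} (h : D.k b w = c • w) :
    D.k b (D.F x w) = (c * (chi b (ix x))⁻¹) • D.F x w := by
  rw [← Module.End.mul_apply, D.k_F, LinearMap.smul_apply, Module.End.mul_apply, h, map_smul,
    smul_smul, mul_comm]

theorem k_word {b : I m n} {c : Cq} {v : W} (h : D.k b v = c • v) (l : List X) :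
    D.k b (D.word l v) = (c * (chiWord ix b l)⁻¹) • D.word l v := by
  induction l with
  | nil => simp [chiWord, h]
  | cons x l ih =>
    rw [word_cons, D.k_F_apply ih]
    congr 1
    simp only [chiWord, List.map_cons, List.prod_cons, mul_inv]
    ring

theorem E_F_apply (x : X) {w : W} {c d : Cq} (hc : c ≠ 0) (hd : d ≠ 0)
    (h1 : D.k (ix x).inc w = c • w) (h2 : D.k (ix x).next w = d • w) :
    D.E x (D.F x w) = D.F x (D.E x w) + ((q - q⁻¹)⁻¹ * (c / d - d / c)) • w := by
  rw [← Module.End.mul_apply, D.E_F]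
  simp only [LinearMap.add_apply, LinearMap.smul_apply, LinearMap.sub_apply, Module.End.mul_apply,
    D.kinv_apply hc h1, D.kinv_apply hd h2, map_smul, h1, h2, smul_smul, ← sub_smul]
  congr 3
  ring

variable {D} {Λ : Weight m n} {v : W}

theorem IsSingular.k_word (h : D.IsSingular Λ v) (b : I m n) (l : List X) :
    D.k b (D.word l v) = (Λ b * (chiWord ix b l)⁻¹ : Cq) • D.word l v :=
  D.k_word (h.k_apply b) l

theorem weight_mul_ne_zero (Λ : Weight m n) (b : I m n) (l : List X) :
    (Λ b * (chiWord ix b l)⁻¹ : Cq) ≠ 0 :=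
  mul_ne_zero (Λ b).ne_zero (inv_ne_zero (chiWord_ne_zero ix b l))

/-- `E x` maps a word to a combination of words with one letter `x` less. -/
theorem IsSingular.E_word (h : D.IsSingular Λ v) (x : X) (l : List X) :
    D.E x (D.word l v) ∈
      Submodule.span Cq ((fun l' => D.word l' v) '' {l' | (x :: l').Perm l}) := by
  induction l with
  | nil => rw [word_nil, h.E_apply]; exact Submodule.zero_mem _
  | cons y l ih =>
    have key : D.F y (D.E x (D.word l v)) ∈
        Submodule.span Cq ((fun l' => D.word l' v) '' {l' | (x :: l').Perm (y :: l)}) := by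
      have := Submodule.mem_map_of_mem (f := D.F y) ih
      rw [Submodule.map_span, ← Set.image_comp] at this
      refine Submodule.span_mono ?_ this
      rintro _ ⟨l', hl', rfl⟩
      exact ⟨y :: l', (List.Perm.swap y x l').trans (List.Perm.cons y hl'), rfl⟩
    by_cases hxy : x = y
    · subst hxy
      rw [word_cons, D.E_F_apply x (weight_mul_ne_zero _ _ l) (weight_mul_ne_zero _ _ l)
        (h.k_word _ _) (h.k_word _ _)]
      refine Submodule.add_mem _ key (Submodule.smul_mem _ _ (Submodule.subset_span ⟨l, ?_, rfl⟩))
      exact List.Perm.refl _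
    · rw [word_cons, ← Module.End.mul_apply, (D.E_F_ne x y hxy).eq]
      exact key

/-- The span of all vectors `F x₁ F x₂ ⋯ v`. -/
def wordSpan (D : CartanData ix (Module.End Cq W)) (v : W) : Submodule Cq W :=
  Submodule.span Cq (Set.range fun l => D.word l v)

/-- The span of all vectors `F x₁ F x₂ ⋯ v` with at least one factor `F`. -/
def posSpan (D : CartanData ix (Module.End Cq W)) (v : W) : Submodule Cq W :=
  Submodule.span Cq ((fun l => D.word l v) '' {l | l ≠ []})

theorem word_mem_wordSpan (D : CartanData ix (Module.End Cq W)) (v : W) (l : List X) :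
    D.word l v ∈ D.wordSpan v := Submodule.subset_span ⟨l, rfl⟩

theorem posSpan_le_wordSpan (D : CartanData ix (Module.End Cq W)) (v : W) :
    D.posSpan v ≤ D.wordSpan v := Submodule.span_mono (Set.image_subset_range _ _)

theorem F_mem_posSpan (x : X) {w : W} (hw : w ∈ D.wordSpan v) : D.F x w ∈ D.posSpan v := by
  have := Submodule.mem_map_of_mem (f := D.F x) hw
  rw [wordSpan, Submodule.map_span, ← Set.range_comp] at this
  refine Submodule.span_mono ?_ this
  rintro _ ⟨l, rfl⟩
  exact ⟨x :: l, by simp, rfl⟩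

theorem F_mem_wordSpan (x : X) {w : W} (hw : w ∈ D.wordSpan v) : D.F x w ∈ D.wordSpan v :=
  D.posSpan_le_wordSpan v (F_mem_posSpan x hw)

theorem IsSingular.E_mem_wordSpan (h : D.IsSingular Λ v) (x : X) {w : W}
    (hw : w ∈ D.wordSpan v) : D.E x w ∈ D.wordSpan v := by
  have : D.wordSpan v ≤ (D.wordSpan v).comap (D.E x) := by
    rw [wordSpan, Submodule.span_le]
    rintro _ ⟨l, rfl⟩
    exact Submodule.span_mono (Set.image_subset_range _ _) (h.E_word x l)
  exact this hw

theorem IsSingular.k_mem_wordSpan (h : D.IsSingular Λ v) (b : I m n) {w : W}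
    (hw : w ∈ D.wordSpan v) : D.k b w ∈ D.wordSpan v := by
  have : D.wordSpan v ≤ (D.wordSpan v).comap (D.k b) := by
    rw [wordSpan, Submodule.span_le]
    rintro _ ⟨l, rfl⟩
    change D.k b (D.word l v) ∈ D.wordSpan v
    rw [h.k_word]
    exact Submodule.smul_mem _ _ (word_mem_wordSpan D v l)
  exact this hw

theorem IsSingular.kinv_mem_wordSpan (h : D.IsSingular Λ v) (b : I m n) {w : W}
    (hw : w ∈ D.wordSpan v) : D.kinv b w ∈ D.wordSpan v := by
  have : D.wordSpan v ≤ (D.wordSpan v).comap (D.kinv b) := by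
    rw [wordSpan, Submodule.span_le]
    rintro _ ⟨l, rfl⟩
    change D.kinv b (D.word l v) ∈ D.wordSpan v
    rw [D.kinv_apply (weight_mul_ne_zero _ _ l) (h.k_word b l)]
    exact Submodule.smul_mem _ _ (word_mem_wordSpan D v l)
  exact this hw

theorem exists_eq_smul_add {w : W} (hw : w ∈ D.wordSpan v) :
    ∃ c : Cq, ∃ y ∈ D.posSpan v, w = c • v + y := by
  induction hw using Submodule.span_induction with
  | mem w hw =>
    obtain ⟨l, rfl⟩ := hw
    by_cases hl : l = []
    · exact ⟨1, 0, Submodule.zero_mem _, by simp [hl]⟩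
    · exact ⟨0, _, Submodule.subset_span ⟨l, hl, rfl⟩, by simp⟩
  | zero => exact ⟨0, 0, Submodule.zero_mem _, by simp⟩
  | add w w' _ _ hw hw' =>
    obtain ⟨c, y, hy, rfl⟩ := hw
    obtain ⟨c', y', hy', rfl⟩ := hw'
    exact ⟨c + c', y + y', Submodule.add_mem _ hy hy', by rw [add_smul]; abel⟩
  | smul r w _ hw =>
    obtain ⟨c, y, hy, rfl⟩ := hw
    exact ⟨r * c, r • y, Submodule.smul_mem _ _ hy, by rw [smul_add, smul_smul]⟩

/-! ### The height operator -/

/-- Exponents `r_b` for which conjugation with `∏_b K_b ^ r_b` multiplies every `e_a` by a positive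
even power of `q`. The choice differs for `b ≤ m`, where `q_b = q`, and `b > m`, where
`q_b = -q⁻¹`. -/
def rhoExp (b : I m n) : ℕ := if (b : ℕ) ≤ m then 2 * (m + 1 - b) else 2 * (b - m)

/-- Conjugation with `∏_b K_b ^ r_b` multiplies `e_a` by `q ^ (2 * height a)`. -/
def height (a : I' m n) : ℕ := if (a : ℕ) = m then 2 else 1

theorem height_pos (a : I' m n) : 1 ≤ height a := by unfold height; split_ifs <;> omega

theorem neg_inv_pow_two_mul {K : Type*} [Field K] (x : K) (k : ℕ) :
    (-x⁻¹) ^ (2 * k) = (x ^ (2 * k))⁻¹ := by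
  rw [Even.neg_pow (even_two_mul k), inv_pow]

theorem prod_chi_pow_rhoExp (a : I' m n) :
    ∏ b : I m n, chi b a ^ rhoExp b = q ^ (2 * height a) := by
  have h1 : ∀ b : I m n, chi b a ^ rhoExp b
      = (if a.inc = b then qa m a.inc ^ rhoExp a.inc else 1)
        * (if a.next = b then (qa m a.next ^ rhoExp a.next)⁻¹ else 1) := by
    intro b
    have e1 : a.inc = b ↔ (b : ℕ) = a := by rw [Subtype.ext_iff, eq_comm]; rfl
    have e2 : a.next = b ↔ (b : ℕ) = a + 1 := by rw [Subtype.ext_iff, eq_comm]; rfl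
    by_cases hb : (b : ℕ) = a
    · have hb2 : ¬ ((b : ℕ) = a + 1) := by omega
      obtain rfl := e1.2 hb
      simp [chi, hb, mt e2.1 hb2]
    · by_cases hb2 : (b : ℕ) = a + 1
      · obtain rfl := e2.2 hb2
        simp [chi, hb2, mt e1.1 hb, zpow_neg]
      · simp [chi, hb, hb2, mt e1.1 hb, mt e2.1 hb2]
  rw [Finset.prod_congr rfl fun b _ => h1 b, Finset.prod_mul_distrib, Finset.prod_ite_eq,
    Finset.prod_ite_eq, if_pos (Finset.mem_univ _), if_pos (Finset.mem_univ _)]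
  have ha1 := a.2.1
  have i1 : (a.inc : ℕ) = a := rfl
  have i2 : (a.next : ℕ) = a + 1 := rfl
  have hq := q_ne_zero
  rcases lt_trichotomy (a : ℕ) m with h | h | h
  · rw [rhoExp, rhoExp, qa, qa, if_pos (by omega), if_pos (by omega), if_pos (by omega),
      if_pos (by omega), height, if_neg (by omega), ← div_eq_mul_inv, div_eq_iff (pow_ne_zero _ hq),
      ← pow_add]
    congr 1; omega
  · rw [rhoExp, rhoExp, qa, qa, if_pos (by omega), if_pos (by omega), if_neg (by omega),
      if_neg (by omega), height, if_pos (by omega), neg_inv_pow_two_mul, inv_inv, ← pow_add]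
    congr 1; omega
  · rw [rhoExp, rhoExp, qa, qa, if_neg (by omega), if_neg (by omega), if_neg (by omega),
      if_neg (by omega), height, if_neg (by omega), neg_inv_pow_two_mul, neg_inv_pow_two_mul,
      inv_inv, mul_comm, ← div_eq_mul_inv, div_eq_iff (pow_ne_zero _ hq), ← pow_add]
    congr 1; omega

/-- The height operator `∏_b k_b ^ r_b`. -/
def rho (D : CartanData ix (Module.End Cq W)) : Module.End Cq W :=
  ((Finset.univ : Finset (I m n)).toList.map fun b => D.k b ^ rhoExp b).prod

theorem rho_apply {w : W} {μ : I m n → Cq} (h : ∀ b, D.k b w = μ b • w) :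
    D.rho w = (∏ b, μ b ^ rhoExp b) • w := by
  have hp : ∀ (b : I m n) (j : ℕ), (D.k b ^ j) w = μ b ^ j • w := by
    intro b j
    induction j with
    | zero => simp
    | succ j ih => rw [pow_succ', Module.End.mul_apply, ih, map_smul, h, smul_smul, pow_succ]
  rw [← Finset.prod_map_toList, rho]
  induction (Finset.univ : Finset (I m n)).toList with
  | nil => simp
  | cons b l ih =>
    rw [List.map_cons, List.prod_cons, Module.End.mul_apply, ih, map_smul, hp, smul_smul,
      List.map_cons, List.prod_cons, mul_comm]

theorem prod_chiWord_pow_rhoExp (ix : X → I' m n) (l : List X) :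
    ∏ b : I m n, chiWord ix b l ^ rhoExp b = q ^ (2 * (l.map fun x => height (ix x)).sum) := by
  induction l with
  | nil => simp [chiWord]
  | cons x l ih =>
    rw [List.map_cons, List.sum_cons, mul_add, pow_add, ← ih, ← prod_chi_pow_rhoExp,
      ← Finset.prod_mul_distrib]
    simp only [chiWord, List.map_cons, List.prod_cons, mul_pow]

theorem length_le_sum_height (ix : X → I' m n) (l : List X) :
    l.length ≤ (l.map fun x => height (ix x)).sum := by
  induction l with
  | nil => simp
  | cons x l ih =>
    rw [List.map_cons, List.sum_cons, List.length_cons]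
    have := height_pos (ix x)
    omega

theorem rho_word (h : ∀ b, D.k b v = (Λ b : Cq) • v) (l : List X) :
    D.rho (D.word l v) = ((∏ b, (Λ b : Cq) ^ rhoExp b) *
      (q ^ (2 * (l.map fun x => height (ix x)).sum))⁻¹) • D.word l v := by
  rw [rho_apply fun b => D.k_word (h b) l]
  simp only [mul_pow, Finset.prod_mul_distrib, inv_pow, Finset.prod_inv_distrib,
    prod_chiWord_pow_rhoExp]

theorem prod_pow_rhoExp_ne_zero (Λ : Weight m n) : (∏ b, (Λ b : Cq) ^ rhoExp b) ≠ 0 :=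
  Finset.prod_ne_zero_iff.2 fun b _ => pow_ne_zero _ (Λ b).ne_zero

/-- A highest weight vector is not a combination of vectors of lower height. -/
theorem IsSingular.notMem_posSpan (h : D.IsSingular Λ v) (hv : v ≠ 0) : v ∉ D.posSpan v := by
  intro hmem
  set τ := ∏ b, (Λ b : Cq) ^ rhoExp b with hτ
  have h1 : v ∈ Module.End.eigenspace D.rho τ := by
    rw [Module.End.mem_eigenspace_iff]; exact rho_apply h.k_apply
  -- nonempty words have other eigenvalues under the height operator
  have h2 : D.posSpan v ≤ ⨆ μ, ⨆ (_ : μ ≠ τ), Module.End.eigenspace D.rho μ := by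
    rw [posSpan, Submodule.span_le]
    rintro _ ⟨l, hl, rfl⟩
    have h3 := rho_word h.k_apply l
    refine Submodule.mem_iSup_of_mem _ (Submodule.mem_iSup_of_mem ?_
      (Module.End.mem_eigenspace_iff.2 h3))
    intro h4
    have h5 := mul_left_cancel₀ (prod_pow_rhoExp_ne_zero Λ) (h4.trans (mul_one _).symm)
    have h6 := q_pow_eq_one (inv_eq_one.1 h5)
    have h7 := length_le_sum_height ix l
    have h8 := List.length_pos_iff.2 hl
    omega
  have := (Module.End.eigenspaces_iSupIndep D.rho τ)
  exact hv (Submodule.disjoint_def.1 this v h1 (h2 hmem))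

end Module

end CartanData

end

section

/-! ### Relations among the `f`'s commute with the `e`'s -/

section Commutators

variable {k A : Type*} [Field k] [Ring A] [Algebra k A]

/-- `E` acts on a Serre expression through its repeated letter. -/
theorem commute_serre_left {y κ : k} (hy : y ≠ 0) {E a b h h' : A}
    (hEa : E * a = a * E + κ • (h - h')) (hEb : E * b = b * E)
    (ha : h * a = (y⁻¹ * y⁻¹) • (a * h)) (ha' : h' * a = (y * y) • (a * h'))
    (hb : h * b = y • (b * h)) (hb' : h' * b = y⁻¹ • (b * h')) : Commute E (serre y a b) := by
  have e1 : ∀ t, E * (a * t) = a * (E * t) + κ • (h * t - h' * t) := fun t => by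
    rw [← mul_assoc, hEa]; simp only [add_mul, smul_mul_assoc, sub_mul, mul_assoc]
  have e2 : ∀ t, E * (b * t) = b * (E * t) := fun t => by rw [← mul_assoc, hEb, mul_assoc]
  have e3 : ∀ t, h * (a * t) = (y⁻¹ * y⁻¹) • (a * (h * t)) := fun t => by
    rw [← mul_assoc, ha, smul_mul_assoc, mul_assoc]
  have e4 : ∀ t, h' * (a * t) = (y * y) • (a * (h' * t)) := fun t => by
    rw [← mul_assoc, ha', smul_mul_assoc, mul_assoc]
  have e5 : ∀ t, h * (b * t) = y • (b * (h * t)) := fun t => by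
    rw [← mul_assoc, hb, smul_mul_assoc, mul_assoc]
  have e6 : ∀ t, h' * (b * t) = y⁻¹ • (b * (h' * t)) := fun t => by
    rw [← mul_assoc, hb', smul_mul_assoc, mul_assoc]
  rw [commute_iff_eq, ← sub_eq_zero]
  simp only [serre, mul_add, add_mul, mul_sub, sub_mul, smul_mul_assoc, mul_smul_comm,
    mul_assoc, smul_smul, smul_sub, smul_add, e1, e2, e3, e4, e5, e6, hEa, hEb, ha, ha', hb, hb']
  match_scalars <;> field_simp <;> ring

/-- `E` acts on a Serre expression through its single letter. -/
theorem commute_serre_right {y κ : k} (hy : y ≠ 0) {E a b h h' : A}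
    (hEa : E * a = a * E) (hEb : E * b = b * E + κ • (h - h'))
    (ha : h * a = y • (a * h)) (ha' : h' * a = y⁻¹ • (a * h')) : Commute E (serre y a b) := by
  have e1 : ∀ t, E * (b * t) = b * (E * t) + κ • (h * t - h' * t) := fun t => by
    rw [← mul_assoc, hEb]; simp only [add_mul, smul_mul_assoc, sub_mul, mul_assoc]
  have e2 : ∀ t, E * (a * t) = a * (E * t) := fun t => by rw [← mul_assoc, hEa, mul_assoc]
  have e3 : ∀ t, h * (a * t) = y • (a * (h * t)) := fun t => by
    rw [← mul_assoc, ha, smul_mul_assoc, mul_assoc]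
  have e4 : ∀ t, h' * (a * t) = y⁻¹ • (a * (h' * t)) := fun t => by
    rw [← mul_assoc, ha', smul_mul_assoc, mul_assoc]
  rw [commute_iff_eq, ← sub_eq_zero]
  simp only [serre, mul_add, add_mul, mul_sub, sub_mul, smul_mul_assoc, mul_smul_comm,
    mul_assoc, smul_smul, smul_sub, smul_add, e1, e2, e3, e4, hEa, hEb, ha, ha']
  match_scalars <;> field_simp <;> ring

/-- The expression whose vanishing is the quartic relation between `a = f_{m-1}`, `b = f_m` and
`c = f_{m+1}`, with `x = q_m` and `-x⁻¹ = q_{m+1}`. -/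
def quartic (x : k) (a b c : A) : A :=
  b * qcomm (-x⁻¹) c (qcomm x b a) - qcomm (-x⁻¹) c (qcomm x b a) * b

theorem quartic_eq {x : k} (hx : x ≠ 0) {a b c : A} (hb : b * b = 0) (hac : a * c = c * a) :
    quartic x a b c = b * c * b * a - b * a * b * c - c * b * a * b + a * b * c * b
      - (x + x⁻¹) • (b * c * a * b) := by
  have hb' : ∀ t, b * (b * t) = 0 := fun t => by rw [← mul_assoc, hb, zero_mul]
  have hac' : ∀ t, a * (c * t) = c * (a * t) := fun t => by rw [← mul_assoc, hac, mul_assoc]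
  simp only [quartic, qcomm, mul_sub, sub_mul, smul_mul_assoc, mul_smul_comm,
    mul_assoc, smul_smul, smul_sub, hb, hb', hac', mul_zero, smul_zero]
  match_scalars <;> field_simp
  ring

/-- `E` acts on the quartic expression through its repeated letter. -/
theorem commute_quartic_mid {x κ : k} (hx : x ≠ 0) {E a b c h h' : A} (hb : b * b = 0)
    (hac : a * c = c * a) (hEa : E * a = a * E) (hEc : E * c = c * E)
    (hEb : E * b = b * E + κ • (h - h'))
    (ha : h * a = x • (a * h)) (ha' : h' * a = x⁻¹ • (a * h'))
    (hbb : h * b = (-1 : k) • (b * h)) (hbb' : h' * b = (-1 : k) • (b * h'))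
    (hc : h * c = (-x⁻¹) • (c * h)) (hc' : h' * c = (-x) • (c * h')) :
    Commute E (quartic x a b c) := by
  have e1 : ∀ t, E * (b * t) = b * (E * t) + κ • (h * t - h' * t) := fun t => by
    rw [← mul_assoc, hEb]; simp only [add_mul, smul_mul_assoc, sub_mul, mul_assoc]
  have e2 : ∀ t, E * (a * t) = a * (E * t) := fun t => by rw [← mul_assoc, hEa, mul_assoc]
  have e2' : ∀ t, E * (c * t) = c * (E * t) := fun t => by rw [← mul_assoc, hEc, mul_assoc]
  have e3 : ∀ t, h * (a * t) = x • (a * (h * t)) := fun t => by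
    rw [← mul_assoc, ha, smul_mul_assoc, mul_assoc]
  have e4 : ∀ t, h' * (a * t) = x⁻¹ • (a * (h' * t)) := fun t => by
    rw [← mul_assoc, ha', smul_mul_assoc, mul_assoc]
  have e5 : ∀ t, h * (b * t) = (-1 : k) • (b * (h * t)) := fun t => by
    rw [← mul_assoc, hbb, smul_mul_assoc, mul_assoc]
  have e6 : ∀ t, h' * (b * t) = (-1 : k) • (b * (h' * t)) := fun t => by
    rw [← mul_assoc, hbb', smul_mul_assoc, mul_assoc]
  have e7 : ∀ t, h * (c * t) = (-x⁻¹) • (c * (h * t)) := fun t => by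
    rw [← mul_assoc, hc, smul_mul_assoc, mul_assoc]
  have e8 : ∀ t, h' * (c * t) = (-x) • (c * (h' * t)) := fun t => by
    rw [← mul_assoc, hc', smul_mul_assoc, mul_assoc]
  have e9 : ∀ t, a * (c * t) = c * (a * t) := fun t => by rw [← mul_assoc, hac, mul_assoc]
  rw [commute_iff_eq, ← sub_eq_zero, quartic_eq hx hb hac]
  simp only [mul_add, add_mul, mul_sub, sub_mul, smul_mul_assoc, mul_smul_comm,
    mul_assoc, smul_smul, smul_sub, smul_add, e1, e2, e2', e3, e4, e5, e6, e7, e8, e9, hEa, hEb,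
    hEc, ha, ha', hbb, hbb', hc, hc']
  match_scalars <;> field_simp <;> ring

/-- `E` acts on the quartic expression through the letter `a`. -/
theorem commute_quartic_left {x κ : k} (hx : x ≠ 0) {E a b c h h' : A} (hb : b * b = 0)
    (hac : a * c = c * a) (hEb : E * b = b * E) (hEc : E * c = c * E)
    (hEa : E * a = a * E + κ • (h - h'))
    (hbb : h * b = x • (b * h)) (hbb' : h' * b = x⁻¹ • (b * h'))
    (hc : h * c = c * h) (hc' : h' * c = c * h') :
    Commute E (quartic x a b c) := by
  have e1 : ∀ t, E * (a * t) = a * (E * t) + κ • (h * t - h' * t) := fun t => by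
    rw [← mul_assoc, hEa]; simp only [add_mul, smul_mul_assoc, sub_mul, mul_assoc]
  have e2 : ∀ t, E * (b * t) = b * (E * t) := fun t => by rw [← mul_assoc, hEb, mul_assoc]
  have e2' : ∀ t, E * (c * t) = c * (E * t) := fun t => by rw [← mul_assoc, hEc, mul_assoc]
  have e5 : ∀ t, h * (b * t) = x • (b * (h * t)) := fun t => by
    rw [← mul_assoc, hbb, smul_mul_assoc, mul_assoc]
  have e6 : ∀ t, h' * (b * t) = x⁻¹ • (b * (h' * t)) := fun t => by
    rw [← mul_assoc, hbb', smul_mul_assoc, mul_assoc]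
  have e7 : ∀ t, h * (c * t) = c * (h * t) := fun t => by rw [← mul_assoc, hc, mul_assoc]
  have e8 : ∀ t, h' * (c * t) = c * (h' * t) := fun t => by rw [← mul_assoc, hc', mul_assoc]
  have e9 : ∀ t, b * (b * t) = 0 := fun t => by rw [← mul_assoc, hb, zero_mul]
  rw [commute_iff_eq, ← sub_eq_zero, quartic_eq hx hb hac]
  simp only [mul_add, add_mul, mul_sub, sub_mul, smul_mul_assoc, mul_smul_comm,
    mul_assoc, smul_smul, smul_sub, smul_add, e1, e2, e2', e5, e6, e7, e8, e9, hEa, hEb,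
    hEc, hbb, hbb', hc, hc', mul_zero, smul_zero]
  match_scalars <;> field_simp <;> ring

/-- `E` acts on the quartic expression through the letter `c`. -/
theorem commute_quartic_right {x κ : k} (hx : x ≠ 0) {E a b c h h' : A} (hb : b * b = 0)
    (hac : a * c = c * a) (hEb : E * b = b * E) (hEa : E * a = a * E)
    (hEc : E * c = c * E + κ • (h - h'))
    (hbb : h * b = (-x⁻¹) • (b * h)) (hbb' : h' * b = (-x) • (b * h'))
    (ha : h * a = a * h) (ha' : h' * a = a * h') :
    Commute E (quartic x a b c) := by
  have e1 : ∀ t, E * (c * t) = c * (E * t) + κ • (h * t - h' * t) := fun t => by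
    rw [← mul_assoc, hEc]; simp only [add_mul, smul_mul_assoc, sub_mul, mul_assoc]
  have e2 : ∀ t, E * (b * t) = b * (E * t) := fun t => by rw [← mul_assoc, hEb, mul_assoc]
  have e2' : ∀ t, E * (a * t) = a * (E * t) := fun t => by rw [← mul_assoc, hEa, mul_assoc]
  have e5 : ∀ t, h * (b * t) = (-x⁻¹) • (b * (h * t)) := fun t => by
    rw [← mul_assoc, hbb, smul_mul_assoc, mul_assoc]
  have e6 : ∀ t, h' * (b * t) = (-x) • (b * (h' * t)) := fun t => by
    rw [← mul_assoc, hbb', smul_mul_assoc, mul_assoc]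
  have e7 : ∀ t, h * (a * t) = a * (h * t) := fun t => by rw [← mul_assoc, ha, mul_assoc]
  have e8 : ∀ t, h' * (a * t) = a * (h' * t) := fun t => by rw [← mul_assoc, ha', mul_assoc]
  have e9 : ∀ t, b * (b * t) = 0 := fun t => by rw [← mul_assoc, hb, zero_mul]
  rw [commute_iff_eq, ← sub_eq_zero, quartic_eq hx hb hac]
  simp only [mul_add, add_mul, mul_sub, sub_mul, smul_mul_assoc, mul_smul_comm,
    mul_assoc, smul_smul, smul_sub, smul_add, e1, e2, e2', e5, e6, e7, e8, e9, hEa, hEb,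
    hEc, hbb, hbb', ha, ha', mul_zero, smul_zero]
  match_scalars <;> field_simp <;> ring

end Commutators

variable {m n : ℕ}

/-- The scalar by which conjugation with `k_z = K_z K_{z+1}⁻¹` acts on `f_x`. -/
def theta (z x : I' m n) : Cq := (chi z.inc x)⁻¹ * chi z.next x

theorem theta_self {a : I' m n} (h : (a : ℕ) ≠ m) : theta a a = (qa m a)⁻¹ * (qa m a)⁻¹ := by
  have : qa m (a + 1) = qa m a := by unfold qa; split_ifs <;> first | rfl | omega
  simp [theta, chi, I'.inc, I'.next, this]

theorem theta_self_m {a : I' m n} (h : (a : ℕ) = m) : theta a a = -1 := by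
  have hq := q_ne_zero
  simp only [theta, chi, I'.inc, I'.next, h, qa]
  simp
  field_simp

theorem theta_succ {z x : I' m n} (h : (x : ℕ) = z + 1) : theta z x = qa m x := by
  simp [theta, chi, I'.inc, I'.next, h]
  intro
  omega

theorem theta_pred {z x : I' m n} (h : (z : ℕ) = x + 1) : theta z x = qa m z := by
  simp [theta, chi, I'.inc, I'.next, h]
  intro
  omega

theorem theta_far {z x : I' m n} (h : (z : ℕ) + 1 < x ∨ (x : ℕ) + 1 < z) : theta z x = 1 := by
  have h1 : ((z : ℕ) : ℕ) ≠ x := by omega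
  have h2 : (z : ℕ) ≠ x + 1 := by omega
  have h3 : (z : ℕ) + 1 ≠ x := by omega
  simp [theta, chi, I'.inc, I'.next, h1, h2, h3]

namespace CartanData

variable {A : Type*} [Ring A] [Algebra Cq A] (D : CartanData (id : I' m n → I' m n) A)

/-- The element `k_z = K_z K_{z+1}⁻¹`. -/
def h (z : I' m n) : A := D.k z.inc * D.kinv z.next

/-- The element `k_z⁻¹`. -/
def h' (z : I' m n) : A := D.k z.next * D.kinv z.inc

theorem E_F_eq (z : I' m n) : D.E z * D.F z = D.F z * D.E z + (q - q⁻¹)⁻¹ • (D.h z - D.h' z) :=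
  D.E_F z

theorem h_F (z x : I' m n) : D.h z * D.F x = theta z x • (D.F x * D.h z) := by
  rw [h, mul_assoc, D.kinv_F, mul_smul_comm, ← mul_assoc, D.k_F, smul_mul_assoc, smul_smul,
    mul_assoc, theta, mul_comm]; rfl

theorem h'_F (z x : I' m n) : D.h' z * D.F x = (theta z x)⁻¹ • (D.F x * D.h' z) := by
  rw [h', mul_assoc, D.kinv_F, mul_smul_comm, ← mul_assoc, D.k_F, smul_mul_assoc, smul_smul,
    mul_assoc, theta, mul_inv, inv_inv]; rfl

theorem E_comm_F_comm {a b : I' m n} (hab : (a : ℕ) + 1 < b ∨ (b : ℕ) + 1 < a) (z : I' m n) :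
    Commute (D.E z) (D.F a * D.F b - D.F b * D.F a) := by
  have key : ∀ {a b : I' m n}, ((a : ℕ) + 1 < b ∨ (b : ℕ) + 1 < a) →
      Commute (D.E a) (D.F a * D.F b - D.F b * D.F a) := by
    intro a b hab
    have hne : a ≠ b := by rintro rfl; omega
    have e1 := D.h_F a b
    have e2 := D.h'_F a b
    rw [theta_far hab, one_smul] at e1
    rw [theta_far hab, inv_one, one_smul] at e2
    have e3 := (D.E_F_ne a b hne).eq
    rw [commute_iff_eq, mul_sub, ← mul_assoc, ← mul_assoc, e3, D.E_F_eq, mul_assoc, D.E_F_eq,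
      add_mul, smul_mul_assoc, sub_mul, e1, e2, mul_assoc, e3]
    simp only [mul_add, mul_sub, sub_mul, mul_smul_comm, mul_assoc]
    abel
  by_cases hza : z = a
  · subst hza; exact key hab
  by_cases hzb : z = b
  · subst hzb
    have := (key hab.symm).neg_right
    rwa [neg_sub] at this
  · exact ((D.E_F_ne z a hza).mul_right (D.E_F_ne z b hzb)).sub_right
      ((D.E_F_ne z b hzb).mul_right (D.E_F_ne z a hza))

theorem E_comm_serre {a b : I' m n} (ha : (a : ℕ) ≠ m)
    (hab : (b : ℕ) = a + 1 ∨ (a : ℕ) = b + 1) (z : I' m n) :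
    Commute (D.E z) (serre (qa m a) (D.F a) (D.F b)) := by
  have hne : a ≠ b := by rintro rfl; omega
  have hy := qa_ne_zero m a
  have hq : theta a b = qa m a ∧ theta b a = qa m a := by
    have e : ∀ i : ℕ, i ≠ m → qa m (i + 1) = qa m i := fun i hi => by
      unfold qa; split_ifs <;> first | rfl | omega
    rcases hab with h | h
    · rw [theta_succ h, theta_pred h, h, e _ ha]; exact ⟨rfl, rfl⟩
    · rw [theta_pred h, theta_succ h]; exact ⟨rfl, rfl⟩
  by_cases hza : z = a
  · subst hza
    refine commute_serre_left hy (D.E_F_eq z) (D.E_F_ne z b hne).eq ?_ ?_ ?_ ?_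
      (h := D.h z) (h' := D.h' z)
    · rw [D.h_F, theta_self ha]
    · rw [D.h'_F, theta_self ha, mul_inv, inv_inv]
    · rw [D.h_F, hq.1]
    · rw [D.h'_F, hq.1]
  by_cases hzb : z = b
  · subst hzb
    refine commute_serre_right hy (D.E_F_ne z a hza).eq (D.E_F_eq z) ?_ ?_
      (h := D.h z) (h' := D.h' z)
    · rw [D.h_F, hq.2]
    · rw [D.h'_F, hq.2]
  · have c1 := D.E_F_ne z a hza
    have c2 := D.E_F_ne z b hzb
    exact (((c1.mul_right c1).mul_right c2).sub_right
      (((c1.mul_right c2).mul_right c1).smul_right _)).add_right ((c2.mul_right c1).mul_right c1)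

theorem E_comm_F_sq {a : I' m n} (ha : (a : ℕ) = m) (z : I' m n) :
    Commute (D.E z) (D.F a * D.F a) := by
  by_cases hza : z = a
  · subst hza
    have e1 := D.h_F z z
    have e2 := D.h'_F z z
    rw [theta_self_m ha] at e1 e2
    rw [commute_iff_eq, ← mul_assoc, D.E_F_eq, add_mul, mul_assoc, D.E_F_eq, smul_mul_assoc,
      sub_mul, e1, e2, mul_add, mul_smul_comm, mul_sub, mul_assoc]
    norm_num
    simp only [smul_sub]
    abel
  · exact (D.E_F_ne z a hza).mul_right (D.E_F_ne z a hza)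

theorem E_comm_quartic {a b c : I' m n} (ha : (a : ℕ) + 1 = m) (hb : (b : ℕ) = m)
    (hc : (c : ℕ) = m + 1) (hsq : D.F b * D.F b = 0) (hac : D.F a * D.F c = D.F c * D.F a)
    (z : I' m n) : Commute (D.E z) (quartic q (D.F a) (D.F b) (D.F c)) := by
  have hab : a ≠ b := by rintro rfl; omega
  have hbc : b ≠ c := by rintro rfl; omega
  have hacne : a ≠ c := by rintro rfl; omega
  have hx := q_ne_zero
  have q1 : qa m b = q := if_pos (by omega)
  have q2 : qa m c = -q⁻¹ := if_neg (by omega)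
  have q3 : (-q⁻¹)⁻¹ = -q := by field_simp
  by_cases hza : z = a
  · subst hza
    refine commute_quartic_left hx hsq hac (D.E_F_ne z b hab).eq (D.E_F_ne z c hacne).eq
      (D.E_F_eq z) ?_ ?_ ?_ ?_ (h := D.h z) (h' := D.h' z)
    · rw [D.h_F, theta_succ (by omega), q1]
    · rw [D.h'_F, theta_succ (by omega), q1]
    · rw [D.h_F, theta_far (by omega), one_smul]
    · rw [D.h'_F, theta_far (by omega), inv_one, one_smul]
  by_cases hzb : z = b
  · subst hzb
    refine commute_quartic_mid hx hsq hac (D.E_F_ne z a hza).eq (D.E_F_ne z c hbc).eq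
      (D.E_F_eq z) ?_ ?_ ?_ ?_ ?_ ?_ (h := D.h z) (h' := D.h' z)
    · rw [D.h_F, theta_pred (by omega), q1]
    · rw [D.h'_F, theta_pred (by omega), q1]
    · rw [D.h_F, theta_self_m hb]
    · rw [D.h'_F, theta_self_m hb]; norm_num
    · rw [D.h_F, theta_succ (by omega), q2]
    · rw [D.h'_F, theta_succ (by omega), q2, q3]
  by_cases hzc : z = c
  · subst hzc
    refine commute_quartic_right hx hsq hac (D.E_F_ne z b hzb).eq (D.E_F_ne z a hza).eq
      (D.E_F_eq z) ?_ ?_ ?_ ?_ (h := D.h z) (h' := D.h' z)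
    · rw [D.h_F, theta_pred (by omega), q2]
    · rw [D.h'_F, theta_pred (by omega), q2, q3]
    · rw [D.h_F, theta_far (by omega), one_smul]
    · rw [D.h'_F, theta_far (by omega), inv_one, one_smul]
  · have c1 := D.E_F_ne z a hza
    have c2 := D.E_F_ne z b hzb
    have c3 := D.E_F_ne z c hzc
    have c4 : Commute (D.E z) (qcomm (-q⁻¹) (D.F c) (qcomm q (D.F b) (D.F a))) :=
      commute_qcomm c3 (commute_qcomm c2 c1)
    exact (c2.mul_right c4).sub_right (c4.mul_right c2)

end CartanData

end

section

/-! ### A highest weight module of arbitrary weight -/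

variable {m n : ℕ}

/-- The space with basis the words in the letters `f_a`. -/
abbrev WordSpace (m n : ℕ) : Type := List (I' m n) →₀ Cq

namespace WordSpace

variable (Λ : Weight m n)

/-- The eigenvalue of `K_b` on a word, where the empty word has weight `Λ`. -/
def wt (b : I m n) (l : List (I' m n)) : Cq := Λ b * (chiWord id b l)⁻¹

theorem wt_ne_zero (b : I m n) (l : List (I' m n)) : wt Λ b l ≠ 0 :=
  CartanData.weight_mul_ne_zero Λ b l

theorem wt_cons (b : I m n) (a : I' m n) (l : List (I' m n)) :
    wt Λ b (a :: l) = wt Λ b l * (chi b a)⁻¹ := by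
  simp only [wt, chiWord, List.map_cons, List.prod_cons, mul_inv, id]; ring

/-- The action of `f_a`: put the letter `a` in front of a word. -/
def F (a : I' m n) : Module.End Cq (WordSpace m n) := Finsupp.lmapDomain Cq Cq (List.cons a)

/-- The operator with eigenvectors the words and eigenvalues `c`. -/
def diag (c : List (I' m n) → Cq) : Module.End Cq (WordSpace m n) :=
  Finsupp.linearCombination Cq fun l => Finsupp.single l (c l)

/-- The action of `e_a` on a word. -/
def eWord (a : I' m n) : List (I' m n) → WordSpace m n
  | [] => 0
  | b :: l => F b (eWord a l) + if a = b then ((q - q⁻¹)⁻¹ *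
      (wt Λ a.inc l * (wt Λ a.next l)⁻¹ - wt Λ a.next l * (wt Λ a.inc l)⁻¹)) • Finsupp.single l 1
      else 0

/-- The action of `e_a`. -/
def E (a : I' m n) : Module.End Cq (WordSpace m n) := Finsupp.linearCombination Cq (eWord Λ a)

theorem F_single (a : I' m n) (l : List (I' m n)) :
    F a (Finsupp.single l 1) = Finsupp.single (a :: l) 1 := by
  rw [F, Finsupp.lmapDomain_apply, Finsupp.mapDomain_single]

theorem diag_single (c : List (I' m n) → Cq) (l : List (I' m n)) :
    diag c (Finsupp.single l 1) = c l • Finsupp.single l 1 := by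
  rw [diag, Finsupp.linearCombination_single, one_smul, Finsupp.smul_single_one]

theorem E_single (a : I' m n) (l : List (I' m n)) :
    E Λ a (Finsupp.single l 1) = eWord Λ a l := by
  rw [E, Finsupp.linearCombination_single, one_smul]

theorem hom_ext {φ ψ : Module.End Cq (WordSpace m n)}
    (h : ∀ l, φ (Finsupp.single l 1) = ψ (Finsupp.single l 1)) : φ = ψ :=
  Finsupp.lhom_ext' fun l => LinearMap.ext_ring (h l)

theorem diag_F (b : I m n) (a : I' m n) (w : WordSpace m n) :
    diag (wt Λ b) (F a w) = (chi b a)⁻¹ • F a (diag (wt Λ b) w) := by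
  have : diag (wt Λ b) * F a = (chi b a)⁻¹ • (F a * diag (wt Λ b)) := by
    refine hom_ext fun l => ?_
    rw [Module.End.mul_apply, F_single, diag_single, LinearMap.smul_apply, Module.End.mul_apply,
      diag_single, map_smul, F_single, wt_cons, smul_smul, mul_comm]
  exact LinearMap.congr_fun this w

theorem diag_eWord (b : I m n) (a : I' m n) (l : List (I' m n)) :
    diag (wt Λ b) (eWord Λ a l) = (wt Λ b l * chi b a) • eWord Λ a l := by
  induction l with
  | nil => simp [eWord]
  | cons c l ih =>
    rw [eWord, map_add, diag_F, ih, map_smul, smul_smul, smul_add, wt_cons]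
    congr 1
    · congr 1; ring
    · split_ifs with h
      · subst h
        rw [map_smul, diag_single, smul_comm]
        congr 1
        rw [mul_assoc, inv_mul_cancel₀ (chi_ne_zero _ _), mul_one]
      · simp

/-- The operators on the word space satisfy all relations that do not involve two `e`'s or two
`f`'s. -/
def cartanData : CartanData (id : I' m n → I' m n) (Module.End Cq (WordSpace m n)) where
  E := E Λ
  F := F
  k b := diag (wt Λ b)
  kinv b := diag fun l => (wt Λ b l)⁻¹
  k_kinv b := hom_ext fun l => by
    simp only [Module.End.mul_apply, diag_single, map_smul, smul_smul, Module.End.one_apply,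
      inv_mul_cancel₀ (wt_ne_zero Λ b l), one_smul]
  kinv_k b := hom_ext fun l => by
    simp only [Module.End.mul_apply, diag_single, map_smul, smul_smul, Module.End.one_apply,
      mul_inv_cancel₀ (wt_ne_zero Λ b l), one_smul]
  k_comm b c := hom_ext fun l => by
    simp only [Module.End.mul_apply, diag_single, map_smul, smul_smul, mul_comm]
  k_E b x := hom_ext fun l => by
    simp only [Module.End.mul_apply, diag_single, map_smul, LinearMap.smul_apply, E_single,
      diag_eWord, smul_smul, id, mul_comm]
  k_F b x := LinearMap.ext fun w => diag_F Λ b x w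
  E_F x := hom_ext fun l => by
    simp only [Module.End.mul_apply, diag_single, map_smul, LinearMap.smul_apply, E_single,
      F_single, LinearMap.add_apply, LinearMap.sub_apply, smul_smul, ← sub_smul, id]
    rw [eWord, if_pos rfl]
    congr 3
    ring
  E_F_ne x y h := hom_ext fun l => by
    simp only [Module.End.mul_apply, E_single, F_single]
    rw [eWord, if_neg h, add_zero]

/-- The coefficient of the empty word. -/
def eps : WordSpace m n →ₗ[Cq] Cq := Finsupp.lapply []

end WordSpace

namespace CartanData

variable {X : Type*} {ix : X → I' m n} {W : Type*} [AddCommGroup W] [Module Cq W]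

/-- A subspace stable under all operators of some Cartan data. -/
structure IsStable (D : CartanData ix (Module.End Cq W)) (T : Submodule Cq W) : Prop where
  E : ∀ x, T ≤ T.comap (D.E x)
  F : ∀ x, T ≤ T.comap (D.F x)
  k : ∀ b, T ≤ T.comap (D.k b)
  kinv : ∀ b, T ≤ T.comap (D.kinv b)

variable (D : CartanData ix (Module.End Cq W))

theorem IsStable.sSup {S : Set (Submodule Cq W)} (h : ∀ T ∈ S, D.IsStable T) :
    D.IsStable (sSup S) where
  E x := sSup_le fun T hT => ((h T hT).E x).trans (Submodule.comap_mono (le_sSup hT))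
  F x := sSup_le fun T hT => ((h T hT).F x).trans (Submodule.comap_mono (le_sSup hT))
  k x := sSup_le fun T hT => ((h T hT).k x).trans (Submodule.comap_mono (le_sSup hT))
  kinv x := sSup_le fun T hT => ((h T hT).kinv x).trans (Submodule.comap_mono (le_sSup hT))

/-- The operators induced on a quotient by a stable subspace. -/
def quot {N : Submodule Cq W} (hN : D.IsStable N) :
    CartanData ix (Module.End Cq (W ⧸ N)) where
  E x := N.mapQ N (D.E x) (hN.E x)
  F x := N.mapQ N (D.F x) (hN.F x)
  k b := N.mapQ N (D.k b) (hN.k b)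
  kinv b := N.mapQ N (D.kinv b) (hN.kinv b)
  k_kinv b := Submodule.linearMap_qext _ <| LinearMap.ext fun w =>
    congrArg N.mkQ (LinearMap.congr_fun (D.k_kinv b) w)
  kinv_k b := Submodule.linearMap_qext _ <| LinearMap.ext fun w =>
    congrArg N.mkQ (LinearMap.congr_fun (D.kinv_k b) w)
  k_comm b c := Submodule.linearMap_qext _ <| LinearMap.ext fun w =>
    congrArg N.mkQ (LinearMap.congr_fun (D.k_comm b c).eq w)
  k_E b x := Submodule.linearMap_qext _ <| LinearMap.ext fun w =>
    congrArg N.mkQ (LinearMap.congr_fun (D.k_E b x) w)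
  k_F b x := Submodule.linearMap_qext _ <| LinearMap.ext fun w =>
    congrArg N.mkQ (LinearMap.congr_fun (D.k_F b x) w)
  E_F x := Submodule.linearMap_qext _ <| LinearMap.ext fun w =>
    congrArg N.mkQ (LinearMap.congr_fun (D.E_F x) w)
  E_F_ne x y h := Submodule.linearMap_qext _ <| LinearMap.ext fun w =>
    congrArg N.mkQ (LinearMap.congr_fun (D.E_F_ne x y h).eq w)

/-- The subalgebra generated by the `F`'s, the `k`'s and their inverses. -/
def borel : Subalgebra Cq (Module.End Cq W) :=
  Algebra.adjoin Cq (Set.range D.F ∪ Set.range D.k ∪ Set.range D.kinv)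

theorem F_mem_borel (x : X) : D.F x ∈ D.borel := Algebra.subset_adjoin (.inl (.inl ⟨x, rfl⟩))
theorem k_mem_borel (b : I m n) : D.k b ∈ D.borel := Algebra.subset_adjoin (.inl (.inr ⟨b, rfl⟩))
theorem kinv_mem_borel (b : I m n) : D.kinv b ∈ D.borel := Algebra.subset_adjoin (.inr ⟨b, rfl⟩)

/-- The subspace generated by `Z` under the `F`'s, the `k`'s and their inverses. -/
def borelSpan (Z : Submodule Cq W) : Submodule Cq W :=
  Submodule.span Cq {z | ∃ y ∈ D.borel, ∃ w ∈ Z, z = y w}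

theorem le_borelSpan (Z : Submodule Cq W) : Z ≤ D.borelSpan Z := fun z hz =>
  Submodule.subset_span ⟨1, one_mem _, z, hz, rfl⟩

theorem borel_apply_mem_borelSpan {Z : Submodule Cq W} {y : Module.End Cq W} (hy : y ∈ D.borel)
    {z : W} (hz : z ∈ D.borelSpan Z) : y z ∈ D.borelSpan Z := by
  have : D.borelSpan Z ≤ (D.borelSpan Z).comap y := by
    nth_rewrite 1 [borelSpan]
    rw [Submodule.span_le]
    rintro _ ⟨y', hy', w, hw, rfl⟩
    exact Submodule.subset_span ⟨y * y', mul_mem hy hy', w, hw, rfl⟩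
  exact this hz

/-- If `Z` is stable under the `E`'s, then `borelSpan Z` is stable under all operators. -/
theorem isStable_borelSpan {Z : Submodule Cq W} (hZ : ∀ x, Z ≤ Z.comap (D.E x)) :
    D.IsStable (D.borelSpan Z) where
  F x _ hz := D.borel_apply_mem_borelSpan (D.F_mem_borel x) hz
  k b _ hz := D.borel_apply_mem_borelSpan (D.k_mem_borel b) hz
  kinv b _ hz := D.borel_apply_mem_borelSpan (D.kinv_mem_borel b) hz
  E x := by
    nth_rewrite 1 [borelSpan]
    rw [Submodule.span_le]
    rintro _ ⟨y, hy, z, hz, rfl⟩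
    change D.E x (y z) ∈ D.borelSpan Z
    have h0 : z ∈ D.borelSpan Z := D.le_borelSpan Z hz
    have h1 : D.E x z ∈ D.borelSpan Z := D.le_borelSpan Z (hZ x hz)
    clear hz
    have hy0 := hy
    induction hy using Algebra.adjoin_induction generalizing z with
    | mem y hy =>
      rcases hy with (⟨a, rfl⟩ | ⟨b, rfl⟩) | ⟨b, rfl⟩
      · by_cases hxa : x = a
        · subst hxa
          rw [← Module.End.mul_apply, D.E_F]
          refine Submodule.add_mem _ (D.borel_apply_mem_borelSpan (D.F_mem_borel x) h1)
            (Submodule.smul_mem _ _ (Submodule.sub_mem _ ?_ ?_))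
          · exact D.borel_apply_mem_borelSpan (mul_mem (D.k_mem_borel _) (D.kinv_mem_borel _)) h0
          · exact D.borel_apply_mem_borelSpan (mul_mem (D.k_mem_borel _) (D.kinv_mem_borel _)) h0
        · rw [← Module.End.mul_apply, (D.E_F_ne x a hxa).eq]
          exact D.borel_apply_mem_borelSpan hy0 h1
      · have e := congrArg (fun g => (chi b (ix x))⁻¹ • g z) (D.k_E b x)
        simp only [LinearMap.smul_apply, smul_smul, inv_mul_cancel₀ (chi_ne_zero b (ix x)),
          one_smul, Module.End.mul_apply] at e
        rw [← e]
        exact Submodule.smul_mem _ _ (D.borel_apply_mem_borelSpan hy0 h1)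
      · have e := congrArg (fun g => chi b (ix x) • g z) (D.kinv_E b x)
        simp only [LinearMap.smul_apply, smul_smul, mul_inv_cancel₀ (chi_ne_zero b (ix x)),
          one_smul, Module.End.mul_apply] at e
        rw [← e]
        exact Submodule.smul_mem _ _ (D.borel_apply_mem_borelSpan hy0 h1)
    | algebraMap c =>
      rw [Module.algebraMap_end_apply, map_smul]
      exact Submodule.smul_mem _ _ h1
    | add y y' hy hy' ih ih' =>
      rw [LinearMap.add_apply, map_add]
      exact Submodule.add_mem _ (ih z h0 h1 hy) (ih' z h0 h1 hy')
    | mul y y' hy hy' ih ih' =>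
      rw [Module.End.mul_apply]
      exact ih _ (D.borel_apply_mem_borelSpan hy' h0) (ih' z h0 h1 hy') hy

end CartanData

namespace WordSpace

variable (Λ : Weight m n)

/-- The largest stable subspace of the word space in which the empty word has coefficient `0`. -/
def radical : Submodule Cq (WordSpace m n) :=
  sSup {T | (cartanData Λ).IsStable T ∧ T ≤ LinearMap.ker eps}

theorem isStable_radical : (cartanData Λ).IsStable (radical Λ) :=
  CartanData.IsStable.sSup _ fun _ hT => hT.1

theorem radical_le : radical Λ ≤ LinearMap.ker eps := sSup_le fun _ hT => hT.2

/-- The quotient of the word space by its radical. -/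
abbrev Quo : Type := WordSpace m n ⧸ radical Λ

/-- The operators induced on the quotient by the radical. -/
def quoData : CartanData (id : I' m n → I' m n) (Module.End Cq (Quo Λ)) :=
  (cartanData Λ).quot (isStable_radical Λ)

/-- The linear form induced by `eps` on the quotient by the radical. -/
def quoEps : Quo Λ →ₗ[Cq] Cq := (radical Λ).liftQ eps (radical_le Λ)

/-- The image of the empty word. -/
def vac : Quo Λ := (radical Λ).mkQ (Finsupp.single [] 1)

theorem quoEps_vac : quoEps Λ (vac Λ) = 1 := by
  rw [quoEps, vac, Submodule.mkQ_apply, Submodule.liftQ_apply]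
  simp [eps]

theorem quoEps_F (a : I' m n) (w : Quo Λ) : quoEps Λ ((quoData Λ).F a w) = 0 := by
  obtain ⟨w, rfl⟩ := Submodule.mkQ_surjective _ w
  change eps (F a w) = 0
  simp only [eps, F, Finsupp.lapply_apply, Finsupp.lmapDomain_apply]
  exact Finsupp.mapDomain_of_notMem_range _ _ (by simp)

theorem quoEps_k (b : I m n) (w : Quo Λ) :
    quoEps Λ ((quoData Λ).k b w) = Λ b * quoEps Λ w := by
  obtain ⟨w, rfl⟩ := Submodule.mkQ_surjective _ w
  change eps (diag (wt Λ b) w) = Λ b * eps w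
  have : eps ∘ₗ diag (wt Λ b) = (Λ b : Cq) • eps := by
    refine Finsupp.lhom_ext' fun l => LinearMap.ext_ring ?_
    by_cases hl : l = []
    · subst hl; simp [eps, diag, wt, chiWord]
    · simp [eps, diag, hl]
  exact LinearMap.congr_fun this w

theorem isSingular_vac : (quoData Λ).IsSingular Λ (vac Λ) where
  E_apply x := by
    change (radical Λ).mkQ (E Λ x (Finsupp.single [] 1)) = 0
    rw [E_single, eWord, map_zero]
  k_apply b := by
    change (radical Λ).mkQ (diag (wt Λ b) (Finsupp.single [] 1)) = _
    rw [diag_single, map_smul]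
    simp [wt, chiWord, vac]

theorem word_vac (l : List (I' m n)) :
    (quoData Λ).word l (vac Λ) = (radical Λ).mkQ (Finsupp.single l 1) := by
  induction l with
  | nil => rfl
  | cons a l ih =>
    rw [CartanData.word_cons, ih]
    change (radical Λ).mkQ (F a (Finsupp.single l 1)) = _
    rw [F_single]

/-- The quotient by the radical has no stable subspaces consisting of vectors without component
along the highest weight vector. -/
theorem eq_bot_of_isStable {T : Submodule Cq (Quo Λ)} (hT : (quoData Λ).IsStable T)
    (h : T ≤ LinearMap.ker (quoEps Λ)) : T = ⊥ := by
  have h1 : T.comap (radical Λ).mkQ ≤ radical Λ := by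
    refine le_sSup ⟨⟨fun x w hw => ?_, fun x w hw => ?_, fun x w hw => ?_, fun x w hw => ?_⟩,
      fun w hw => ?_⟩
    exacts [hT.E x hw, hT.F x hw, hT.k x hw, hT.kinv x hw, h hw]
  rw [eq_bot_iff]
  intro w hw
  obtain ⟨w, rfl⟩ := Submodule.mkQ_surjective _ w
  have := h1 hw
  rw [Submodule.mem_bot, Submodule.mkQ_apply, Submodule.Quotient.mk_eq_zero]
  exact this

/-- An operator which commutes with the `e`'s and lowers the degree is zero. -/
theorem eq_zero_of_commute_E {r : Module.End Cq (Quo Λ)} (hr : ∀ x, Commute ((quoData Λ).E x) r)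
    (h0 : ∀ w, quoEps Λ (r w) = 0) : r = 0 := by
  have h1 : (quoData Λ).borelSpan (LinearMap.range r) = ⊥ := by
    refine eq_bot_of_isStable Λ ((quoData Λ).isStable_borelSpan ?_) ?_
    · rintro x _ ⟨w, rfl⟩
      exact ⟨(quoData Λ).E x w, (LinearMap.congr_fun (hr x).eq w).symm⟩
    rw [CartanData.borelSpan, Submodule.span_le]
    rintro _ ⟨y, hy, _, ⟨w, rfl⟩, rfl⟩
    change quoEps Λ (y (r w)) = 0
    have h2 := h0 w
    generalize r w = z at h2
    induction hy using Algebra.adjoin_induction generalizing z with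
    | mem y hy =>
      rcases hy with (⟨a, rfl⟩ | ⟨b, rfl⟩) | ⟨b, rfl⟩
      · exact quoEps_F Λ a z
      · rw [quoEps_k, h2, mul_zero]
      · have h3 := quoEps_k Λ b ((quoData Λ).kinv b z)
        rw [← Module.End.mul_apply, (quoData Λ).k_kinv, Module.End.one_apply, h2] at h3
        exact (mul_eq_zero.1 h3.symm).resolve_left (Λ b).ne_zero
    | algebraMap c => rw [Module.algebraMap_end_apply, map_smul, h2, smul_zero]
    | add y y' _ _ ih ih' => rw [LinearMap.add_apply, map_add, ih z h2, ih' z h2, add_zero]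
    | mul y y' _ _ ih ih' => exact ih _ (ih' z h2)
  refine LinearMap.ext fun w => ?_
  have : r w ∈ (quoData Λ).borelSpan (LinearMap.range r) :=
    (quoData Λ).le_borelSpan _ (LinearMap.mem_range_self r w)
  rw [h1] at this
  exact this

/-- An operator which commutes with the `f`'s and kills the highest weight vector is zero. -/
theorem eq_zero_of_commute_F {r : Module.End Cq (Quo Λ)} (hr : ∀ x, Commute ((quoData Λ).F x) r)
    (h0 : r (vac Λ) = 0) : r = 0 := by
  refine Submodule.linearMap_qext _ (Finsupp.lhom_ext' fun l => LinearMap.ext_ring ?_)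
  change r ((radical Λ).mkQ (Finsupp.single l 1)) = 0
  rw [← word_vac]
  induction l with
  | nil => exact h0
  | cons a l ih =>
    rw [CartanData.word_cons, ← Module.End.mul_apply, ← (hr a).eq, Module.End.mul_apply, ih,
      map_zero]

end WordSpace

end

section

variable {m n : ℕ}

namespace WordSpace

variable (Λ : Weight m n)

local notation "D" => quoData Λ

theorem quo_F_comm {a b : I' m n} (h : (a : ℕ) + 1 < b ∨ (b : ℕ) + 1 < a) :
    (D).F a * (D).F b = (D).F b * (D).F a :=
  sub_eq_zero.1 <| eq_zero_of_commute_E Λ ((D).E_comm_F_comm h) fun w => by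
    simp only [LinearMap.sub_apply, Module.End.mul_apply, map_sub, quoEps_F, sub_zero]

theorem quo_serre_F {a b : I' m n} (ha : (a : ℕ) ≠ m)
    (hab : (b : ℕ) = a + 1 ∨ (a : ℕ) = b + 1) : serre (qa m a) ((D).F a) ((D).F b) = 0 :=
  eq_zero_of_commute_E Λ ((D).E_comm_serre ha hab) fun w => by
    simp only [serre, LinearMap.sub_apply, LinearMap.add_apply, LinearMap.smul_apply,
      Module.End.mul_apply, map_sub, map_add, map_smul, quoEps_F, smul_zero, sub_zero, add_zero]

theorem quo_F_sq {a : I' m n} (ha : (a : ℕ) = m) : (D).F a * (D).F a = 0 :=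
  eq_zero_of_commute_E Λ ((D).E_comm_F_sq ha) fun w => by
    simp only [Module.End.mul_apply, quoEps_F]

theorem quo_quartic_F {a b c : I' m n} (ha : (a : ℕ) + 1 = m) (hb : (b : ℕ) = m)
    (hc : (c : ℕ) = m + 1) : quartic q ((D).F a) ((D).F b) ((D).F c) = 0 :=
  eq_zero_of_commute_E Λ ((D).E_comm_quartic ha hb hc (quo_F_sq Λ hb) (quo_F_comm Λ (by omega)))
    fun w => by
    simp only [quartic, qcomm, LinearMap.sub_apply, LinearMap.smul_apply,
      Module.End.mul_apply, map_sub, map_smul, quoEps_F, smul_zero, sub_zero]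

theorem quo_E_comm {a b : I' m n} (h : (a : ℕ) + 1 < b ∨ (b : ℕ) + 1 < a) :
    (D).E a * (D).E b = (D).E b * (D).E a :=
  sub_eq_zero.1 <| eq_zero_of_commute_F Λ ((D).swap.E_comm_F_comm h) <| by
    simp only [LinearMap.sub_apply, Module.End.mul_apply, map_zero,
      (isSingular_vac Λ).E_apply, sub_zero]

theorem quo_serre_E {a b : I' m n} (ha : (a : ℕ) ≠ m)
    (hab : (b : ℕ) = a + 1 ∨ (a : ℕ) = b + 1) : serre (qa m a) ((D).E a) ((D).E b) = 0 :=
  eq_zero_of_commute_F Λ ((D).swap.E_comm_serre ha hab) <| by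
    simp only [serre, LinearMap.sub_apply, LinearMap.add_apply,
      LinearMap.smul_apply, Module.End.mul_apply, map_zero, (isSingular_vac Λ).E_apply, smul_zero,
      sub_zero, add_zero]

theorem quo_E_sq {a : I' m n} (ha : (a : ℕ) = m) : (D).E a * (D).E a = 0 :=
  eq_zero_of_commute_F Λ ((D).swap.E_comm_F_sq ha) <| by
    simp only [Module.End.mul_apply, map_zero, (isSingular_vac Λ).E_apply]

theorem quo_quartic_E {a b c : I' m n} (ha : (a : ℕ) + 1 = m) (hb : (b : ℕ) = m)
    (hc : (c : ℕ) = m + 1) : quartic q ((D).E a) ((D).E b) ((D).E c) = 0 :=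
  eq_zero_of_commute_F Λ ((D).swap.E_comm_quartic ha hb hc (quo_E_sq Λ hb)
    (quo_E_comm Λ (by omega))) <| by
    simp only [quartic, qcomm, LinearMap.sub_apply, LinearMap.smul_apply,
      Module.End.mul_apply, (isSingular_vac Λ).E_apply, map_zero, smul_zero,
      sub_zero]

/-- The operators by which the generators act. -/
def quoGen : Gen m n → Module.End Cq (Quo Λ)
  | .e a => (D).E a
  | .f a => (D).F a
  | .K b => (D).k b
  | .Kinv b => (D).kinv b

theorem quoGen_rel (x y : FreeAlgebra Cq (Gen m n)) (h : Rel m n x y) :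
    FreeAlgebra.lift Cq (quoGen Λ) x = FreeAlgebra.lift Cq (quoGen Λ) y := by
  have q1 : qa m m = q := if_pos le_rfl
  have q2 : qa m (m + 1) = -q⁻¹ := if_neg (by omega)
  have q3 : (-q⁻¹)⁻¹ = -q := by have := q_ne_zero; field_simp
  cases h
  all_goals
    simp only [xcomm, map_mul, map_sub, map_add, map_smul, map_one, map_zero,
      FreeAlgebra.lift_ι_apply, quoGen]
  case K_mul_Kinv a => exact (D).k_kinv a
  case K_comm_K a b => exact (D).k_comm a b
  case K_comm_Kinv a b => exact ((D).kinv_comm_k b a).symm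
  case Kinv_comm_Kinv a b => exact (D).kinv_comm a b
  case K_e a b =>
    rw [(D).k_E, smul_mul_assoc, mul_assoc, (D).k_kinv, mul_one]; rfl
  case K_f a b =>
    have hs : (-(if (a : ℕ) = b then 1 else 0) + (if (a : ℕ) = b + 1 then 1 else 0) : ℤ)
      = -((if (a : ℕ) = b then 1 else 0) - (if (a : ℕ) = b + 1 then 1 else 0) : ℤ) := by ring
    rw [(D).k_F, smul_mul_assoc, mul_assoc, (D).k_kinv, mul_one, hs, zpow_neg]; rfl
  case e_f_same a => rw [(D).E_F, add_sub_cancel_left, qa_sub_inv]; rfl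
  case e_f_ne a b h => rw [((D).E_F_ne a b h).eq, sub_self]
  case e_comm a b h => exact quo_E_comm Λ h
  case f_comm a b h => exact quo_F_comm Λ h
  case serre_e a b ha h => exact quo_serre_E Λ ha h
  case serre_f a b ha h => exact quo_serre_F Λ ha h
  case e_sq a h => exact quo_E_sq Λ h
  case f_sq a h => exact quo_F_sq Λ h
  case quartic_e a b c ha hb hc =>
    -- up to sign, the iterated commutators of the `e`'s and of the `f`'s have the same shape
    have e1 : (D).E a * (D).E b * (D).E c - q⁻¹ • ((D).E b * (D).E a * (D).E c)
        - -q • ((D).E c * ((D).E a * (D).E b) - q⁻¹ • ((D).E c * ((D).E b * (D).E a)))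
        = -qcomm (-q⁻¹) ((D).E c) (qcomm q ((D).E b) ((D).E a)) := by
      have := q_ne_zero
      simp only [qcomm, mul_sub, sub_mul, mul_smul_comm, smul_mul_assoc, smul_sub, smul_smul,
        mul_assoc]
      rw [neg_mul, neg_mul, inv_mul_cancel₀ this, mul_inv_cancel₀ this]
      simp only [neg_smul, one_smul]
      abel
    have e2 := sub_eq_zero.1 (quo_quartic_E Λ ha hb hc)
    rw [q1, q2, q3, sub_mul, smul_mul_assoc, mul_sub ((D).E c), mul_smul_comm, e1]
    exact (show Commute _ _ from e2).neg_right
  case quartic_f a b c ha hb hc =>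
    rw [q1, q2]
    exact sub_eq_zero.1 (quo_quartic_F Λ ha hb hc)

/-- The representation of `U_q(gl_{m,n})` on the quotient of the word space by its radical. -/
def quoRep : U m n →ₐ[Cq] Module.End Cq (Quo Λ) :=
  U.lift (FreeAlgebra.lift Cq (quoGen Λ)) (quoGen_rel Λ)

theorem quoRep_e (a : I' m n) : quoRep Λ (e a) = (D).E a := by
  rw [quoRep, e, U.lift_mk, FreeAlgebra.lift_ι_apply]; rfl
theorem quoRep_f (a : I' m n) : quoRep Λ (f a) = (D).F a := by
  rw [quoRep, f, U.lift_mk, FreeAlgebra.lift_ι_apply]; rfl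
theorem quoRep_K (b : I m n) : quoRep Λ (K b) = (D).k b := by
  rw [quoRep, K, U.lift_mk, FreeAlgebra.lift_ι_apply]; rfl
theorem quoRep_Kinv (b : I m n) : quoRep Λ (Kinv b) = (D).kinv b := by
  rw [quoRep, Kinv, U.lift_mk, FreeAlgebra.lift_ι_apply]; rfl

end WordSpace

/-! ### Modules over `U_q(gl_{m,n})` and over `U_q(g₀)` -/

/-- Induction along the generators of `U_q(gl_{m,n})`. -/
theorem U.induction {C : U m n → Prop} (e : ∀ a, C (e a)) (f : ∀ a, C (f a)) (K : ∀ b, C (K b))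
    (Kinv : ∀ b, C (Kinv b)) (algebraMap : ∀ c, C (algebraMap Cq _ c))
    (add : ∀ x y, C x → C y → C (x + y)) (mul : ∀ x y, C x → C y → C (x * y)) (u : U m n) :
    C u := by
  obtain ⟨x, rfl⟩ : ∃ x, U.mk x = u := RingQuot.mkAlgHom_surjective Cq (Rel m n) u
  induction x using FreeAlgebra.induction with
  | grade0 c => rw [AlgHom.commutes]; exact algebraMap c
  | grade1 g =>
    cases g
    exacts [e _, f _, K _, Kinv _]
  | mul x y hx hy => rw [map_mul]; exact mul _ _ hx hy
  | add x y hx hy => rw [map_add]; exact add _ _ hx hy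

/-- The generators of `U_q(gl_{m,n})`. -/
def uCartan (m n : ℕ) : CartanData (id : I' m n → I' m n) (U m n) where
  E := e
  F := f
  k := K
  kinv := Kinv
  k_kinv := K_mul_Kinv
  kinv_k := Kinv_mul_K
  k_comm := K_comm_K
  k_E := K_mul_e
  k_F := K_mul_f
  E_F := e_mul_f_same
  E_F_ne _ _ h := e_comm_f h

/-- The indices `a ∈ I'` with `a ≠ m`. -/
abbrev EvenIx (m n : ℕ) : Type := {a : I' m n // (a : ℕ) ≠ m}

/-- The generators of `U_q(g₀)`. -/
def leviCartan (m n : ℕ) : CartanData (Subtype.val : EvenIx m n → I' m n) (Ug0 m n) where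
  E x := ⟨e x.1, Algebra.subset_adjoin (.e _ x.2)⟩
  F x := ⟨f x.1, Algebra.subset_adjoin (.f _ x.2)⟩
  k b := ⟨K b, Algebra.subset_adjoin (.K b)⟩
  kinv b := ⟨Kinv b, Algebra.subset_adjoin (.Kinv b)⟩
  k_kinv b := Subtype.ext (K_mul_Kinv b)
  kinv_k b := Subtype.ext (Kinv_mul_K b)
  k_comm b c := Subtype.ext (K_comm_K b c)
  k_E b x := Subtype.ext (K_mul_e b x.1)
  k_F b x := Subtype.ext (K_mul_f b x.1)
  E_F x := Subtype.ext (e_mul_f_same x.1)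
  E_F_ne _ _ h := Subtype.ext (e_comm_f fun h' => h (Subtype.ext h'))

/-- The action of the generators of `U_q(gl_{m,n})` on a module. -/
def uData (m n : ℕ) (W : Type*) [AddCommGroup W] [Module Cq W] [Module (U m n) W]
    [IsScalarTower Cq (U m n) W] : CartanData (id : I' m n → I' m n) (Module.End Cq W) :=
  (uCartan m n).map (Algebra.lsmul Cq Cq W)

/-- The action of the generators of `U_q(g₀)` on a module. -/
def leviData (m n : ℕ) (W : Type*) [AddCommGroup W] [Module Cq W] [Module (Ug0 m n) W]
    [IsScalarTower Cq (Ug0 m n) W] :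
    CartanData (Subtype.val : EvenIx m n → I' m n) (Module.End Cq W) :=
  (leviCartan m n).map (Algebra.lsmul Cq Cq W)

end

section

variable {m n : ℕ}

namespace CartanData

variable {X : Type*} {ix : X → I' m n} {W : Type*} [AddCommGroup W] [Module Cq W]
  {D : CartanData ix (Module.End Cq W)} {Λ : Weight m n} {v : W}

theorem IsSingular.isStable_wordSpan (h : D.IsSingular Λ v) : D.IsStable (D.wordSpan v) where
  E x _ hw := h.E_mem_wordSpan x hw
  F x _ hw := F_mem_wordSpan x hw
  k b _ hw := h.k_mem_wordSpan b hw
  kinv b _ hw := h.kinv_mem_wordSpan b hw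

/-- The span of the vectors of lower height is stable under the `F`'s, the `k`'s and their
inverses. -/
theorem IsSingular.borel_mem_posSpan (h : D.IsSingular Λ v) {y : Module.End Cq W}
    (hy : y ∈ D.borel) {w : W} (hw : w ∈ D.posSpan v) : y w ∈ D.posSpan v := by
  induction hy using Algebra.adjoin_induction generalizing w with
  | mem y hy =>
    rcases hy with (⟨a, rfl⟩ | ⟨b, rfl⟩) | ⟨b, rfl⟩
    · exact F_mem_posSpan a (D.posSpan_le_wordSpan v hw)
    · have : D.posSpan v ≤ (D.posSpan v).comap (D.k b) := by
        nth_rewrite 1 [posSpan]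
        rw [Submodule.span_le]
        rintro _ ⟨l, hl, rfl⟩
        change D.k b (D.word l v) ∈ D.posSpan v
        rw [h.k_word]
        exact Submodule.smul_mem _ _ (Submodule.subset_span ⟨l, hl, rfl⟩)
      exact this hw
    · have : D.posSpan v ≤ (D.posSpan v).comap (D.kinv b) := by
        nth_rewrite 1 [posSpan]
        rw [Submodule.span_le]
        rintro _ ⟨l, hl, rfl⟩
        change D.kinv b (D.word l v) ∈ D.posSpan v
        rw [D.kinv_apply (weight_mul_ne_zero _ _ l) (h.k_word b l)]
        exact Submodule.smul_mem _ _ (Submodule.subset_span ⟨l, hl, rfl⟩)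
      exact this hw
  | algebraMap c => rw [Module.algebraMap_end_apply]; exact Submodule.smul_mem _ _ hw
  | add y y' _ _ ih ih' => exact Submodule.add_mem _ (ih hw) (ih' hw)
  | mul y y' _ _ ih ih' => exact ih (ih' hw)

theorem map_word {A : Type*} [Ring A] [Algebra Cq A] (D : CartanData ix A)
    (φ : A →ₐ[Cq] Module.End Cq W) (l : List X) (w : W) :
    (D.map φ).word l w = φ (l.map D.F).prod w := by
  induction l with
  | nil => rw [List.map_nil, List.prod_nil, map_one]; rfl
  | cons x l ih => rw [word_cons, ih, List.map_cons, List.prod_cons, map_mul]; rfl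

end CartanData

section Stable

theorem smul_mem_of_isStable {W : Type*} [AddCommGroup W] [Module Cq W] [Module (U m n) W]
    [IsScalarTower Cq (U m n) W] {T : Submodule Cq W} (hT : (uData m n W).IsStable T) (u : U m n)
    {w : W} (hw : w ∈ T) : u • w ∈ T := by
  induction u using U.induction generalizing w with
  | e a => exact hT.E a hw
  | f a => exact hT.F a hw
  | K b => exact hT.k b hw
  | Kinv b => exact hT.kinv b hw
  | algebraMap c => rw [algebraMap_smul]; exact T.smul_mem c hw
  | add x y hx hy => rw [add_smul]; exact T.add_mem (hx hw) (hy hw)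
  | mul x y hx hy => rw [mul_smul]; exact hx (hy hw)

theorem levi_smul_mem_of_isStable {W : Type*} [AddCommGroup W] [Module Cq W]
    [Module (Ug0 m n) W] [IsScalarTower Cq (Ug0 m n) W] {T : Submodule Cq W}
    (hT : (leviData m n W).IsStable T) (x : Ug0 m n) {w : W} (hw : w ∈ T) : x • w ∈ T := by
  obtain ⟨x, hx⟩ := x
  induction hx using Algebra.adjoin_induction generalizing w with
  | mem x hx =>
    cases hx with
    | e a h => exact hT.E ⟨a, h⟩ hw
    | f a h => exact hT.F ⟨a, h⟩ hw
    | K b => exact hT.k b hw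
    | Kinv b => exact hT.kinv b hw
  | algebraMap c =>
    have : (⟨algebraMap Cq (U m n) c, Subalgebra.algebraMap_mem _ c⟩ : Ug0 m n)
      = algebraMap Cq (Ug0 m n) c := rfl
    rw [this, algebraMap_smul]; exact T.smul_mem c hw
  | add x y hx hy ihx ihy =>
    have : (⟨x + y, add_mem hx hy⟩ : Ug0 m n) = ⟨x, hx⟩ + ⟨y, hy⟩ := rfl
    rw [this, add_smul]; exact T.add_mem (ihx hw) (ihy hw)
  | mul x y hx hy ihx ihy =>
    have : (⟨x * y, mul_mem hx hy⟩ : Ug0 m n) = ⟨x, hx⟩ * ⟨y, hy⟩ := rfl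
    rw [this, mul_smul]; exact ihx (ihy hw)

/-- The `U_q(gl_{m,n})`-submodule with a given stable underlying subspace. -/
def stableSubmodule {W : Type*} [AddCommGroup W] [Module Cq W] [Module (U m n) W]
    [IsScalarTower Cq (U m n) W] {T : Submodule Cq W} (hT : (uData m n W).IsStable T) :
    Submodule (U m n) W where
  carrier := T
  zero_mem' := T.zero_mem
  add_mem' := T.add_mem
  smul_mem' u _ hw := smul_mem_of_isStable hT u hw

end Stable

/-- For every weight there is a module over `U_q(gl_{m,n})` with a nonzero highest weight vector of
this weight, in which no nonzero submodule consists of vectors of lower height. -/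
theorem exists_reduced_module (Λ : Weight m n) :
    ∃ (W : Type) (_ : AddCommGroup W) (_ : Module Cq W) (_ : Module (U m n) W)
      (_ : IsScalarTower Cq (U m n) W) (v : W), v ≠ 0 ∧ (uData m n W).IsSingular Λ v ∧
      ∀ N : Submodule (U m n) W, N.restrictScalars Cq ≤ (uData m n W).posSpan v → N = ⊥ := by
  let _ : Module (U m n) (WordSpace.Quo Λ) :=
    Module.compHom (WordSpace.Quo Λ) (WordSpace.quoRep Λ).toRingHom
  have smul_def : ∀ (u : U m n) (w : WordSpace.Quo Λ), u • w = WordSpace.quoRep Λ u w :=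
    fun _ _ => rfl
  have : IsScalarTower Cq (U m n) (WordSpace.Quo Λ) := ⟨fun c u w => by
    rw [smul_def, smul_def, map_smul, LinearMap.smul_apply]⟩
  have hE : ∀ a w, e a • w = (WordSpace.quoData Λ).E a w := fun a w => by
    rw [smul_def, WordSpace.quoRep_e]
  have hF : ∀ a w, f a • w = (WordSpace.quoData Λ).F a w := fun a w => by
    rw [smul_def, WordSpace.quoRep_f]
  have hk : ∀ b w, K b • w = (WordSpace.quoData Λ).k b w := fun a w => by
    rw [smul_def, WordSpace.quoRep_K]
  have hkinv : ∀ b w, Kinv b • w = (WordSpace.quoData Λ).kinv b w := fun a w => by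
    rw [smul_def, WordSpace.quoRep_Kinv]
  refine ⟨WordSpace.Quo Λ, inferInstance, inferInstance, inferInstance, inferInstance,
    WordSpace.vac Λ, ?_, ⟨fun a => ?_, fun b => ?_⟩, fun N hN => ?_⟩
  · intro h
    have := WordSpace.quoEps_vac Λ
    rw [h, map_zero] at this
    exact zero_ne_one this
  · exact (hE a _).trans ((WordSpace.isSingular_vac Λ).E_apply a)
  · exact (hk b _).trans ((WordSpace.isSingular_vac Λ).k_apply b)
  · have h1 : N.restrictScalars Cq = ⊥ := by
      refine WordSpace.eq_bot_of_isStable Λ ⟨fun a w hw => ?_, fun a w hw => ?_, fun a w hw => ?_,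
        fun a w hw => ?_⟩ (hN.trans ?_)
      · change (WordSpace.quoData Λ).E a w ∈ N
        rw [← hE]
        exact N.smul_mem (e a) hw
      · change (WordSpace.quoData Λ).F a w ∈ N
        rw [← hF]
        exact N.smul_mem (f a) hw
      · change (WordSpace.quoData Λ).k a w ∈ N
        rw [← hk]
        exact N.smul_mem (K a) hw
      · change (WordSpace.quoData Λ).kinv a w ∈ N
        rw [← hkinv]
        exact N.smul_mem (Kinv a) hw
      · rw [CartanData.posSpan, Submodule.span_le]
        rintro _ ⟨l, hl, rfl⟩
        obtain ⟨a, l, rfl⟩ := List.exists_cons_of_ne_nil hl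
        change WordSpace.quoEps Λ ((uData m n _).F a ((uData m n _).word l _)) = 0
        exact (congrArg _ (hF a _)).trans (WordSpace.quoEps_F Λ a _)
    exact (Submodule.restrictScalars_eq_bot_iff Cq _ _).1 h1

/-! ### The simple module `L⁰(Λ)` -/

section Levi

variable (Λ : Weight m n)

theorem E_mem_vermaIdeal (x : EvenIx m n) : (leviCartan m n).E x ∈ vermaIdeal Λ :=
  Submodule.subset_span (.inl ⟨x.1, x.2, rfl⟩)

theorem k_sub_mem_vermaIdeal (b : I m n) :
    (leviCartan m n).k b - algebraMap Cq (Ug0 m n) (Λ b : Cq) ∈ vermaIdeal Λ :=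
  Submodule.subset_span (.inr ⟨b, rfl⟩)

variable {Λ}

-- the two instances below shorten the search for the module structure on a quotient by a left ideal
instance (N : Submodule (Ug0 m n) (Ug0 m n)) : Module (Ug0 m n) (Ug0 m n ⧸ N) :=
  Submodule.Quotient.module N

instance (N : Submodule (Ug0 m n) (Ug0 m n)) : SMul (Ug0 m n) (Ug0 m n ⧸ N) :=
  (Submodule.Quotient.module N).toSMul

/-- The image of `1` in a quotient of the Verma module is a highest weight vector. -/
theorem isSingular_mk_one {N : Submodule (Ug0 m n) (Ug0 m n)} (hN : vermaIdeal Λ ≤ N) :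
    (leviData m n (Ug0 m n ⧸ N)).IsSingular Λ (N.mkQ 1) where
  E_apply x := by
    change (leviCartan m n).E x • N.mkQ 1 = 0
    rw [← map_smul, smul_eq_mul, mul_one, Submodule.mkQ_apply, Submodule.Quotient.mk_eq_zero]
    exact hN (E_mem_vermaIdeal Λ x)
  k_apply b := by
    change (leviCartan m n).k b • N.mkQ 1 = (Λ b : Cq) • N.mkQ 1
    rw [← algebraMap_smul (Ug0 m n) (Λ b : Cq), ← sub_eq_zero, ← sub_smul, ← map_smul, smul_eq_mul,
      mul_one, Submodule.mkQ_apply, Submodule.Quotient.mk_eq_zero]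
    exact hN (k_sub_mem_vermaIdeal Λ b)

/-- The span in `U_q(g₀)` of all nonempty products of `f`'s. -/
def posWords (m n : ℕ) : Submodule Cq (Ug0 m n) :=
  Submodule.span Cq ((fun l => (l.map (leviCartan m n).F).prod) '' {l | l ≠ []})

theorem map_posWords {W : Type*} [AddCommGroup W] [Module Cq W] [Module (Ug0 m n) W]
    [IsScalarTower Cq (Ug0 m n) W] (v : W) :
    (posWords m n).map (((LinearMap.toSpanSingleton (Ug0 m n) W v)).restrictScalars Cq)
      = (leviData m n W).posSpan v := by
  rw [posWords, Submodule.map_span, ← Set.image_comp, CartanData.posSpan]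
  congr 1
  refine Set.image_congr fun l _ => ?_
  exact (CartanData.map_word (leviCartan m n) (Algebra.lsmul Cq Cq W) l v).symm

variable (Λ) in
/-- Modulo the Verma ideal, every element of `U_q(g₀)` is the sum of a constant and a combination of
nonempty products of `f`'s. -/
theorem exists_sub_mem_vermaIdeal (x : Ug0 m n) : ∃ c : Cq, ∃ p ∈ posWords m n,
    x - (algebraMap Cq (Ug0 m n) c + p) ∈ vermaIdeal Λ := by
  have hs := isSingular_mk_one (le_refl (vermaIdeal Λ))
  set v := (vermaIdeal Λ).mkQ 1 with hv
  have h1 : x • v ∈ (leviData m n _).wordSpan v :=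
    levi_smul_mem_of_isStable hs.isStable_wordSpan x (CartanData.word_mem_wordSpan _ v [])
  obtain ⟨c, y, hy, hxy⟩ := CartanData.exists_eq_smul_add h1
  rw [← map_posWords] at hy
  obtain ⟨p, hp, rfl⟩ := hy
  refine ⟨c, p, hp, ?_⟩
  rw [← Submodule.Quotient.mk_eq_zero, ← Submodule.mkQ_apply]
  change x • v = c • v + p • v at hxy
  rw [← algebraMap_smul (Ug0 m n) c, ← add_smul, ← sub_eq_zero, ← sub_smul, hv, ← map_smul,
    smul_eq_mul, mul_one] at hxy
  exact hxy

/-- Proper left ideals containing the Verma ideal have no constant terms. -/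
theorem exists_mem_posWords {N : Submodule (Ug0 m n) (Ug0 m n)} (hN : vermaIdeal Λ ≤ N)
    (hN' : N ≠ ⊤) {x : Ug0 m n} (hx : x ∈ N) : ∃ p ∈ posWords m n, x - p ∈ vermaIdeal Λ := by
  obtain ⟨c, p, hp, h⟩ := exists_sub_mem_vermaIdeal Λ x
  have hs := isSingular_mk_one hN
  have hv : N.mkQ 1 ≠ 0 := by
    rw [Submodule.mkQ_apply, Ne, Submodule.Quotient.mk_eq_zero]
    intro h1
    exact hN' ((Ideal.eq_top_iff_one N).2 h1)
  have h1 : algebraMap Cq (Ug0 m n) c + p ∈ N := by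
    have := N.sub_mem hx (hN h)
    rwa [sub_sub_cancel] at this
  have h2 : c • N.mkQ 1 + p • N.mkQ 1 = 0 := by
    rw [← algebraMap_smul (Ug0 m n) c, ← add_smul, ← map_smul, smul_eq_mul, mul_one,
      Submodule.mkQ_apply, Submodule.Quotient.mk_eq_zero]
    exact h1
  have hc : c = 0 := by
    by_contra hc
    refine hs.notMem_posSpan hv ?_
    rw [add_eq_zero_iff_eq_neg] at h2
    have h3 : N.mkQ 1 = c⁻¹ • -(p • N.mkQ 1) := by
      rw [← h2, smul_smul, inv_mul_cancel₀ hc, one_smul]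
    have h4 : p • N.mkQ 1 ∈ (leviData m n _).posSpan (N.mkQ 1) := by
      rw [← map_posWords]
      exact ⟨p, hp, rfl⟩
    have h5 := Submodule.smul_mem _ c⁻¹ (Submodule.neg_mem _ h4)
    rwa [← h3] at h5
  subst hc
  rw [map_zero, zero_add] at h
  exact ⟨p, hp, h⟩

theorem exists_mem_posWords_of_mem_maxIdeal {x : Ug0 m n} (hx : x ∈ maxIdeal Λ) :
    ∃ p ∈ posWords m n, x - p ∈ vermaIdeal Λ := by
  rw [maxIdeal, sSup_eq_iSup'] at hx
  induction hx using Submodule.iSup_induction' with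
  | mem N x hx => exact exists_mem_posWords N.2.1 N.2.2 hx
  | zero => exact ⟨0, Submodule.zero_mem _, by simp⟩
  | add x y _ _ hx hy =>
    obtain ⟨p, hp, hx⟩ := hx
    obtain ⟨p', hp', hy⟩ := hy
    refine ⟨p + p', Submodule.add_mem _ hp hp', ?_⟩
    have := Submodule.add_mem _ hx hy
    rwa [sub_add_sub_comm] at this

end Levi

section Restriction

variable {W : Type*} [AddCommGroup W] [Module Cq W] [Module (U m n) W]
  [IsScalarTower Cq (U m n) W] {Λ : Weight m n} {v : W}

theorem isSingular_levi (h : (uData m n W).IsSingular Λ v) : (leviData m n W).IsSingular Λ v where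
  E_apply x := h.E_apply x.1
  k_apply b := h.k_apply b

theorem levi_word (l : List (EvenIx m n)) (w : W) :
    (leviData m n W).word l w = (uData m n W).word (l.map Subtype.val) w := by
  induction l with
  | nil => rfl
  | cons x l ih => rw [CartanData.word_cons, List.map_cons, CartanData.word_cons, ih]; rfl

theorem levi_posSpan_le (w : W) : (leviData m n W).posSpan w ≤ (uData m n W).posSpan w := by
  rw [CartanData.posSpan, Submodule.span_le]
  rintro _ ⟨l, hl, rfl⟩
  refine Submodule.subset_span ⟨l.map Subtype.val, ?_, (levi_word l w).symm⟩
  simpa using hl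

theorem vermaIdeal_smul (h : (uData m n W).IsSingular Λ v) {x : Ug0 m n} (hx : x ∈ vermaIdeal Λ) :
    x • v = 0 := by
  induction hx using Submodule.span_induction with
  | mem x hx =>
    rcases hx with ⟨a, ha, hx⟩ | ⟨b, hx⟩
    · change (x : U m n) • v = 0
      rw [hx]; exact h.E_apply a
    · change (x : U m n) • v = 0
      rw [hx, sub_smul, algebraMap_smul, sub_eq_zero]; exact h.k_apply b
  | zero => exact zero_smul _ v
  | add x y _ _ hx hy => rw [add_smul, hx, hy, add_zero]
  | smul a x _ hx => rw [smul_eq_mul, mul_smul, hx, smul_zero]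

theorem maxIdeal_smul_mem (h : (uData m n W).IsSingular Λ v) {x : Ug0 m n} (hx : x ∈ maxIdeal Λ) :
    x • v ∈ (uData m n W).posSpan v := by
  obtain ⟨p, hp, hxp⟩ := exists_mem_posWords_of_mem_maxIdeal hx
  have h1 := vermaIdeal_smul h hxp
  rw [sub_smul, sub_eq_zero] at h1
  rw [h1]
  refine levi_posSpan_le v ?_
  rw [← map_posWords]
  exact ⟨p, hp, rfl⟩

/-- `e_m` annihilates the `U_q(g₀)`-submodule generated by a highest weight vector. -/
theorem e_m_smul (h : (uData m n W).IsSingular Λ v) {a : I' m n} (ha : (a : ℕ) = m) (x : Ug0 m n) :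
    e a • x • v = 0 := by
  have h1 : x • v ∈ (leviData m n W).wordSpan v :=
    levi_smul_mem_of_isStable (isSingular_levi h).isStable_wordSpan x
      (CartanData.word_mem_wordSpan _ v [])
  have h2 : (leviData m n W).wordSpan v ≤ LinearMap.ker ((uData m n W).E a) := by
    rw [CartanData.wordSpan, Submodule.span_le]
    rintro _ ⟨l, rfl⟩
    change (uData m n W).E a ((leviData m n W).word l v) = 0
    induction l with
    | nil => exact h.E_apply a
    | cons x l ih =>
      have hne : a ≠ x.1 := fun hax => x.2 (hax ▸ ha)
      change (uData m n W).E a ((uData m n W).F x.1 ((leviData m n W).word l v)) = 0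
      rw [← Module.End.mul_apply, ((uData m n W).E_F_ne a x.1 hne).eq, Module.End.mul_apply, ih,
        map_zero]
  exact h2 h1

/-- If no nonzero submodule of `W` consists of vectors of lower height, then the vectors of the
Verma module which die in `L⁰(Λ)` also die in `W`. -/
theorem maxIdeal_smul_eq_zero (h : (uData m n W).IsSingular Λ v)
    (hr : ∀ N : Submodule (U m n) W, N.restrictScalars Cq ≤ (uData m n W).posSpan v → N = ⊥)
    {x : Ug0 m n} (hx : x ∈ maxIdeal Λ) : x • v = 0 := by
  set Z : Submodule Cq W := ((maxIdeal Λ).restrictScalars Cq).map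
    ((LinearMap.toSpanSingleton (Ug0 m n) W v).restrictScalars Cq) with hZ
  have hE : ∀ a, Z ≤ Z.comap ((uData m n W).E a) := by
    rintro a _ ⟨y, hy, rfl⟩
    change e a • y • v ∈ Z
    by_cases ha : (a : ℕ) = m
    · rw [e_m_smul h ha]; exact Z.zero_mem
    · refine ⟨(leviCartan m n).E ⟨a, ha⟩ * y, (maxIdeal Λ).smul_mem _ hy, ?_⟩
      exact mul_smul ((leviCartan m n).E ⟨a, ha⟩) y v
  have hs := (uData m n W).isStable_borelSpan hE
  have hbot := hr (stableSubmodule hs) (by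
    change (uData m n W).borelSpan Z ≤ _
    rw [CartanData.borelSpan, Submodule.span_le]
    rintro _ ⟨y, hy, _, ⟨z, hz, rfl⟩, rfl⟩
    exact h.borel_mem_posSpan hy (maxIdeal_smul_mem h hz))
  have hmem : x • v ∈ stableSubmodule hs := (uData m n W).le_borelSpan Z ⟨x, hx, rfl⟩
  rw [hbot] at hmem
  exact hmem

end Restriction

section Levi

variable (Λ : Weight m n)

theorem maxIdeal_ne_top : maxIdeal Λ ≠ ⊤ := by
  intro h
  obtain ⟨W, _, _, _, _, v, hv, hs, _⟩ := exists_reduced_module Λ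
  have := maxIdeal_smul_mem hs (x := 1) (h ▸ Submodule.mem_top)
  rw [one_smul] at this
  exact hs.notMem_posSpan hv this

theorem vermaIdeal_le_maxIdeal : vermaIdeal Λ ≤ maxIdeal Λ := by
  refine le_sSup ⟨le_rfl, fun h => ?_⟩
  obtain ⟨W, _, _, _, _, v, hv, hs, _⟩ := exists_reduced_module Λ
  have := vermaIdeal_smul hs (x := 1) (h ▸ Submodule.mem_top)
  rw [one_smul] at this
  exact hv this

theorem isSimpleModule_L0 : IsSimpleModule (Ug0 m n) (L0 Λ) := by
  change IsSimpleModule (Ug0 m n) (Ug0 m n ⧸ maxIdeal Λ)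
  rw [isSimpleModule_iff_isCoatom]
  refine ⟨maxIdeal_ne_top Λ, fun N hN => ?_⟩
  by_contra h
  exact hN.not_ge (le_sSup ⟨(vermaIdeal_le_maxIdeal Λ).trans hN.le, h⟩)

/-- The highest weight vector of `L⁰(Λ)`. -/
def L0.vec : L0 Λ := (maxIdeal Λ).mkQ 1

theorem L0.exists_smul_vec (w : L0 Λ) : ∃ x : Ug0 m n, w = x • L0.vec Λ := by
  obtain ⟨x, rfl⟩ := (maxIdeal Λ).mkQ_surjective w
  refine ⟨x, ?_⟩
  change _ = x • (maxIdeal Λ).mkQ 1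
  rw [← map_smul, smul_eq_mul, mul_one]

theorem L0.isSingular_vec : (leviData m n (L0 Λ)).IsSingular Λ (L0.vec Λ) :=
  isSingular_mk_one (vermaIdeal_le_maxIdeal Λ)

end Levi

end

section

variable {m n : ℕ}

/-! ### Modules generated by a highest weight vector -/

theorem span_eq_top_of_simple {R W : Type*} [Ring R] [AddCommGroup W] [Module R W]
    [IsSimpleModule R W] {v : W} (h0 : v ≠ 0) : Submodule.span R {v} = ⊤ :=
  (eq_bot_or_eq_top _).resolve_left fun h => h0 (Submodule.span_singleton_eq_bot.1 h)

section Generated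

variable {W : Type*} [AddCommGroup W] [Module Cq W] [Module (U m n) W]
  [IsScalarTower Cq (U m n) W] {Λ : Weight m n} {v : W}

theorem wordSpan_eq_top (h : (uData m n W).IsSingular Λ v)
    (hv : Submodule.span (U m n) {v} = ⊤) : (uData m n W).wordSpan v = ⊤ := by
  have h1 : Submodule.span (U m n) {v} ≤ stableSubmodule h.isStable_wordSpan :=
    Submodule.span_le.2 (Set.singleton_subset_iff.2 (CartanData.word_mem_wordSpan _ v []))
  rw [hv] at h1
  exact eq_top_iff.2 fun w _ => h1 (Submodule.mem_top (x := w))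

/-- Proper submodules of a module generated by a highest weight vector consist of vectors of lower
height. -/
theorem le_posSpan_of_ne_top (h : (uData m n W).IsSingular Λ v)
    (hv : Submodule.span (U m n) {v} = ⊤) {N : Submodule (U m n) W} (hN : N ≠ ⊤) :
    N.restrictScalars Cq ≤ (uData m n W).posSpan v := by
  intro x hx
  obtain ⟨c, y, hy, rfl⟩ := CartanData.exists_eq_smul_add
    (wordSpan_eq_top h hv ▸ Submodule.mem_top : x ∈ (uData m n W).wordSpan v)
  have hs : (uData m n (W ⧸ N)).IsSingular Λ (N.mkQ v) :=
    ⟨fun a => (N.mkQ.map_smul (e a) v).symm.trans ((congrArg N.mkQ (h.E_apply a)).trans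
      (map_zero _)), fun b => (N.mkQ.map_smul (K b) v).symm.trans (congrArg N.mkQ (h.k_apply b))⟩
  have hv' : N.mkQ v ≠ 0 := by
    rw [Submodule.mkQ_apply, Ne, Submodule.Quotient.mk_eq_zero]
    intro h1
    exact hN (eq_top_iff.2 (hv ▸ Submodule.span_le.2 (Set.singleton_subset_iff.2 h1)))
  have hy' : N.mkQ y ∈ (uData m n (W ⧸ N)).posSpan (N.mkQ v) := by
    have h2 : ∀ l, N.mkQ ((uData m n W).word l v) = (uData m n (W ⧸ N)).word l (N.mkQ v) := by
      intro l
      induction l with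
      | nil => rfl
      | cons a l ih =>
        rw [CartanData.word_cons, CartanData.word_cons, ← ih]
        exact N.mkQ.map_smul (f a) _
    have h3 := Submodule.mem_map_of_mem (f := N.mkQ.restrictScalars Cq) hy
    rw [CartanData.posSpan, Submodule.map_span, ← Set.image_comp] at h3
    refine Submodule.span_mono ?_ h3
    rintro _ ⟨l, hl, rfl⟩
    exact ⟨l, hl, (h2 l).symm⟩
  have h4 : c • N.mkQ v + N.mkQ y = 0 := by
    have : N.mkQ (c • v + y) = 0 := (Submodule.Quotient.mk_eq_zero N).2 hx
    rw [map_add] at this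
    exact this
  have hc : c = 0 := by
    by_contra hc
    refine hs.notMem_posSpan hv' ?_
    rw [add_eq_zero_iff_eq_neg] at h4
    have h5 : N.mkQ v = c⁻¹ • -N.mkQ y := by
      rw [← h4, smul_smul, inv_mul_cancel₀ hc, one_smul]
    have h6 := Submodule.smul_mem _ c⁻¹ (Submodule.neg_mem _ hy')
    rwa [← h5] at h6
  rw [hc, zero_smul, zero_add]
  exact hy

/-- The sum of all proper submodules of a module generated by a highest weight vector is proper. -/
theorem sSup_ne_top (h : (uData m n W).IsSingular Λ v) (hv : Submodule.span (U m n) {v} = ⊤)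
    (h0 : v ≠ 0) : sSup {N : Submodule (U m n) W | N ≠ ⊤} ≠ ⊤ := by
  intro htop
  have h1 : ∀ w ∈ sSup {N : Submodule (U m n) W | N ≠ ⊤}, w ∈ (uData m n W).posSpan v := by
    intro w hw
    rw [sSup_eq_iSup'] at hw
    induction hw using Submodule.iSup_induction' with
    | mem N x hx => exact le_posSpan_of_ne_top h hv N.2 hx
    | zero => exact Submodule.zero_mem _
    | add x y _ _ hx hy => exact Submodule.add_mem _ hx hy
  exact h.notMem_posSpan h0 (h1 v (by rw [htop]; exact Submodule.mem_top))

theorem isCoatom_sSup (h : (uData m n W).IsSingular Λ v) (hv : Submodule.span (U m n) {v} = ⊤)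
    (h0 : v ≠ 0) : IsCoatom (sSup {N : Submodule (U m n) W | N ≠ ⊤}) := by
  refine ⟨sSup_ne_top h hv h0, fun N hN => ?_⟩
  by_contra hN'
  exact hN.not_ge (le_sSup hN')

/-- In a simple module no nonzero submodule consists of vectors of lower height. -/
theorem eq_bot_of_le_posSpan [IsSimpleModule (U m n) W] (h : (uData m n W).IsSingular Λ v)
    (h0 : v ≠ 0) (N : Submodule (U m n) W)
    (hN : N.restrictScalars Cq ≤ (uData m n W).posSpan v) : N = ⊥ :=
  (eq_bot_or_eq_top N).resolve_right fun ht =>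
    h.notMem_posSpan h0 (hN (show v ∈ N from ht ▸ Submodule.mem_top))

theorem isWeightModule_of_generated (h : (uData m n W).IsSingular Λ v)
    (hv : Submodule.span (U m n) {v} = ⊤) : IsWeightModule m n W := by
  refine eq_top_iff.2 ((wordSpan_eq_top h hv).ge.trans (Submodule.span_mono ?_))
  rintro _ ⟨l, rfl⟩
  exact ⟨fun b => Units.mk0 _ (CartanData.weight_mul_ne_zero (ix := id) Λ b l),
    fun b => h.k_word b l⟩

end Generated

/-! ### The modules `V(Λ)` and `L(Λ)` -/

theorem Ug0_le_Up : Ug0 m n ≤ Up m n := by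
  refine Algebra.adjoin_mono ?_
  rintro x (⟨a, _⟩ | ⟨a, ha⟩ | b | b)
  exacts [.e a, .f a ha, .K b, .Kinv b]

namespace V

variable (Λ : Weight m n)

/-- The defining relation `u b ⊗ w = u ⊗ b w` of the tensor product over `U_q(p)`. -/
theorem smul_incl (b : Up m n) (w : L0 Λ) : (b : U m n) • incl Λ w = incl Λ (b • w) := by
  rw [incl, incl, ← Submodule.Quotient.mk_smul, Submodule.Quotient.eq]
  refine Submodule.subset_span ⟨1, b, w, ?_⟩
  rw [TensorProduct.smul_tmul', smul_eq_mul, one_mul, mul_one]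

theorem levi_smul_incl (x : Ug0 m n) (w : L0 Λ) : (x : U m n) • incl Λ w = incl Λ (x • w) := by
  have hp : (x : U m n) ∈ Up m n := Ug0_le_Up x.2
  have h1 := smul_incl Λ ⟨x, hp⟩ w
  have h2 : (⟨x, hp⟩ : Up m n) • w = x • w := by
    change toLevi m n ⟨x, hp⟩ • w = x • w
    rw [toLevi_of_Ug0 x.2]
  rw [h2] at h1
  exact h1

/-- `w ↦ 1 ⊗ w` as a linear map. -/
def inclHom : L0 Λ →ₗ[Cq] V Λ :=
  ((balancing (Up m n) (L0 Λ)).mkQ.restrictScalars Cq) ∘ₗ (TensorProduct.mk Cq (U m n) (L0 Λ) 1)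

theorem inclHom_apply (w : L0 Λ) : inclHom Λ w = incl Λ w := rfl

/-- The highest weight vector of `V(Λ)`. -/
def vec : V Λ := incl Λ (L0.vec Λ)

theorem isSingular_vec : (uData m n (V Λ)).IsSingular Λ (vec Λ) where
  E_apply a := by
    change e a • incl Λ (L0.vec Λ) = 0
    rw [← map_zero (inclHom Λ), inclHom_apply]
    by_cases ha : (a : ℕ) = m
    · refine (smul_incl Λ ⟨e a, Algebra.subset_adjoin (.e a)⟩ _).trans ?_
      congr 1
      change toLevi m n ⟨e a, Algebra.subset_adjoin (.e a)⟩ • L0.vec Λ = 0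
      rw [toLevi_e_m a ha, zero_smul]
    · refine (levi_smul_incl Λ ((leviCartan m n).E ⟨a, ha⟩) _).trans ?_
      congr 1
      exact (L0.isSingular_vec Λ).E_apply ⟨a, ha⟩
  k_apply b := by
    change K b • incl Λ (L0.vec Λ) = (Λ b : Cq) • inclHom Λ (L0.vec Λ)
    rw [← map_smul, inclHom_apply]
    refine (levi_smul_incl Λ ((leviCartan m n).k b) _).trans ?_
    congr 1
    exact (L0.isSingular_vec Λ).k_apply b

theorem span_vec : Submodule.span (U m n) {vec Λ} = ⊤ := by
  rw [eq_top_iff]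
  rintro t -
  obtain ⟨t, rfl⟩ := Submodule.mkQ_surjective _ t
  induction t using TensorProduct.induction_on with
  | zero => rw [map_zero]; exact Submodule.zero_mem _
  | tmul u w =>
    obtain ⟨x, rfl⟩ := L0.exists_smul_vec Λ w
    have : (balancing (Up m n) (L0 Λ)).mkQ (u ⊗ₜ[Cq] (x • L0.vec Λ))
        = u • ((x : U m n) • vec Λ) := by
      rw [vec, levi_smul_incl, incl, ← Submodule.Quotient.mk_smul, TensorProduct.smul_tmul',
        smul_eq_mul, mul_one]
      rfl
    rw [this]
    exact Submodule.smul_mem _ _ (Submodule.smul_mem _ _ (Submodule.mem_span_singleton_self _))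
  | add x y hx hy => rw [map_add]; exact Submodule.add_mem _ hx hy

variable {Λ}
variable {W : Type*} [AddCommGroup W] [Module Cq W] [Module (U m n) W]
  [IsScalarTower Cq (U m n) W]

/-- The universal property of the induced module. -/
def lift (φ : L0 Λ →ₗ[Cq] W) (hφ : ∀ (b : Up m n) (w : L0 Λ), φ (b • w) = (b : U m n) • φ w) :
    V Λ →ₗ[U m n] W :=
  (balancing (Up m n) (L0 Λ)).liftQ
    (TensorProduct.AlgebraTensorModule.lift (LinearMap.toSpanSingleton (U m n) (L0 Λ →ₗ[Cq] W) φ))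
    (by
      rw [balancing, Submodule.span_le]
      rintro _ ⟨a, b, w, rfl⟩
      change TensorProduct.AlgebraTensorModule.lift _ _ = 0
      rw [map_sub, TensorProduct.AlgebraTensorModule.lift_tmul,
        TensorProduct.AlgebraTensorModule.lift_tmul, LinearMap.toSpanSingleton_apply,
        LinearMap.toSpanSingleton_apply, LinearMap.smul_apply, LinearMap.smul_apply, hφ, mul_smul,
        sub_self])

theorem lift_incl (φ : L0 Λ →ₗ[Cq] W)
    (hφ : ∀ (b : Up m n) (w : L0 Λ), φ (b • w) = (b : U m n) • φ w) (w : L0 Λ) :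
    lift φ hφ (incl Λ w) = φ w := by
  change (TensorProduct.AlgebraTensorModule.lift
    (LinearMap.toSpanSingleton (U m n) (L0 Λ →ₗ[Cq] W) φ)) ((1 : U m n) ⊗ₜ[Cq] w) = φ w
  rw [TensorProduct.AlgebraTensorModule.lift_tmul, LinearMap.toSpanSingleton_apply, one_smul]

/-- A highest weight vector of weight `Λ` in a module without nonzero submodules of lower height is
the image of the highest weight vector of `V(Λ)`. -/
theorem exists_hom {v : W} (h : (uData m n W).IsSingular Λ v)
    (hr : ∀ N : Submodule (U m n) W, N.restrictScalars Cq ≤ (uData m n W).posSpan v → N = ⊥) :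
    ∃ Φ : V Λ →ₗ[U m n] W, Φ (vec Λ) = v := by
  let φ : L0 Λ →ₗ[Ug0 m n] W := (maxIdeal Λ).liftQ (LinearMap.toSpanSingleton (Ug0 m n) W v)
    fun x hx => maxIdeal_smul_eq_zero h hr hx
  have hφ : ∀ x : Ug0 m n, φ (x • L0.vec Λ) = x • v := by
    intro x
    rw [map_smul]
    congr 1
    exact (Submodule.liftQ_apply _ _ _).trans (one_smul _ v)
  have hb : ∀ (b : Up m n) (w : L0 Λ), φ (b • w) = (b : U m n) • φ w := by
    rintro ⟨b, hb⟩ w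
    induction hb using Algebra.adjoin_induction generalizing w with
    | mem b hb =>
      have key : ∀ (hx : b ∈ Ug0 m n),
          φ ((⟨b, Algebra.subset_adjoin hb⟩ : Up m n) • w) = b • φ w := by
        intro hx
        have hp : b ∈ Up m n := Algebra.subset_adjoin hb
        change φ (toLevi m n ⟨b, hp⟩ • w) = b • φ w
        rw [toLevi_of_Ug0 hx, map_smul]
        rfl
      cases hb with
      | e a =>
        by_cases ha : (a : ℕ) = m
        · change φ (toLevi m n ⟨e a, _⟩ • w) = e a • φ w
          obtain ⟨x, rfl⟩ := L0.exists_smul_vec Λ w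
          rw [toLevi_e_m a ha, zero_smul, map_zero, hφ, e_m_smul h ha]
        · exact key (Algebra.subset_adjoin (.e a ha))
      | f a ha => exact key (Algebra.subset_adjoin (.f a ha))
      | K b => exact key (Algebra.subset_adjoin (.K b))
      | Kinv b => exact key (Algebra.subset_adjoin (.Kinv b))
    | algebraMap c =>
      have h1 : algebraMap Cq (U m n) c ∈ Ug0 m n := Subalgebra.algebraMap_mem _ c
      have hp : algebraMap Cq (U m n) c ∈ Up m n := Subalgebra.algebraMap_mem _ c
      change φ (toLevi m n ⟨algebraMap Cq (U m n) c, hp⟩ • w) = _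
      rw [toLevi_of_Ug0 h1, map_smul]
      rfl
    | add x y hx hy ihx ihy =>
      have e1 : (⟨x + y, add_mem hx hy⟩ : Up m n) = ⟨x, hx⟩ + ⟨y, hy⟩ := rfl
      rw [e1, add_smul, map_add, ihx, ihy]
      exact (add_smul x y _).symm
    | mul x y hx hy ihx ihy =>
      have e1 : (⟨x * y, mul_mem hx hy⟩ : Up m n) = ⟨x, hx⟩ * ⟨y, hy⟩ := rfl
      rw [e1, mul_smul, ihx, ihy]
      exact (mul_smul x y _).symm
  refine ⟨lift (φ.restrictScalars Cq) hb, (lift_incl _ _ _).trans ?_⟩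
  have := hφ 1
  rwa [one_smul, one_smul] at this

variable (Λ)

theorem vec_ne_zero : vec Λ ≠ 0 := by
  obtain ⟨W, _, _, _, _, v, hv, hs, hr⟩ := exists_reduced_module Λ
  obtain ⟨Φ, hΦ⟩ := exists_hom hs hr
  intro h
  rw [h, map_zero] at hΦ
  exact hv hΦ.symm

end V

variable (Λ : Weight m n)

/-- A submodule of `V(Λ)` meets `1 ⊗ L⁰(Λ)` trivially if and only if it is proper. -/
theorem forall_incl_iff (N : Submodule (U m n) (V Λ)) :
    (∀ w : L0 Λ, V.incl Λ w ∈ N → V.incl Λ w = 0) ↔ N ≠ ⊤ := by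
  constructor
  · rintro h rfl
    exact V.vec_ne_zero Λ (h _ Submodule.mem_top)
  · intro hN w hw
    by_contra h0
    let S : Submodule (Ug0 m n) (L0 Λ) :=
      { carrier := {w | V.incl Λ w ∈ N}
        zero_mem' := by
          change V.inclHom Λ 0 ∈ N
          rw [map_zero]; exact N.zero_mem
        add_mem' := fun {x y} hx hy => by
          change V.inclHom Λ (x + y) ∈ N
          rw [map_add]; exact N.add_mem hx hy
        smul_mem' := fun x w hw => by
          change V.incl Λ (x • w) ∈ N
          rw [← V.levi_smul_incl]; exact N.smul_mem _ hw }
    have := isSimpleModule_L0 Λ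
    rcases eq_bot_or_eq_top S with hS | hS
    · have hw' : w ∈ S := hw
      rw [hS, Submodule.mem_bot] at hw'
      refine h0 ?_
      rw [hw', ← V.inclHom_apply, map_zero]
    · have hv : L0.vec Λ ∈ S := hS ▸ Submodule.mem_top
      refine hN (eq_top_iff.2 ?_)
      rw [← V.span_vec]
      exact Submodule.span_le.2 (Set.singleton_subset_iff.2 hv)

/-- `M(Λ)` is the sum of all proper submodules of `V(Λ)`. -/
theorem M_eq : M Λ = sSup {N | N ≠ ⊤} := by
  rw [M]
  congr 1
  ext N
  exact forall_incl_iff Λ N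

theorem isCoatom_M : IsCoatom (M Λ) :=
  M_eq Λ ▸ isCoatom_sSup (V.isSingular_vec Λ) (V.span_vec Λ) (V.vec_ne_zero Λ)

theorem isSimpleModule_L : IsSimpleModule (U m n) (L Λ) :=
  isSimpleModule_iff_isCoatom.2 (isCoatom_M Λ)

/-- The highest weight vector of `L(Λ)`. -/
def L.vec : L Λ := (M Λ).mkQ (V.vec Λ)

theorem L.vec_ne_zero : L.vec Λ ≠ 0 := by
  intro h
  refine (isCoatom_M Λ).1 (eq_top_iff.2 ?_)
  rw [← V.span_vec]
  exact Submodule.span_le.2 (Set.singleton_subset_iff.2 ((Submodule.Quotient.mk_eq_zero _).1 h))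

theorem L.isSingular_vec : (uData m n (L Λ)).IsSingular Λ (L.vec Λ) where
  E_apply a := ((M Λ).mkQ.map_smul (e a) _).symm.trans
    ((congrArg (M Λ).mkQ ((V.isSingular_vec Λ).E_apply a)).trans (map_zero _))
  k_apply b := ((M Λ).mkQ.map_smul (K b) _).symm.trans
    (congrArg (M Λ).mkQ ((V.isSingular_vec Λ).k_apply b))

theorem L.span_vec : Submodule.span (U m n) {L.vec Λ} = ⊤ :=
  have := isSimpleModule_L Λ
  span_eq_top_of_simple (L.vec_ne_zero Λ)

theorem isHighestWeightModule_L : IsHighestWeightModule Λ (L Λ) :=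
  ⟨L.vec Λ, L.vec_ne_zero Λ, (L.isSingular_vec Λ).E_apply, (L.isSingular_vec Λ).k_apply,
    L.span_vec Λ⟩

theorem isWeightModule_L : IsWeightModule m n (L Λ) :=
  isWeightModule_of_generated (L.isSingular_vec Λ) (L.span_vec Λ)

variable {Λ}

/-- A simple module with a highest weight vector of weight `Λ` is isomorphic to `L(Λ)`. -/
theorem nonempty_equiv_L {W : Type*} [AddCommGroup W] [Module Cq W] [Module (U m n) W]
    [IsScalarTower Cq (U m n) W] [IsSimpleModule (U m n) W] {v : W}
    (h : (uData m n W).IsSingular Λ v) (h0 : v ≠ 0) : Nonempty (W ≃ₗ[U m n] L Λ) := by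
  obtain ⟨Φ, hΦ⟩ := V.exists_hom h (eq_bot_of_le_posSpan h h0)
  have hs : Function.Surjective Φ := by
    rw [← LinearMap.range_eq_top]
    refine eq_top_iff.2 ?_
    rw [← span_eq_top_of_simple h0]
    exact Submodule.span_le.2 (Set.singleton_subset_iff.2 ⟨_, hΦ⟩)
  have e1 := Φ.quotKerEquivOfSurjective hs
  have hk : LinearMap.ker Φ ≠ ⊤ := fun ht => h0 <| by
    rw [← hΦ]; exact (ht ▸ Submodule.mem_top : V.vec Λ ∈ LinearMap.ker Φ)
  have hle : LinearMap.ker Φ ≤ M Λ := M_eq Λ ▸ le_sSup hk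
  have hco : IsCoatom (LinearMap.ker Φ) := by
    rw [← isSimpleModule_iff_isCoatom]
    exact IsSimpleModule.congr e1
  have heq : LinearMap.ker Φ = M Λ :=
    hle.eq_of_not_lt fun hlt => (isCoatom_M Λ).1 (hco.2 _ hlt)
  exact ⟨e1.symm.trans (Submodule.quotEquivOfEq _ _ heq)⟩

/-- The weight of a highest weight vector of a simple module is unique. -/
theorem weight_unique {W : Type*} [AddCommGroup W] [Module Cq W] [Module (U m n) W]
    [IsScalarTower Cq (U m n) W] [IsSimpleModule (U m n) W] {v v' : W} {Λ' : Weight m n}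
    (h : (uData m n W).IsSingular Λ v) (h0 : v ≠ 0) (h' : (uData m n W).IsSingular Λ' v')
    (h0' : v' ≠ 0) : Λ = Λ' := by
  obtain ⟨c, y, hy, hv⟩ := CartanData.exists_eq_smul_add
    (wordSpan_eq_top h (span_eq_top_of_simple h0) ▸ Submodule.mem_top :
      v' ∈ (uData m n W).wordSpan v)
  have hc : c ≠ 0 := by
    rintro rfl
    rw [zero_smul, zero_add] at hv
    have h1 : (uData m n W).wordSpan v' ≤ (uData m n W).posSpan v := by
      rw [CartanData.wordSpan, Submodule.span_le]
      rintro _ ⟨l, rfl⟩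
      change (uData m n W).word l v' ∈ (uData m n W).posSpan v
      induction l with
      | nil => rw [CartanData.word_nil, hv]; exact hy
      | cons a l ih =>
        exact h.borel_mem_posSpan (CartanData.F_mem_borel _ a) ih
    rw [wordSpan_eq_top h' (span_eq_top_of_simple h0')] at h1
    exact h.notMem_posSpan h0 (h1 Submodule.mem_top)
  funext b
  by_contra hb
  have hb' : (Λ b : Cq) - Λ' b ≠ 0 := fun hb' => hb (Units.ext (sub_eq_zero.1 hb'))
  have e1 := h'.k_apply b
  nth_rewrite 1 [hv] at e1
  rw [hv, map_add, map_smul, h.k_apply] at e1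
  have e2 : (c * (Λ b - Λ' b)) • v = (Λ' b : Cq) • y - (uData m n W).k b y := by
    rw [mul_sub, sub_smul, mul_smul, mul_comm c, mul_smul, sub_eq_sub_iff_add_eq_add, e1, smul_add]
    abel
  have e3 : v = (c * (Λ b - Λ' b))⁻¹ • ((Λ' b : Cq) • y - (uData m n W).k b y) := by
    rw [← e2, smul_smul, inv_mul_cancel₀ (mul_ne_zero hc hb'), one_smul]
  refine h.notMem_posSpan h0 ?_
  have h2 := Submodule.smul_mem _ (c * (Λ b - Λ' b))⁻¹ (Submodule.sub_mem _
    (Submodule.smul_mem _ (Λ' b : Cq) hy) (h.borel_mem_posSpan (CartanData.k_mem_borel _ b) hy))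
  rwa [← e3] at h2

end

section

variable {m n : ℕ}

/-! ### Strings of a single even letter -/

/-- The recursion for the coefficients with which `e_a` acts on a string `f_a ^ j w`, where
`A = Q ^ (j + 1)`. -/
theorem string_coeff_succ {F : Type*} [Field F] {Q r A : F} (hA : A ≠ 0) (hr : r ≠ 0) (hQ : Q ≠ 0)
    (h : Q - Q⁻¹ ≠ 0) :
    (Q - Q⁻¹)⁻¹ ^ 2 * ((Q * A - (Q * A)⁻¹) * (r * A⁻¹ - r⁻¹ * A))
      = (Q - Q⁻¹)⁻¹ ^ 2 * ((A - A⁻¹) * (r * (Q⁻¹ * A)⁻¹ - r⁻¹ * (Q⁻¹ * A)))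
        + (Q - Q⁻¹)⁻¹ * (r * (A⁻¹ * A⁻¹) - (r * (A⁻¹ * A⁻¹))⁻¹) := by
  set z := Q - Q⁻¹ with hz
  have key : (Q * A - (Q * A)⁻¹) * (r * A⁻¹ - r⁻¹ * A)
      = (A - A⁻¹) * (r * (Q⁻¹ * A)⁻¹ - r⁻¹ * (Q⁻¹ * A))
        + z * (r * (A⁻¹ * A⁻¹) - (r * (A⁻¹ * A⁻¹))⁻¹) := by
    rw [hz]; field_simp; ring
  rw [key]
  field_simp

theorem qa_even_pow_inj {a i j : ℕ} (h : qa m a ^ (2 * i) = qa m a ^ (2 * j)) : i = j := by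
  have h1 : qa m a ^ (2 * ((i : ℤ) - j)) = 1 := by
    rw [mul_sub, zpow_sub₀ (qa_ne_zero m a), ← Nat.cast_ofNat, ← Nat.cast_mul, ← Nat.cast_mul,
      zpow_natCast, zpow_natCast, h, div_self (pow_ne_zero _ (qa_ne_zero m a))]
  have := qa_zpow_sq_eq_one h1
  omega

namespace CartanData

variable {W : Type*} [AddCommGroup W] [Module Cq W]
  (D : CartanData (id : I' m n → I' m n) (Module.End Cq W))

/-- The vector `w` is an eigenvector of `k_a = K_a K_{a+1}⁻¹` with eigenvalue `r`. -/
structure HasRatio (a : I' m n) (r : Cq) (w : W) : Prop where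
  h_apply : D.h a w = r • w
  h'_apply : D.h' a w = r⁻¹ • w

variable {D} {a : I' m n} {r : Cq} {w : W}

theorem HasRatio.congr {s : Cq} (h : D.HasRatio a r w) (hrs : r = s) : D.HasRatio a s w := hrs ▸ h

theorem hasRatio_of_k {c d : Cq} (hc : c ≠ 0) (hd : d ≠ 0) (h1 : D.k a.inc w = c • w)
    (h2 : D.k a.next w = d • w) : D.HasRatio a (c / d) w := by
  constructor
  · rw [h, Module.End.mul_apply, D.kinv_apply hd h2, map_smul, h1, smul_smul, mul_comm,
      div_eq_mul_inv]
  · rw [h', Module.End.mul_apply, D.kinv_apply hc h1, map_smul, h2, smul_smul, mul_comm, inv_div,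
      div_eq_mul_inv]

theorem HasRatio.F (h : D.HasRatio a r w) (x : I' m n) :
    D.HasRatio a (r * theta a x) (D.F x w) := by
  constructor
  · rw [← Module.End.mul_apply, D.h_F, LinearMap.smul_apply, Module.End.mul_apply, h.h_apply,
      map_smul, smul_smul, mul_comm]
  · rw [← Module.End.mul_apply, D.h'_F, LinearMap.smul_apply, Module.End.mul_apply, h.h'_apply,
      map_smul, smul_smul, mul_comm, mul_inv]

theorem swap_h (a : I' m n) : D.swap.h a = D.h' a := (D.kinv_comm_k _ _).eq

theorem swap_h' (a : I' m n) : D.swap.h' a = D.h a := (D.kinv_comm_k _ _).eq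

theorem HasRatio.swap (h : D.HasRatio a r w) : D.swap.HasRatio a r⁻¹ w := by
  constructor
  · rw [swap_h, h.h'_apply]
  · rw [swap_h', h.h_apply, inv_inv]

theorem HasRatio.E_F (h : D.HasRatio a r w) :
    D.E a (D.F a w) = D.F a (D.E a w) + ((q - q⁻¹)⁻¹ * (r - r⁻¹)) • w := by
  rw [← Module.End.mul_apply, D.E_F_eq, LinearMap.add_apply, LinearMap.smul_apply,
    LinearMap.sub_apply, h.h_apply, h.h'_apply, ← sub_smul, smul_smul]
  rfl

theorem HasRatio.F_pow (ha : (a : ℕ) ≠ m) (h : D.HasRatio a r w) (j : ℕ) :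
    D.HasRatio a (r * ((qa m a ^ j)⁻¹ * (qa m a ^ j)⁻¹)) ((D.F a ^ j) w) := by
  induction j with
  | zero => exact h.congr (by simp)
  | succ j ih =>
    rw [pow_succ' (D.F a), Module.End.mul_apply]
    refine (ih.F a).congr ?_
    rw [theta_self ha, pow_succ', mul_inv]
    ring

theorem HasRatio.E_pow (ha : (a : ℕ) ≠ m) (h : D.HasRatio a r w) (j : ℕ) :
    D.HasRatio a (r * (qa m a ^ j * qa m a ^ j)) ((D.E a ^ j) w) :=
  (h.swap.F_pow ha j).swap.congr (by rw [mul_inv, mul_inv, inv_inv, inv_inv])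

/-- The action of `e_a` on the string through a vector annihilated by `e_a`. -/
theorem HasRatio.E_F_pow_succ (ha : (a : ℕ) ≠ m) (h : D.HasRatio a r w) (hr : r ≠ 0)
    (hE : D.E a w = 0) (j : ℕ) :
    D.E a ((D.F a ^ (j + 1)) w) = ((q - q⁻¹)⁻¹ ^ 2 *
      ((qa m a ^ (j + 1) - (qa m a ^ (j + 1))⁻¹) * (r * (qa m a ^ j)⁻¹ - r⁻¹ * qa m a ^ j))) •
        (D.F a ^ j) w := by
  have hQ := qa_ne_zero m a
  have hz : qa m a - (qa m a)⁻¹ ≠ 0 := by rw [qa_sub_inv]; exact q_sub_inv_ne_zero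
  induction j with
  | zero =>
    rw [zero_add, pow_one, h.E_F, hE, map_zero, zero_add, pow_zero, pow_zero, Module.End.one_apply,
      pow_one, inv_one, mul_one, mul_one, ← qa_sub_inv m a, pow_two]
    congr 1
    rw [mul_assoc, ← mul_assoc (qa m a - (qa m a)⁻¹)⁻¹ (qa m a - (qa m a)⁻¹), inv_mul_cancel₀ hz,
      one_mul]
  | succ j ih =>
    rw [pow_succ' _ (j + 1), Module.End.mul_apply, (h.F_pow ha (j + 1)).E_F, ih, map_smul,
      ← Module.End.mul_apply, ← pow_succ', ← add_smul]
    congr 1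
    rw [← qa_sub_inv m a, pow_succ' (qa m a) (j + 1),
      string_coeff_succ (pow_ne_zero (j + 1) hQ) hr hQ hz]
    have : (qa m a)⁻¹ * qa m a ^ (j + 1) = qa m a ^ j := by
      rw [pow_succ', ← mul_assoc, inv_mul_cancel₀ hQ, one_mul]
    rw [this]

/-- The coefficient of `e_a f_a ^ (j + 1) w` along `f_a ^ j w` vanishes only if
`r² = q_a ^ (2 j)`. -/
theorem string_coeff_ne_zero {Q : Cq} {j : ℕ} (hQ : Q = qa m a) (hr : r ≠ 0)
    (h : r ^ 2 ≠ Q ^ (2 * j)) :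
    (q - q⁻¹)⁻¹ ^ 2 * ((Q ^ (j + 1) - (Q ^ (j + 1))⁻¹) * (r * (Q ^ j)⁻¹ - r⁻¹ * Q ^ j)) ≠ 0 := by
  have hQ0 : Q ≠ 0 := hQ ▸ qa_ne_zero m a
  refine mul_ne_zero (pow_ne_zero _ (inv_ne_zero q_sub_inv_ne_zero)) (mul_ne_zero ?_ ?_)
  · intro h1
    rw [sub_eq_zero, ← mul_eq_one_iff_eq_inv₀ (pow_ne_zero _ hQ0), ← pow_add, ← two_mul, hQ,
      ← pow_zero (qa m a)] at h1
    have := qa_even_pow_inj (j := 0) h1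
    omega
  · intro h1
    refine h ?_
    rw [sub_eq_zero, ← div_eq_mul_inv, div_eq_iff (pow_ne_zero _ hQ0), mul_assoc, ← pow_add,
      ← two_mul, mul_comm, ← div_eq_mul_inv, eq_div_iff hr, ← pow_two] at h1
    exact h1

theorem HasRatio.F_pow_ne_zero (ha : (a : ℕ) ≠ m) (h : D.HasRatio a r w) (hr : r ≠ 0)
    (hE : D.E a w = 0) (hw : w ≠ 0) {s : ℕ} (hs : ∀ i < s, r ^ 2 ≠ qa m a ^ (2 * i)) :
    (D.F a ^ s) w ≠ 0 := by
  induction s with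
  | zero => exact hw
  | succ j ih =>
    intro h0
    have h1 := h.E_F_pow_succ ha hr hE j
    rw [h0, map_zero] at h1
    exact (smul_ne_zero (string_coeff_ne_zero rfl hr (hs j j.lt_succ_self))
      (ih fun i hi => hs i (hi.trans j.lt_succ_self))) h1.symm

/-- If `w ≠ 0` has the eigenvalue `± q_a ^ t` with `t ≥ 0` under `k_a`, then some vector of the
form `f_a ^ (r + t) e_a ^ r w` does not vanish: this is the reflection of `w`. -/
theorem HasRatio.exists_reflection (ha : (a : ℕ) ≠ m) (h : D.HasRatio a r w) (hw : w ≠ 0) {t : ℕ}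
    (hr : r ^ 2 = qa m a ^ (2 * t)) {N : ℕ} (hN : (D.E a ^ N) w = 0) :
    ∃ s, (D.F a ^ (s + t)) ((D.E a ^ s) w) ≠ 0 := by
  classical
  have hex : ∃ N, (D.E a ^ N) w = 0 := ⟨N, hN⟩
  have h0 : Nat.find hex ≠ 0 := fun h0 => hw (by have := Nat.find_spec hex; rwa [h0] at this)
  obtain ⟨s, hs⟩ := Nat.exists_eq_succ_of_ne_zero h0
  have hs1 : (D.E a ^ s) w ≠ 0 := Nat.find_min hex (by omega)
  have hs2 : D.E a ((D.E a ^ s) w) = 0 := by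
    have := Nat.find_spec hex
    rwa [hs, Nat.succ_eq_add_one, pow_succ', Module.End.mul_apply] at this
  have hQ := qa_ne_zero m a
  have hr2 : (r * (qa m a ^ s * qa m a ^ s)) ^ 2 = qa m a ^ (2 * (t + 2 * s)) := by
    rw [mul_pow, hr, ← pow_add, ← pow_mul, ← pow_add]
    congr 1; ring
  refine ⟨s, (h.E_pow ha s).F_pow_ne_zero ha ?_ hs2 hs1 fun i hi => ?_⟩
  · intro h3
    rw [h3, zero_pow two_ne_zero] at hr2
    exact pow_ne_zero _ hQ hr2.symm
  · rw [hr2]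
    intro h3
    have := qa_even_pow_inj h3
    omega

/-! ### Local nilpotency -/

theorem F_pow_apply_far {b : I' m n} (hc : Commute (D.F a) (D.F b)) {N : ℕ}
    (h : (D.F a ^ N) w = 0) : (D.F a ^ N) (D.F b w) = 0 := by
  rw [← Module.End.mul_apply, (hc.pow_left N).eq, Module.End.mul_apply, h, map_zero]

/-- By the Serre relation, `f_b` raises the order of nilpotency of `f_a` at a vector by at most
one. -/
theorem F_pow_apply_serre {b : I' m n} {y : Cq} (hs : serre y (D.F a) (D.F b) = 0) (N : ℕ) {w : W}
    (h : (D.F a ^ N) w = 0) : (D.F a ^ (N + 1)) (D.F b w) = 0 := by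
  have h2 : ∀ w, D.F a (D.F a (D.F b w))
      = (y + y⁻¹) • D.F a (D.F b (D.F a w)) - D.F b (D.F a (D.F a w)) := by
    intro w
    have := congrArg (fun z : Module.End Cq W => z w) hs
    simp only [serre, LinearMap.add_apply, LinearMap.sub_apply, LinearMap.smul_apply,
      Module.End.mul_apply, LinearMap.zero_apply] at this
    rw [sub_add] at this
    rw [← sub_eq_zero, ← this]
  induction N using Nat.strong_induction_on generalizing w with
  | _ N ih =>
    match N with
    | 0 =>
      have : w = 0 := h
      rw [this, map_zero, map_zero]
    | 1 =>
      rw [pow_one] at h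
      rw [pow_two, Module.End.mul_apply, h2, h]
      simp only [map_zero, smul_zero, sub_zero]
    | N + 2 =>
      have i1 : (D.F a ^ (N + 1)) (D.F a w) = 0 := by
        rw [← Module.End.mul_apply, ← pow_succ]; exact h
      have i2 : (D.F a ^ N) (D.F a (D.F a w)) = 0 := by
        rw [← Module.End.mul_apply, ← pow_succ]; exact i1
      have e1 : (D.F a ^ (N + 2 + 1)) (D.F b w)
          = (D.F a ^ (N + 1)) (D.F a (D.F a (D.F b w))) := by
        rw [show N + 2 + 1 = N + 1 + 1 + 1 by ring, pow_succ, Module.End.mul_apply, pow_succ,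
          Module.End.mul_apply]
      have e2 : (D.F a ^ (N + 1)) (D.F a (D.F b (D.F a w)))
          = (D.F a ^ (N + 1 + 1)) (D.F b (D.F a w)) := by
        rw [pow_succ _ (N + 1), Module.End.mul_apply]
      rw [e1, h2, map_sub, map_smul, e2, ih (N + 1) (by omega) i1, ih N (by omega) i2, smul_zero,
        sub_zero]

end CartanData

end

section

variable {m n : ℕ}

/-! ### Contents of words -/

/-- The number of letters `i` in a word. The index `i` ranges over all natural numbers, so that the
contents at `0` and from `m + n` on vanish, and takes integer values. -/
def content (l : List (I' m n)) (i : ℕ) : ℤ :=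
  (l.map fun x : I' m n => if (x : ℕ) = i then 1 else 0).sum

theorem content_cons (x : I' m n) (l : List (I' m n)) (i : ℕ) :
    content (x :: l) i = (if (x : ℕ) = i then 1 else 0) + content l i := rfl

theorem content_nonneg (l : List (I' m n)) (i : ℕ) : 0 ≤ content l i := by
  induction l with
  | nil => exact le_rfl
  | cons x l ih => rw [content_cons]; split_ifs <;> omega

theorem content_perm {l l' : List (I' m n)} (h : l.Perm l') : content l = content l' :=
  funext fun _ => (h.map _).sum_eq

theorem content_zero (l : List (I' m n)) : content l 0 = 0 := by
  induction l with
  | nil => rfl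
  | cons x l ih => rw [content_cons, ih, if_neg (by have := x.2.1; omega), add_zero]

theorem content_of_le (l : List (I' m n)) {i : ℕ} (hi : m + n ≤ i) : content l i = 0 := by
  induction l with
  | nil => rfl
  | cons x l ih => rw [content_cons, ih, if_neg (by have := x.2.2; omega), add_zero]

theorem length_eq_sum_content (l : List (I' m n)) :
    (l.length : ℤ) = ∑ i ∈ Finset.range (m + n), content l i := by
  induction l with
  | nil => simp [content]
  | cons x l ih =>
    simp only [content_cons, Finset.sum_add_distrib, ← ih, Finset.sum_ite_eq, Finset.mem_range,
      List.length_cons]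
    rw [if_pos x.2.2]
    push_cast
    ring

theorem countP_eq_content (l : List (I' m n)) (i : ℕ) :
    (l.countP (fun a : I' m n => (a : ℕ) = i) : ℤ) = content l i := by
  induction l with
  | nil => rfl
  | cons x l ih =>
    rw [content_cons, ← ih, List.countP_cons]
    simp only [decide_eq_true_eq]
    split_ifs <;> push_cast <;> ring

namespace CartanData

section Content

variable {W : Type*} [AddCommGroup W] [Module Cq W]
  (D : CartanData (id : I' m n → I' m n) (Module.End Cq W))

/-- The span of all vectors `f x₁ f x₂ ⋯ v` whose word has content `ν`. -/
def contentSpan (v : W) (ν : ℕ → ℤ) : Submodule Cq W :=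
  Submodule.span Cq ((fun l => D.word l v) '' {l | content l = ν})

variable {D} {v w : W} {ν : ℕ → ℤ}

theorem word_mem_contentSpan (l : List (I' m n)) : D.word l v ∈ D.contentSpan v (content l) :=
  Submodule.subset_span ⟨l, rfl, rfl⟩

theorem F_mem_contentSpan (x : I' m n) (hw : w ∈ D.contentSpan v ν) :
    D.F x w ∈ D.contentSpan v (Function.update ν x (ν x + 1)) := by
  have := Submodule.mem_map_of_mem (f := D.F x) hw
  rw [contentSpan, Submodule.map_span, ← Set.image_comp] at this
  refine Submodule.span_mono ?_ this
  rintro _ ⟨l, rfl, rfl⟩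
  refine ⟨x :: l, funext fun i => ?_, rfl⟩
  rw [content_cons, Function.update_apply]
  split_ifs with h1 h2 h2
  · rw [h2, add_comm]
  · exact (h2 h1.symm).elim
  · exact (h1 h2.symm).elim
  · rw [zero_add]

theorem F_pow_mem_contentSpan (x : I' m n) (hw : w ∈ D.contentSpan v ν) (j : ℕ) :
    (D.F x ^ j) w ∈ D.contentSpan v (Function.update ν x (ν x + j)) := by
  induction j with
  | zero => simpa using hw
  | succ j ih =>
    rw [pow_succ', Module.End.mul_apply]
    have := F_mem_contentSpan x ih
    rw [Function.update_idem, Function.update_self, add_assoc] at this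
    exact_mod_cast this

variable {Λ : Weight m n}

theorem IsSingular.E_mem_contentSpan (h : D.IsSingular Λ v) (x : I' m n)
    (hw : w ∈ D.contentSpan v ν) :
    D.E x w ∈ D.contentSpan v (Function.update ν x (ν x - 1)) := by
  have : D.contentSpan v ν ≤ (D.contentSpan v (Function.update ν x (ν x - 1))).comap (D.E x) := by
    refine Submodule.span_le.2 ?_
    rintro _ ⟨l, rfl, rfl⟩
    refine Submodule.span_mono (Set.image_mono fun l' hl' => funext fun i => ?_) (h.E_word x l)
    rw [← content_perm hl', Function.update_apply, content_cons, content_cons]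
    split_ifs with h1 h2 h2
    · rw [h1]; ring
    · exact (h2 rfl).elim
    · exact (h1 h2.symm).elim
    · rw [zero_add]
  exact this hw

theorem IsSingular.E_pow_mem_contentSpan (h : D.IsSingular Λ v) (x : I' m n)
    (hw : w ∈ D.contentSpan v ν) (j : ℕ) :
    (D.E x ^ j) w ∈ D.contentSpan v (Function.update ν x (ν x - j)) := by
  induction j with
  | zero => simpa using hw
  | succ j ih =>
    rw [pow_succ', Module.End.mul_apply]
    have := h.E_mem_contentSpan x ih
    rw [Function.update_idem, Function.update_self, sub_sub] at this
    exact_mod_cast this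

theorem exists_word_ne_zero (hw : w ∈ D.contentSpan v ν) (hw0 : w ≠ 0) :
    ∃ l, content l = ν ∧ D.word l v ≠ 0 := by
  by_contra! hl
  refine hw0 ?_
  have : D.contentSpan v ν ≤ ⊥ := by
    refine Submodule.span_le.2 ?_
    rintro _ ⟨l, h1, rfl⟩
    exact hl l h1
  exact (Submodule.mem_bot _).1 (this hw)

theorem IsSingular.exists_E_pow_eq_zero (h : D.IsSingular Λ v) (x : I' m n)
    (hw : w ∈ D.contentSpan v ν) : ∃ N, (D.E x ^ N) w = 0 := by
  refine ⟨(ν x + 1).toNat, ?_⟩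
  by_contra h0
  obtain ⟨l, hl, -⟩ := exists_word_ne_zero (h.E_pow_mem_contentSpan x hw _) h0
  have h1 := content_nonneg l x
  have h2 := Int.self_le_toNat (ν x + 1)
  rw [hl, Function.update_self] at h1
  omega

theorem qa_zpow_theta {a : I' m n} (ha : (a : ℕ) ≠ m) (x : I' m n) :
    theta a x = qa m a ^ ((if (x : ℕ) + 1 = a then 1 else 0) - 2 * (if (x : ℕ) = a then 1 else 0)
      + (if (x : ℕ) = a + 1 then 1 else 0) : ℤ) := by
  rcases lt_trichotomy (x : ℕ) a with h | h | h
  · by_cases h1 : (x : ℕ) + 1 = a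
    · rw [theta_pred h1.symm, if_pos h1, if_neg (by omega), if_neg (by omega)]; simp
    · rw [theta_far (.inr (by omega)), if_neg h1, if_neg (by omega), if_neg (by omega)]; simp
  · have : x = a := Subtype.ext h
    subst this
    rw [theta_self ha, if_neg (by omega), if_pos rfl, if_neg (by omega)]
    rw [show (0 - 2 * 1 + 0 : ℤ) = -1 + -1 by norm_num, zpow_add₀ (qa_ne_zero m x), zpow_neg_one]
  · by_cases h1 : (x : ℕ) = a + 1
    · rw [theta_succ h1, if_neg (by omega), if_neg (by omega), if_pos h1, h1]
      have : qa m (a + 1) = qa m a := by unfold qa; split_ifs <;> first | rfl | omega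
      rw [this]; simp
    · rw [theta_far (.inl (by omega)), if_neg (by omega), if_neg (by omega), if_neg h1]; simp

/-- Words of content `ν` multiply the eigenvalue of `k_a` by `q_a` to the power `pairing ν a`. -/
def pairing (ν : ℕ → ℤ) (a : ℕ) : ℤ := ν (a - 1) - 2 * ν a + ν (a + 1)

theorem hasRatio_word {a : I' m n} (ha : (a : ℕ) ≠ m) {r : Cq} (h : D.HasRatio a r v)
    (l : List (I' m n)) :
    D.HasRatio a (r * qa m a ^ pairing (content l) a) (D.word l v) := by
  induction l with
  | nil => exact h.congr (by simp [pairing, content])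
  | cons x l ih =>
    refine (ih.F x).congr ?_
    rw [qa_zpow_theta ha, mul_assoc, ← zpow_add₀ (qa_ne_zero m a)]
    congr 2
    have : (x : ℕ) + 1 = a ↔ (x : ℕ) = a - 1 := by have := x.2.1; omega
    simp only [pairing, content_cons, this]
    ring

theorem hasRatio_of_mem {a : I' m n} (ha : (a : ℕ) ≠ m) {r : Cq} (h : D.HasRatio a r v)
    (hw : w ∈ D.contentSpan v ν) : D.HasRatio a (r * qa m a ^ pairing ν a) w := by
  have h1 : D.contentSpan v ν ≤ (D.h a).eigenspace (r * qa m a ^ pairing ν a) := by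
    refine Submodule.span_le.2 ?_
    rintro _ ⟨l, rfl, rfl⟩
    exact Module.End.mem_eigenspace_iff.2 (hasRatio_word ha h l).1
  have h2 : D.contentSpan v ν ≤ (D.h' a).eigenspace (r * qa m a ^ pairing ν a)⁻¹ := by
    refine Submodule.span_le.2 ?_
    rintro _ ⟨l, rfl, rfl⟩
    exact Module.End.mem_eigenspace_iff.2 (hasRatio_word ha h l).2
  exact ⟨Module.End.mem_eigenspace_iff.1 (h1 hw), Module.End.mem_eigenspace_iff.1 (h2 hw)⟩

/-- The set of contents of nonvanishing words is invariant under the reflection at `a`. -/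
theorem IsSingular.exists_word_reflection (h : D.IsSingular Λ v) {a : I' m n} (ha : (a : ℕ) ≠ m)
    {r : Cq} (hv : D.HasRatio a r v) {k : ℕ} (hr : r ^ 2 = qa m a ^ (2 * k))
    (hF : ∀ l, ∃ N, (D.F a ^ N) (D.word l v) = 0) {l : List (I' m n)} (hl : D.word l v ≠ 0) :
    ∃ l', content l' = Function.update (content l) a
        (k + content l (a - 1) - content l a + content l (a + 1)) ∧ D.word l' v ≠ 0 := by
  have hQ := qa_ne_zero m a
  have hw := word_mem_contentSpan (D := D) (v := v) l
  have hR := hasRatio_of_mem ha hv hw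
  set t : ℤ := k + pairing (content l) a with ht
  have hR2 : (r * qa m a ^ pairing (content l) a) ^ 2 = qa m a ^ (2 * t) := by
    rw [mul_pow, hr, ← zpow_natCast, ← zpow_natCast, ← zpow_mul, ← zpow_add₀ hQ]
    congr 1
    push_cast
    ring
  -- the reflection adds `t` letters `a`: use `f_a ^ (s + t) e_a ^ s` or `e_a ^ (s - t) f_a ^ s`
  rcases le_total 0 t with h0 | h0
  · obtain ⟨t', ht'⟩ := Int.eq_ofNat_of_zero_le h0
    obtain ⟨N, hN⟩ := h.exists_E_pow_eq_zero a hw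
    obtain ⟨s, hs⟩ := hR.exists_reflection ha hl (t := t')
      (by rw [hR2, ht', ← zpow_natCast]; push_cast; rfl) hN
    obtain ⟨l', hl', hl0⟩ :=
      exists_word_ne_zero (F_pow_mem_contentSpan a (h.E_pow_mem_contentSpan a hw s) (s + t')) hs
    refine ⟨l', ?_, hl0⟩
    rw [hl', Function.update_idem, Function.update_self]
    congr 1
    simp only [pairing] at ht
    push_cast
    omega
  · obtain ⟨t', ht'⟩ := Int.eq_ofNat_of_zero_le (neg_nonneg.2 h0)
    obtain ⟨N, hN⟩ := hF l
    obtain ⟨s, hs⟩ := hR.swap.exists_reflection ha hl (t := t')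
      (by rw [inv_pow, hR2, ← zpow_neg, ← mul_neg, ht', ← zpow_natCast]; push_cast; rfl) hN
    obtain ⟨l', hl', hl0⟩ :=
      exists_word_ne_zero (h.E_pow_mem_contentSpan a (F_pow_mem_contentSpan a hw s) (s + t')) hs
    refine ⟨l', ?_, hl0⟩
    rw [hl', Function.update_idem, Function.update_self]
    congr 1
    simp only [pairing] at ht
    push_cast
    omega

end Content

end CartanData

/-! ### Boundedness of contents -/

/-- A set of contents which is bounded in the entry `m` and invariant under the reflections at the
other entries is bounded in every entry. -/
theorem exists_content_bound {S : Set (ℕ → ℤ)} {m N : ℕ} {B : ℤ} (ℓ : ℕ → ℤ)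
    (h0 : ∀ ν ∈ S, ∀ i, 0 ≤ ν i) (hz : ∀ ν ∈ S, ν 0 = 0) (hN : ∀ ν ∈ S, ∀ i, N ≤ i → ν i = 0)
    (hm : ∀ ν ∈ S, ν m ≤ B)
    (hs : ∀ ν ∈ S, ∀ a, 1 ≤ a → a < N → a ≠ m →
      Function.update ν a (ℓ a + ν (a - 1) - ν a + ν (a + 1)) ∈ S) (i : ℕ) :
    ∃ C : ℤ, ∀ ν ∈ S, ν i ≤ C := by
  -- successive differences on either side of `m` are controlled, starting from the outer ends
  have left : ∀ i, i < m → ∃ C : ℤ, ∀ ν ∈ S, ν i - ν (i + 1) ≤ C := by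
    intro i
    induction i with
    | zero => exact fun _ => ⟨0, fun ν hν => by have := h0 ν hν (0 + 1); rw [hz ν hν]; omega⟩
    | succ i ih =>
      intro hi
      obtain ⟨C, hC⟩ := ih (by omega)
      by_cases hiN : i + 1 < N
      · refine ⟨C + ℓ (i + 1), fun ν hν => ?_⟩
        have := hC _ (hs ν hν (i + 1) (by omega) hiN (by omega))
        rw [Function.update_self, Function.update_of_ne (by omega), Nat.add_sub_cancel] at this
        linarith
      · refine ⟨0, fun ν hν => ?_⟩
        rw [hN ν hν (i + 1) (by omega), hN ν hν (i + 1 + 1) (by omega), sub_zero]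
  have right : ∀ d i, m ≤ i → N ≤ i + d → ∃ C : ℤ, ∀ ν ∈ S, ν (i + 1) - ν i ≤ C := by
    intro d
    induction d with
    | zero =>
      refine fun i _ hi => ⟨0, fun ν hν => ?_⟩
      rw [hN ν hν i (by omega), hN ν hν (i + 1) (by omega), sub_zero]
    | succ d ih =>
      intro i hmi hi
      obtain ⟨C, hC⟩ := ih (i + 1) (by omega) (by omega)
      by_cases hiN : i + 1 < N
      · refine ⟨C + ℓ (i + 1), fun ν hν => ?_⟩
        have := hC _ (hs ν hν (i + 1) (by omega) hiN (by omega))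
        rw [Function.update_self, Function.update_of_ne (by omega), Nat.add_sub_cancel] at this
        linarith
      · refine ⟨0, fun ν hν => ?_⟩
        have := h0 ν hν i
        rw [hN ν hν (i + 1) (by omega)]
        omega
  rcases le_total i m with him | him
  · obtain ⟨d, hd⟩ := Nat.exists_eq_add_of_le him
    induction d generalizing i with
    | zero => exact ⟨B, fun ν hν => by have := hm ν hν; rwa [hd, add_zero] at this⟩
    | succ d ih =>
      obtain ⟨C, hC⟩ := ih (i + 1) (by omega) (by omega)
      obtain ⟨C', hC'⟩ := left i (by omega)
      exact ⟨C + C', fun ν hν => by linarith [hC ν hν, hC' ν hν]⟩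
  · induction i, him using Nat.le_induction with
    | base => exact ⟨B, hm⟩
    | succ i hi ih =>
      obtain ⟨C, hC⟩ := ih
      obtain ⟨C', hC'⟩ := right N i hi (by omega)
      exact ⟨C + C', fun ν hν => by linarith [hC ν hν, hC' ν hν]⟩

end

section

variable {m n : ℕ}

/-! ### Finite dimensionality -/

namespace CartanData

variable {X : Type*} {ix : X → I' m n} {W : Type*} [AddCommGroup W] [Module Cq W]
  {D : CartanData ix (Module.End Cq W)} {Λ : Weight m n} {v : W}

/-- On a finite dimensional module long words vanish, because the height operator takes different
eigenvalues on words of different heights. -/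
theorem exists_word_eq_zero [FiniteDimensional Cq W] (h : ∀ b, D.k b v = (Λ b : Cq) • v) :
    ∃ N, ∀ l, N ≤ l.length → D.word l v = 0 := by
  set g : ℕ → Cq := fun k => (∏ b, (Λ b : Cq) ^ rhoExp b) * (q ^ (2 * k))⁻¹ with hg
  have hinj : Function.Injective g := by
    intro i j hij
    have h1 := inv_injective (mul_left_cancel₀ (prod_pow_rhoExp_ne_zero Λ) hij)
    have h2 : qa m 0 = q := if_pos (Nat.zero_le _)
    rw [← h2] at h1
    exact qa_even_pow_inj h1
  have hfin : {k | Module.End.HasEigenvalue D.rho (g k)}.Finite :=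
    (Module.End.finite_hasEigenvalue D.rho).preimage hinj.injOn
  obtain ⟨N, hN⟩ := hfin.bddAbove
  refine ⟨N + 1, fun l hl => ?_⟩
  by_contra h0
  have h1 : Module.End.HasEigenvalue D.rho (g (l.map fun x => height (ix x)).sum) :=
    Module.End.hasEigenvalue_of_hasEigenvector
      ⟨Module.End.mem_eigenspace_iff.2 (rho_word h l), h0⟩
  have h2 := hN h1
  have h3 := length_le_sum_height ix l
  omega

theorem word_replicate (x : X) (j : ℕ) : D.word (List.replicate j x) v = (D.F x ^ j) v := by
  rw [word, List.map_replicate, List.prod_replicate]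

end CartanData

variable {W : Type*} [AddCommGroup W] [Module Cq W] [Module (U m n) W]
  [IsScalarTower Cq (U m n) W] {Λ : Weight m n} {v : W}

theorem hasRatio_of_isSingular (h : (uData m n W).IsSingular Λ v) (a : I' m n) :
    (uData m n W).HasRatio a (Λ a.inc / Λ a.next : Cq) v :=
  CartanData.hasRatio_of_k (Λ a.inc).ne_zero (Λ a.next).ne_zero (h.k_apply _) (h.k_apply _)

theorem div_weight_ne_zero (Λ : Weight m n) (a : I' m n) : (Λ a.inc / Λ a.next : Cq) ≠ 0 :=
  div_ne_zero (Λ a.inc).ne_zero (Λ a.next).ne_zero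

theorem intUnit_cast_sq (ω : ℤˣ) : ((ω : ℤ) : Cq) ^ 2 = 1 := by
  rcases Int.units_eq_one_or ω with rfl | rfl <;> simp

/-- Highest weights of finite dimensional modules satisfy the integrality condition. -/
theorem fdCondition_of_finiteDimensional [FiniteDimensional Cq W]
    (h : (uData m n W).IsSingular Λ v) (h0 : v ≠ 0) : FDCondition Λ := by
  have key : ∀ a : I' m n, ∃ (ω : ℤˣ) (ℓ : ℕ), (a : ℕ) ≠ m →
      (Λ a.inc : Cq) / (Λ a.next : Cq) = ((ω : ℤ) : Cq) * qa m a ^ ℓ := by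
    intro a
    by_cases ha : (a : ℕ) = m
    · exact ⟨1, 0, fun h => (h ha).elim⟩
    obtain ⟨N, hN⟩ := CartanData.exists_word_eq_zero h.k_apply
    classical
    have hex : ∃ j, ((uData m n W).F a ^ j) v = 0 := ⟨N, by
      rw [← CartanData.word_replicate]; exact hN _ (by rw [List.length_replicate])⟩
    have h1 : Nat.find hex ≠ 0 := fun h1 => h0 (by have := Nat.find_spec hex; rwa [h1] at this)
    -- the last nonvanishing vector of the string is `f_a ^ j v`
    obtain ⟨j, hj⟩ := Nat.exists_eq_succ_of_ne_zero h1
    have h2 : ((uData m n W).F a ^ j) v ≠ 0 := Nat.find_min hex (by omega)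
    have h3 : ((uData m n W).F a ^ (j + 1)) v = 0 := by
      have := Nat.find_spec hex
      rwa [hj] at this
    have h4 := (hasRatio_of_isSingular h a).E_F_pow_succ ha (div_weight_ne_zero Λ a) (h.E_apply a) j
    rw [h3, map_zero] at h4
    have h5 : (Λ a.inc / Λ a.next : Cq) ^ 2 = qa m a ^ (2 * j) := by
      by_contra h5
      exact smul_ne_zero (CartanData.string_coeff_ne_zero rfl (div_weight_ne_zero Λ a) h5) h2
        h4.symm
    rw [mul_comm 2 j, pow_mul, sq_eq_sq_iff_eq_or_eq_neg] at h5
    rcases h5 with h5 | h5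
    · exact ⟨1, j, fun _ => by rw [h5]; simp⟩
    · exact ⟨-1, j, fun _ => by rw [h5]; simp⟩
  choose ω ℓ hωℓ using key
  exact ⟨ω, ℓ, hωℓ⟩

/-- In a simple module, a weight vector of lower height that is annihilated by all `e_b` is zero. -/
theorem eq_zero_of_isSingular [IsSimpleModule (U m n) W] (h : (uData m n W).IsSingular Λ v)
    (h0 : v ≠ 0) {Λ' : Weight m n} {y : W} (hy : (uData m n W).IsSingular Λ' y)
    (hyv : y ∈ (uData m n W).posSpan v) : y = 0 := by
  by_contra hy0
  have h1 : (uData m n W).wordSpan y ≤ (uData m n W).posSpan v := by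
    refine Submodule.span_le.2 ?_
    rintro _ ⟨l, rfl⟩
    change (uData m n W).word l y ∈ (uData m n W).posSpan v
    induction l with
    | nil => exact hyv
    | cons a l ih => exact h.borel_mem_posSpan (CartanData.F_mem_borel _ a) ih
  rw [wordSpan_eq_top hy (span_eq_top_of_simple hy0)] at h1
  exact h.notMem_posSpan h0 (h1 Submodule.mem_top)

/-- The vector `f_a ^ (k + 1) v` is annihilated by all `e_b`, hence vanishes. -/
theorem F_pow_vec_eq_zero [IsSimpleModule (U m n) W] (h : (uData m n W).IsSingular Λ v)
    (h0 : v ≠ 0) {a : I' m n} (ha : (a : ℕ) ≠ m) {k : ℕ}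
    (hk : (Λ a.inc / Λ a.next : Cq) ^ 2 = qa m a ^ (2 * k)) :
    ((uData m n W).F a ^ (k + 1)) v = 0 := by
  refine eq_zero_of_isSingular h h0 (Λ' := fun b => Units.mk0 _
    (CartanData.weight_mul_ne_zero (ix := id) Λ b (List.replicate (k + 1) a))) ⟨fun b => ?_,
      fun b => ?_⟩ ?_
  · by_cases hb : b = a
    · subst hb
      have hr := div_weight_ne_zero Λ b
      have hQ := pow_ne_zero k (qa_ne_zero m b)
      have h1 : (Λ b.inc / Λ b.next : Cq) * (qa m b ^ k)⁻¹
          - (Λ b.inc / Λ b.next : Cq)⁻¹ * qa m b ^ k = 0 := by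
        rw [sub_eq_zero, ← div_eq_mul_inv, div_eq_iff hQ, mul_assoc, ← pow_add,
          ← two_mul, mul_comm, ← div_eq_mul_inv, eq_div_iff hr, ← pow_two]
        exact hk
      rw [(hasRatio_of_isSingular h b).E_F_pow_succ ha hr (h.E_apply b), h1, mul_zero, mul_zero,
        zero_smul]
    · rw [← Module.End.mul_apply, (((uData m n W).E_F_ne b a hb).pow_right (k + 1)).eq,
        Module.End.mul_apply, h.E_apply, map_zero]
  · rw [← CartanData.word_replicate]
    exact h.k_word b _
  · rw [← CartanData.word_replicate]
    exact Submodule.subset_span ⟨_, by simp, rfl⟩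

/-- If `f_a` acts nilpotently on `v`, then it acts nilpotently on every word. -/
theorem F_pow_word_eq_zero {a : I' m n} (ha : (a : ℕ) ≠ m) {k : ℕ}
    (hk : ((uData m n W).F a ^ k) v = 0) (l : List (I' m n)) :
    ∃ N, ((uData m n W).F a ^ N) ((uData m n W).word l v) = 0 := by
  induction l with
  | nil => exact ⟨k, hk⟩
  | cons x l ih =>
    obtain ⟨N, hN⟩ := ih
    rw [CartanData.word_cons]
    let φ := Algebra.lsmul Cq (A := U m n) Cq W
    by_cases h1 : (x : ℕ) = a + 1 ∨ (a : ℕ) = x + 1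
    · refine ⟨N + 1, CartanData.F_pow_apply_serre (y := qa m a) ?_ N hN⟩
      have := congrArg φ (serre_f ha h1)
      simp only [serre, map_add, map_sub, map_smul, map_mul, map_zero] at this
      exact this
    · refine ⟨N, CartanData.F_pow_apply_far ?_ hN⟩
      by_cases h2 : (x : ℕ) = a
      · rw [show x = a from Subtype.ext h2]
      · exact (f_comm_f (by omega)).map φ

/-- A word with more than `m n` odd letters vanishes. -/
theorem word_eq_zero_of_content (hm : 0 < m) (hn : 0 < n) {l : List (I' m n)}
    (hl : ((m * n : ℕ) : ℤ) < content l m) : (uData m n W).word l v = 0 := by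
  rw [← countP_eq_content, Nat.cast_lt] at hl
  refine (CartanData.map_word (uCartan m n) _ l v).trans ?_
  change Algebra.lsmul Cq Cq W (l.map f).prod v = 0
  rw [prod_f_eq_zero hm hn l hl, map_zero, LinearMap.zero_apply]

/-- A simple module whose highest weight satisfies the integrality condition is finite
dimensional: the contents of its nonvanishing words are bounded. -/
theorem finiteDimensional_of_fdCondition (hm : 0 < m) (hn : 0 < n) [IsSimpleModule (U m n) W]
    (h : (uData m n W).IsSingular Λ v) (h0 : v ≠ 0) (hΛ : FDCondition Λ) :
    FiniteDimensional Cq W := by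
  obtain ⟨ω, ℓ, hωℓ⟩ := hΛ
  have hsq : ∀ a : I' m n, (a : ℕ) ≠ m →
      (Λ a.inc / Λ a.next : Cq) ^ 2 = qa m a ^ (2 * ℓ a) := by
    intro a ha
    rw [hωℓ a ha, mul_pow, intUnit_cast_sq, one_mul, ← pow_mul, mul_comm]
  set S : Set (ℕ → ℤ) := {ν | ∃ l : List (I' m n), content l = ν ∧ (uData m n W).word l v ≠ 0}
    with hS
  have hb : ∀ i, ∃ C : ℤ, ∀ ν ∈ S, ν i ≤ C := by
    refine exists_content_bound (m := m) (N := m + n) (B := ((m * n : ℕ) : ℤ))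
      (fun i => if hi : i ∈ Set.Ico 1 (m + n) then ℓ ⟨i, hi⟩ else 0) ?_ ?_ ?_ ?_ ?_
    · rintro _ ⟨l, rfl, -⟩ i
      exact content_nonneg l i
    · rintro _ ⟨l, rfl, -⟩
      exact content_zero l
    · rintro _ ⟨l, rfl, -⟩ i hi
      exact content_of_le l hi
    · rintro _ ⟨l, rfl, hl⟩
      by_contra hlt
      exact hl (word_eq_zero_of_content hm hn (not_le.1 hlt))
    · rintro _ ⟨l, rfl, hl⟩ a ha1 ha2 ham
      have haI : a ∈ Set.Ico 1 (m + n) := ⟨ha1, ha2⟩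
      rw [dif_pos haI]
      exact h.exists_word_reflection (a := ⟨a, haI⟩) ham (hasRatio_of_isSingular h _) (hsq _ ham)
        (F_pow_word_eq_zero ham (F_pow_vec_eq_zero h h0 ham (hsq _ ham))) hl
  choose C hC using hb
  set N : ℕ := (∑ i ∈ Finset.range (m + n), C i).toNat with hN
  have hlen : ∀ l : List (I' m n), (uData m n W).word l v ≠ 0 → l.length ≤ N := by
    intro l hl
    have h1 : (l.length : ℤ) ≤ ∑ i ∈ Finset.range (m + n), C i := by
      rw [length_eq_sum_content]
      exact Finset.sum_le_sum fun i _ => hC i _ ⟨l, rfl, hl⟩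
    omega
  have hfin : ((fun l => (uData m n W).word l v) '' {l | l.length ≤ N}).Finite :=
    (List.finite_length_le _ N).image _
  refine ⟨Submodule.fg_def.2 ⟨_, hfin, ?_⟩⟩
  rw [eq_top_iff, ← wordSpan_eq_top h (span_eq_top_of_simple h0)]
  refine Submodule.span_le.2 ?_
  rintro _ ⟨l, rfl⟩
  by_cases hl : (uData m n W).word l v = 0
  · change (uData m n W).word l v ∈ _
    rw [hl]
    exact Submodule.zero_mem _
  · exact Submodule.subset_span ⟨l, hlen l hl, rfl⟩

end

section

variable {m n : ℕ}

/-! ### The parametrisation -/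

theorem fdCondition_of_hasParams {Λ : Weight m n} {x : Params m n} (h : HasParams Λ x) :
    FDCondition Λ := by
  classical
  refine ⟨fun a => if ha : (a : ℕ) ≠ m then x.1 ⟨a, ha⟩ else 1,
    fun a => if ha : (a : ℕ) ≠ m then x.2.1 ⟨a, ha⟩ else 0, fun a ha => ?_⟩
  beta_reduce
  rw [dif_pos ha, dif_pos ha]
  exact h.1 ⟨a, ha⟩

theorem exists_hasParams (hm : 0 < m) (hn : 0 < n) {Λ : Weight m n} (h : FDCondition Λ) :
    ∃ x : Params m n, HasParams Λ x := by
  obtain ⟨ω, ℓ, hωℓ⟩ := h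
  refine ⟨⟨fun a => ω a, fun a => ℓ a, Λ ⟨m, by omega, by omega⟩,
    Λ ⟨m + 1, by omega, by omega⟩⟩, fun a => hωℓ a a.2, fun b hb => ?_, fun b hb => ?_⟩
  · rw [show b = ⟨m, by omega, by omega⟩ from Subtype.ext hb]
  · rw [show b = ⟨m + 1, by omega, by omega⟩ from Subtype.ext hb]

/-- The ratio `λ_a / λ_{a+1}` prescribed by parameters, and `1` for `a` outside the range. -/
def Params.ratio (x : Params m n) (i : ℕ) : Cqˣ :=
  if h : ∃ hi : i ∈ Set.Ico 1 (m + n), i ≠ m then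
    Units.mk0 (((x.1 ⟨⟨i, h.1⟩, h.2⟩ : ℤ) : Cq) * qa m i ^ x.2.1 ⟨⟨i, h.1⟩, h.2⟩)
      (mul_ne_zero (by rcases Int.units_eq_one_or (x.1 ⟨⟨i, h.1⟩, h.2⟩) with h | h <;> simp [h])
        (pow_ne_zero _ (qa_ne_zero m i)))
  else 1

theorem Params.coe_ratio (x : Params m n) (a : {a : I' m n // (a : ℕ) ≠ m}) :
    (x.ratio a.1 : Cq) = ((x.1 a : ℤ) : Cq) * qa m a.1 ^ x.2.1 a := by
  rw [ratio, dif_pos ⟨a.1.2, a.2⟩]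
  rfl

/-- The weight with given parameters. -/
def Params.weight (x : Params m n) : Weight m n := fun b =>
  if (b : ℕ) ≤ m then x.2.2.1 * ∏ i ∈ Finset.Ico (b : ℕ) m, x.ratio i
  else x.2.2.2 * (∏ i ∈ Finset.Ico (m + 1) (b : ℕ), x.ratio i)⁻¹

theorem Params.hasParams_weight (x : Params m n) : HasParams x.weight x := by
  refine ⟨fun a => ?_, fun b hb => ?_, fun b hb => ?_⟩
  · rw [← x.coe_ratio, div_eq_iff (Units.ne_zero _), ← Units.val_mul, Units.val_inj]
    have h1 : (a.1.inc : ℕ) = a.1 := rfl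
    have h2 : (a.1.next : ℕ) = a.1 + 1 := rfl
    rw [weight, weight, h1, h2]
    rcases lt_or_gt_of_ne a.2 with h | h
    · rw [if_pos h.le, if_pos (Nat.succ_le_of_lt h), Finset.prod_eq_prod_Ico_succ_bot h]
      exact mul_left_comm _ _ _
    · rw [if_neg (by omega), if_neg (by omega), Finset.prod_Ico_succ_top (by omega), mul_inv,
        mul_left_comm, mul_left_comm (x.ratio _), mul_inv_cancel, mul_one]
  · rw [weight, if_pos hb.le, hb, Finset.Ico_self, Finset.prod_empty, mul_one]
  · rw [weight, if_neg (by omega), hb, Finset.Ico_self, Finset.prod_empty, inv_one, mul_one]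

theorem Params.eq_weight {x : Params m n} {Λ : Weight m n} (h : HasParams Λ x) : Λ = x.weight := by
  have hx := x.hasParams_weight
  -- both weights have the same ratios and agree at `m` and at `m + 1`
  have hr : ∀ a : I' m n, (a : ℕ) ≠ m → Λ a.inc / Λ a.next = x.weight a.inc / x.weight a.next :=
    fun a ha => Units.ext <| by
      rw [Units.val_div_eq_div_val, Units.val_div_eq_div_val, h.1 ⟨a, ha⟩, hx.1 ⟨a, ha⟩]
  have hle : ∀ d i (hi : i ∈ Set.Icc 1 (m + n)), i + d = m → Λ ⟨i, hi⟩ = x.weight ⟨i, hi⟩ := by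
    intro d
    induction d with
    | zero => exact fun i hi him => by rw [h.2.1 _ him, hx.2.1 _ him]
    | succ d ih =>
      intro i hi him
      have h1 := hr ⟨i, hi.1, by omega⟩ (by change i ≠ m; omega)
      have h2 := ih (i + 1) ⟨by omega, by omega⟩ (by omega)
      simp only [I'.inc, I'.next] at h1
      rw [h2] at h1
      exact div_left_injective h1
  have hgt : ∀ d i (hi : i ∈ Set.Icc 1 (m + n)), i = m + 1 + d → Λ ⟨i, hi⟩ = x.weight ⟨i, hi⟩ := by
    intro d
    induction d with
    | zero => exact fun i hi him => by rw [h.2.2 _ him, hx.2.2 _ him]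
    | succ d ih =>
      rintro i hi rfl
      have h1 := hr ⟨m + 1 + d, by omega, by have := hi.2; omega⟩ (by change m + 1 + d ≠ m; omega)
      have h2 := ih (m + 1 + d) ⟨by omega, by have := hi.2; omega⟩ rfl
      simp only [I'.inc, I'.next] at h1
      rw [h2] at h1
      exact div_right_injective h1
  funext b
  rcases le_or_gt (b : ℕ) m with hb | hb
  · exact hle (m - b) b b.2 (by omega)
  · exact hgt (b - (m + 1)) b b.2 (by omega)

theorem Params.eq_of_hasParams (hm : 0 < m) (hn : 0 < n) {x y : Params m n} {Λ : Weight m n}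
    (hx : HasParams Λ x) (hy : HasParams Λ y) : x = y := by
  have h1 : ∀ a, x.1 a = y.1 a ∧ x.2.1 a = y.2.1 a := by
    intro a
    have h := (hx.1 a).symm.trans (hy.1 a)
    have hQ := qa_ne_zero m a.1
    have hsq := congrArg (· ^ 2) h
    simp only [mul_pow, intUnit_cast_sq, one_mul, ← pow_mul] at hsq
    rw [mul_comm, mul_comm _ 2] at hsq
    have h2 := qa_even_pow_inj hsq
    refine ⟨?_, h2⟩
    rw [h2] at h
    have h3 := mul_right_cancel₀ (pow_ne_zero _ hQ) h
    exact Units.ext (Int.cast_injective h3)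
  refine Prod.ext (funext fun a => (h1 a).1) (Prod.ext (funext fun a => (h1 a).2)
    (Prod.ext ?_ ?_))
  · exact (hx.2.1 ⟨m, by omega, by omega⟩ rfl).symm.trans (hy.2.1 _ rfl)
  · exact (hx.2.2 ⟨m + 1, by omega, by omega⟩ rfl).symm.trans (hy.2.2 _ rfl)

/-! ### Finite dimensional simple weight modules -/

/-- A nonzero finite dimensional weight module contains a highest weight vector: apply a product of
`e`'s of maximal length that does not annihilate a given weight vector. -/
theorem exists_isSingular {W : Type*} [AddCommGroup W] [Module Cq W] [Module (U m n) W]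
    [IsScalarTower Cq (U m n) W] [FiniteDimensional Cq W] [Nontrivial W]
    (h : IsWeightModule m n W) :
    ∃ (Λ : Weight m n) (v : W), v ≠ 0 ∧ (uData m n W).IsSingular Λ v := by
  obtain ⟨w, ⟨μ, hμ⟩, hw⟩ : ∃ w ∈ {w : W | ∃ Λ : Weight m n, ∀ b : I m n, K b • w = (Λ b : Cq) • w},
      w ≠ 0 := by
    by_contra! hc
    have h1 : Submodule.span Cq {w : W | ∃ Λ : Weight m n, ∀ b, K b • w = (Λ b : Cq) • w} ≤ ⊥ :=
      Submodule.span_le.2 hc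
    rw [show Submodule.span Cq _ = ⊤ from h] at h1
    exact bot_ne_top (eq_top_iff.2 h1)
  -- products of `e`'s are the words of the data in which `e` and `f` are exchanged
  set D := (uData m n W).swap with hD
  have hk : ∀ b, D.k b w = (((μ b)⁻¹ : Cqˣ) : Cq) • w := fun b => by
    rw [Units.val_inv_eq_inv_val]
    exact (uData m n W).kinv_apply (μ b).ne_zero (hμ b)
  obtain ⟨N, hN⟩ := CartanData.exists_word_eq_zero (Λ := fun b => (μ b)⁻¹) hk
  classical
  have hex : ∃ N, ∀ l, N ≤ l.length → D.word l w = 0 := ⟨N, hN⟩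
  have h0 : Nat.find hex ≠ 0 := fun h0 => hw (Nat.find_spec hex [] (by rw [h0]; exact le_rfl))
  obtain ⟨s, hs⟩ := Nat.exists_eq_succ_of_ne_zero h0
  have h1 := Nat.find_min hex (m := s) (by omega)
  push Not at h1
  obtain ⟨l, hl, hl0⟩ := h1
  refine ⟨fun b =>
      (Units.mk0 _ (CartanData.weight_mul_ne_zero (ix := id) (fun b => (μ b)⁻¹) b l))⁻¹,
    D.word l w, hl0, fun a => ?_, fun b => ?_⟩
  · exact Nat.find_spec hex (a :: l) (by rw [hs, List.length_cons]; omega)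
  · rw [Units.val_inv_eq_inv_val]
    exact D.kinv_apply (Units.ne_zero _) (D.k_word (hk b) l)

theorem finiteDimensional_L_iff (hm : 0 < m) (hn : 0 < n) (Λ : Weight m n) :
    FiniteDimensional Cq (L Λ) ↔ FDCondition Λ := by
  have := isSimpleModule_L Λ
  exact ⟨fun _ => fdCondition_of_finiteDimensional (L.isSingular_vec Λ) (L.vec_ne_zero Λ),
    finiteDimensional_of_fdCondition hm hn (L.isSingular_vec Λ) (L.vec_ne_zero Λ)⟩

/-- Isomorphic modules `L(Λ)` have the same highest weight. -/
theorem weight_eq_of_equiv {W : Type*} [AddCommGroup W] [Module Cq W] [Module (U m n) W]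
    [IsScalarTower Cq (U m n) W] [IsSimpleModule (U m n) W] {Λ Λ' : Weight m n}
    (φ : W ≃ₗ[U m n] L Λ) (φ' : W ≃ₗ[U m n] L Λ') : Λ = Λ' := by
  have key : ∀ {M : Weight m n} (ψ : W ≃ₗ[U m n] L M),
      (uData m n W).IsSingular M (ψ.symm (L.vec M)) := fun {M} ψ =>
    ⟨fun a => (ψ.symm.map_smul (e a) (L.vec M)).symm.trans
      ((congrArg ψ.symm ((L.isSingular_vec M).E_apply a)).trans (map_zero _)),
    fun b => (ψ.symm.map_smul (K b) (L.vec M)).symm.trans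
      ((congrArg ψ.symm ((L.isSingular_vec M).k_apply b)).trans
        ((ψ.symm.toLinearMap.restrictScalars Cq).map_smul (M b : Cq) (L.vec M)))⟩
  exact weight_unique (key φ) (fun h => L.vec_ne_zero Λ ((map_eq_zero_iff _ φ.symm.injective).1 h))
    (key φ') (fun h => L.vec_ne_zero Λ' ((map_eq_zero_iff _ φ'.symm.injective).1 h))

theorem existsUnique_params (hm : 0 < m) (hn : 0 < n) (W : Type*) [AddCommGroup W] [Module Cq W]
    [Module (U m n) W] [IsScalarTower Cq (U m n) W] [FiniteDimensional Cq W]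
    [IsSimpleModule (U m n) W] (h : IsWeightModule m n W) :
    ∃! x : Params m n, ∃ Λ : Weight m n, HasParams Λ x ∧ Nonempty (W ≃ₗ[U m n] L Λ) := by
  have := IsSimpleModule.nontrivial (U m n) W
  obtain ⟨Λ, v, h0, hv⟩ := exists_isSingular h
  obtain ⟨x, hx⟩ := exists_hasParams hm hn (fdCondition_of_finiteDimensional hv h0)
  obtain ⟨φ⟩ := nonempty_equiv_L hv h0
  refine ⟨x, ⟨Λ, hx, ⟨φ⟩⟩, ?_⟩
  rintro y ⟨Λ', hy, ⟨φ'⟩⟩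
  obtain rfl := weight_eq_of_equiv φ φ'
  exact Params.eq_of_hasParams hm hn hy hx

end

end DegenerateQuantumGL

end

theorem mainTheorem2 (m n : ℕ) (hm : 0 < m) (hn : 0 < n) :
    -- the modules `L(Λ)`, and when they are finite dimensional
    (∀ Λ : DegenerateQuantumGL.Weight m n,
      IsSimpleModule (DegenerateQuantumGL.Ug0 m n) (DegenerateQuantumGL.L0 Λ) ∧
      IsSimpleModule (DegenerateQuantumGL.U m n) (DegenerateQuantumGL.L Λ) ∧
      DegenerateQuantumGL.IsHighestWeightModule Λ (DegenerateQuantumGL.L Λ) ∧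
      DegenerateQuantumGL.IsWeightModule m n (DegenerateQuantumGL.L Λ) ∧
      (FiniteDimensional DegenerateQuantumGL.Cq (DegenerateQuantumGL.L Λ) ↔
        DegenerateQuantumGL.FDCondition Λ)) ∧
    -- the parametrisation: every parameter gives a finite dimensional `L(Λ)`, and every finite
    -- dimensional simple weight module arises from exactly one parameter
    (∀ x : DegenerateQuantumGL.Params m n, ∃! Λ : DegenerateQuantumGL.Weight m n,
      DegenerateQuantumGL.HasParams Λ x) ∧
    (∀ (x : DegenerateQuantumGL.Params m n) (Λ : DegenerateQuantumGL.Weight m n),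
      DegenerateQuantumGL.HasParams Λ x →
        FiniteDimensional DegenerateQuantumGL.Cq (DegenerateQuantumGL.L Λ)) ∧
    (∀ (W : Type*) [AddCommGroup W] [Module DegenerateQuantumGL.Cq W]
      [Module (DegenerateQuantumGL.U m n) W]
      [IsScalarTower DegenerateQuantumGL.Cq (DegenerateQuantumGL.U m n) W],
      FiniteDimensional DegenerateQuantumGL.Cq W →
      IsSimpleModule (DegenerateQuantumGL.U m n) W →
      DegenerateQuantumGL.IsWeightModule m n W →
      ∃! x : DegenerateQuantumGL.Params m n, ∃ Λ : DegenerateQuantumGL.Weight m n,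
        DegenerateQuantumGL.HasParams Λ x ∧
        Nonempty (W ≃ₗ[DegenerateQuantumGL.U m n] DegenerateQuantumGL.L Λ)) := by
  refine ⟨fun Λ => ⟨DegenerateQuantumGL.isSimpleModule_L0 Λ, DegenerateQuantumGL.isSimpleModule_L Λ,
      DegenerateQuantumGL.isHighestWeightModule_L Λ, DegenerateQuantumGL.isWeightModule_L Λ,
      DegenerateQuantumGL.finiteDimensional_L_iff hm hn Λ⟩,
    fun x => ⟨x.weight, x.hasParams_weight, fun Λ h => DegenerateQuantumGL.Params.eq_weight h⟩,
    fun x Λ h => (DegenerateQuantumGL.finiteDimensional_L_iff hm hn Λ).2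
      (DegenerateQuantumGL.fdCondition_of_hasParams h), ?_⟩
  intro W _ _ _ _ _ _ h
  exact DegenerateQuantumGL.existsUnique_params hm hn W h
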